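/- Let $S$ be a noetherian algebraic stack, let $\mathcal F$ be a coherent $\mathcal O_S$-module and let $\Delta\subseteq\mathbb N$ be a subset. Then there is a largest open substack $U\subseteq S$ such that $\mathcal F|_U$ is locally free with ranks in $\Delta$. There exists a closed substack $Z=Z(S,\mathcal F,\Delta)\subseteq S$, defined by an ideal of finite type, with underlying set $|Z|=|S|\smallsetminus |U|$, such that, for the blow-up $\pi\colon S'=\mathrm{Bl}_Z S\to S$, the strict transform of $\mathcal F$, that is, the quotient of $\pi^*\mathcal F$ by the kernel of $\pi^*\mathcal F\to j_*j^*\pi^*\mathcal F$ where $j\colon \pi^{-1}(U)\to S'$ is the inclusion, is locally free with ranks in $\Delta$. Moreover, $Z$ can be chosen functorially with respect to flat morphisms: if $g\colon T\to S$ is a flat morphism of noetherian algebraic stacks and $\mathcal G\cong g^*\mathcal F$, then $Z(T,\mathcal G,\Delta)=g^{-1}(Z(S,\mathcal F,\Delta))$. Explicitly, one may take for $Z$ the closed substack defined by the ideal $$I=F_0\Bigl(\bigcap_{\delta\in\Delta}J_\delta\Bigr)\cdot\prod_{\delta\in\Delta}\bigl(F_\delta(\mathcal F)+J_\delta\bigr),$$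 where $F_n$ denotes the $n$th Fitting ideal, and $J_\delta$ is the ideal of the schematic closure of the largest open substack of $S$ over which $\mathcal F$ is locally free of rank $\delta$ (all but finitely many factors of the product are $\mathcal O_S$). -/

import Mathlib

open CategoryTheory CategoryTheory.Limits AlgebraicGeometry

universe u

noncomputable section

namespace Flatify

/-! ### Stacks in groupoids over the big étale site of schemes -/

/-- A category over the category of schemes. -/
abbrev CatOverSch := BasedCategory.{u, u + 1} Scheme.{u}

/-- The category `Sch/T` of schemes over `T`, as a category over `Sch`. -/
def overCat (T : Scheme.{u}) : CatOverSch.{u} :=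
  BasedCategory.ofFunctor (Over.forget T)

/-- A sieve `R` on `T`, viewed as a full subcategory of `Sch/T`, as a category over `Sch`. -/
def sieveCat {T : Scheme.{u}} (R : Sieve T) : CatOverSch.{u} :=
  BasedCategory.ofFunctor R.arrows.diagram

/-- The inclusion of a sieve on `T` into `Sch/T`. -/
def sieveIncl {T : Scheme.{u}} (R : Sieve T) : BasedFunctor (sieveCat R) (overCat T) where
  toFunctor := ObjectProperty.ι fun f : Over T => R.arrows f.hom
  w := rfl

/-- `𝒳` is a category fibered in groupoids over `Sch`: pullbacks exist and every arrow is
(strongly) cartesian. -/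
structure IsFiberedInGroupoids (𝒳 : CatOverSch.{u}) : Prop where
  exists_lift : ∀ (x : 𝒳.obj) (T : Scheme.{u}) (f : T ⟶ 𝒳.p.obj x),
    ∃ (y : 𝒳.obj) (φ : y ⟶ x), 𝒳.p.IsHomLift f φ
  cartesian : ∀ {x y : 𝒳.obj} (φ : x ⟶ y), 𝒳.p.IsStronglyCartesian (𝒳.p.map φ) φ

/-- `𝒳` is a stack in groupoids for the étale topology: it is fibered in groupoids, and for every
étale covering sieve `R` of `T` restriction is an equivalence from the category of functors
`Sch/T ⥤ 𝒳` over `Sch` (which is equivalent to the fiber of `𝒳` over `T`) to the category of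
functors `R ⥤ 𝒳` over `Sch` (which is equivalent to the category of descent data). -/
structure IsStack (𝒳 : CatOverSch.{u}) : Prop extends IsFiberedInGroupoids 𝒳 where
  descent : ∀ (T : Scheme.{u}) (R : Sieve T), R ∈ Scheme.etaleTopology T →
    (Bicategory.precomp (B := CatOverSch.{u}) (a := sieveCat R) (b := overCat T) 𝒳
      (sieveIncl R)).IsEquivalence

/-! ### Algebraic spaces and algebraic stacks

In a category `𝒴` fibered in groupoids over `Sch`, an object `w` over a scheme `W` is the same as a
morphism `W → 𝒴`.  For objects `w₁`, `w₂` over `W₁`, `W₂`, the fiber product `W₁ ×_𝒴 W₂` is the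
category of spans `w₁ ← s → w₂` in `𝒴`.  It is a scheme if and only if there is a terminal span,
that is, a categorical product of `w₁` and `w₂` in `𝒴`; the product then lies over the scheme
`W₁ ×_𝒴 W₂`. -/

/-- The fiber product `X ×_𝒳 Y` for objects `x`, `y` of `𝒳` over the schemes `X`, `Y`: the category
of spans `x ← s → y` in `𝒳`. -/
def spanCat (𝒳 : CatOverSch.{u}) (x y : 𝒳.obj) : CatOverSch.{u} :=
  BasedCategory.ofFunctor (𝒳 := BinaryFan x y) (Cone.forget (pair x y) ⋙ 𝒳.p)

/-- The apex of a span, as an object of the ambient category. -/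
def spanPt {𝒳 : CatOverSch.{u}} {x y : 𝒳.obj} (w : (spanCat 𝒳 x y).obj) : 𝒳.obj :=
  Cone.pt (F := pair x y) w

/-- The second leg of a span. -/
def spanSnd {𝒳 : CatOverSch.{u}} {x y : 𝒳.obj} (w : (spanCat 𝒳 x y).obj) : spanPt w ⟶ y :=
  BinaryFan.snd (show BinaryFan x y from w)

/-- The morphism `W → 𝒴` given by the object `w` is representable by schemes, étale and
surjective: for every `y` over `Y`, the fiber product `W ×_𝒴 Y` is a scheme, and its projection
to `Y` is étale and surjective. -/
def IsEtaleAtlas (𝒴 : CatOverSch.{u}) (w : 𝒴.obj) : Prop :=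
  ∀ y : 𝒴.obj, ∃ z : BinaryFan w y, Nonempty (IsLimit z) ∧
    Etale (𝒴.p.map z.snd) ∧ Surjective (𝒴.p.map z.snd)

/-- `𝒴` is an algebraic space: a stack for the étale topology whose objects have no nontrivial
automorphisms (so that `𝒴` is equivalent to a sheaf of sets), such that the diagonal is
representable by schemes (`Y₁ ×_𝒴 Y₂` is a scheme for all schemes `Y₁`, `Y₂` over `𝒴`), and such
that there is an étale surjective morphism from a scheme. -/
structure IsAlgebraicSpace (𝒴 : CatOverSch.{u}) : Prop extends IsStack 𝒴 where
  faithful : 𝒴.p.Faithful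
  diagonal : HasBinaryProducts 𝒴.obj
  exists_atlas : ∃ w : 𝒴.obj, IsEtaleAtlas 𝒴 w

/-- The morphism `X → 𝒳` given by the object `x` has property `P` (which is to be stable under base
change and étale-local on the source and on the target): for every scheme `Y` over `𝒳` there is an
étale surjective morphism `W → X ×_𝒳 Y` from a scheme such that `W → Y` has `P`. -/
def HasProp (P : MorphismProperty Scheme.{u}) (𝒳 : CatOverSch.{u}) (x : 𝒳.obj) : Prop :=
  ∀ y : 𝒳.obj, ∃ w : (spanCat 𝒳 x y).obj, IsEtaleAtlas (spanCat 𝒳 x y) w ∧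
    P (𝒳.p.map (spanSnd w))

/-- The morphism `X → 𝒳` given by `x` is smooth. -/
def IsSmoothOver (𝒳 : CatOverSch.{u}) (x : 𝒳.obj) : Prop :=
  HasProp @Smooth 𝒳 x

/-- The morphism `X → 𝒳` given by `x` is flat. -/
def IsFlatOver (𝒳 : CatOverSch.{u}) (x : 𝒳.obj) : Prop :=
  HasProp @Flat 𝒳 x

/-- The morphism `X → 𝒳` given by `x` is smooth and surjective. -/
def IsSmoothAtlas (𝒳 : CatOverSch.{u}) (x : 𝒳.obj) : Prop :=
  HasProp (fun _ _ f => Smooth f ∧ Surjective f) 𝒳 x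

/-- `𝒳` is an algebraic stack: a stack whose diagonal is representable by algebraic spaces
(`X ×_𝒳 Y` is an algebraic space for all schemes `X`, `Y` over `𝒳`), and which admits a smooth
surjective morphism from a scheme. -/
structure IsAlgebraicStack (𝒳 : CatOverSch.{u}) : Prop extends IsStack 𝒳 where
  diagonal : ∀ x y : 𝒳.obj, IsAlgebraicSpace (spanCat 𝒳 x y)
  exists_atlas : ∃ x : 𝒳.obj, IsSmoothAtlas 𝒳 x

/-! ### Affine charts -/

/-- An affine chart of `𝒳`: a morphism `Spec A → 𝒳`, that is, an object of `𝒳` together with an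
identification of its underlying scheme with the spectrum of a ring. -/
structure AffineChart (𝒳 : CatOverSch.{u}) where
  /-- The object. -/
  obj : 𝒳.obj
  /-- The ring. -/
  ring : CommRingCat.{u}
  /-- The identification of the underlying scheme with the spectrum. -/
  iso : Spec ring ≅ 𝒳.p.obj obj

/-- A morphism of affine charts: a morphism of `𝒳`, together with the corresponding ring
homomorphism. -/
@[ext]
structure AffineChart.Hom {𝒳 : CatOverSch.{u}} (c d : AffineChart 𝒳) where
  /-- The morphism of the stack. -/
  hom : c.obj ⟶ d.obj
  /-- The ring homomorphism. -/
  ringHom : d.ring ⟶ c.ring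
  comm : Spec.map ringHom ≫ d.iso.hom = c.iso.hom ≫ 𝒳.p.map hom

instance (𝒳 : CatOverSch.{u}) : Category (AffineChart 𝒳) where
  Hom := AffineChart.Hom
  id c := ⟨𝟙 _, 𝟙 _, by simp⟩
  comp f g := ⟨f.hom ≫ g.hom, g.ringHom ≫ f.ringHom, by
    rw [Spec.map_comp, Category.assoc, g.comm, reassoc_of% f.comm, Functor.map_comp]⟩
  id_comp f := by apply AffineChart.Hom.ext <;> simp
  comp_id f := by apply AffineChart.Hom.ext <;> simp
  assoc f g h := by apply AffineChart.Hom.ext <;> simp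

/-- The morphism in `𝒳` underlying a morphism of charts. -/
def AffineChart.homOf {𝒳 : CatOverSch.{u}} {c d : AffineChart 𝒳} (f : c ⟶ d) : c.obj ⟶ d.obj :=
  AffineChart.Hom.hom f

/-- The ring homomorphism underlying a morphism of charts. -/
def AffineChart.ringMap {𝒳 : CatOverSch.{u}} {c d : AffineChart 𝒳} (f : c ⟶ d) :
    d.ring →+* c.ring :=
  (AffineChart.Hom.ringHom f).hom

/-- The image of a chart `Spec A → 𝒳'` under a morphism `g : 𝒳' → 𝒳`: the composite
`Spec A → 𝒳' → 𝒳`. -/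
def AffineChart.push {𝒳' 𝒳 : CatOverSch.{u}} (g : BasedFunctor 𝒳' 𝒳) (c : AffineChart 𝒳') :
    AffineChart 𝒳 where
  obj := g.obj c.obj
  ring := c.ring
  iso := c.iso ≪≫ eqToIso (g.w_obj c.obj).symm

/-- Functoriality of `AffineChart.push`; the ring homomorphism is unchanged. -/
def AffineChart.pushHom {𝒳' 𝒳 : CatOverSch.{u}} (g : BasedFunctor 𝒳' 𝒳) {c d : AffineChart 𝒳'}
    (f : c ⟶ d) : c.push g ⟶ d.push g :=
  show AffineChart.Hom _ _ from
  { hom := g.map (AffineChart.homOf f)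
    ringHom := AffineChart.Hom.ringHom (c := c) (d := d) f
    comm := by
      have h := Functor.congr_hom g.w (AffineChart.homOf f)
      have h1 := AffineChart.Hom.comm (c := c) (d := d) f
      simp only [Functor.comp_map] at h
      simp only [AffineChart.push, Iso.trans_hom, eqToIso.hom, Category.assoc]
      rw [h, reassoc_of% h1]
      simp [AffineChart.homOf] }

/-! ### Noetherian stacks and flat morphisms -/

/-- A noetherian algebraic stack: an algebraic stack that is quasi-compact and locally noetherian
(it has a smooth surjective morphism from the spectrum of a noetherian ring), and quasi-separated
(for affine schemes `X`, `Y` over `𝒳`, the algebraic space `X ×_𝒳 Y` is quasi-compact and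
quasi-separated). -/
structure IsNoetherianStack (𝒳 : CatOverSch.{u}) : Prop extends IsAlgebraicStack 𝒳 where
  exists_noetherian_atlas :
    ∃ c : AffineChart 𝒳, IsSmoothAtlas 𝒳 c.obj ∧ IsNoetherianRing c.ring
  diagonal_quasiCompact : ∀ x y : 𝒳.obj, IsAffine (𝒳.p.obj x) → IsAffine (𝒳.p.obj y) →
    ∃ w : (spanCat 𝒳 x y).obj, IsEtaleAtlas (spanCat 𝒳 x y) w ∧
      IsAffine ((spanCat 𝒳 x y).p.obj w)
  diagonal_quasiSeparated : ∀ x y : 𝒳.obj, IsAffine (𝒳.p.obj x) → IsAffine (𝒳.p.obj y) →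
    ∀ w₁ w₂ : (spanCat 𝒳 x y).obj, IsAffine ((spanCat 𝒳 x y).p.obj w₁) →
      IsAffine ((spanCat 𝒳 x y).p.obj w₂) → ∀ z : BinaryFan w₁ w₂, IsLimit z →
        CompactSpace ((spanCat 𝒳 x y).p.obj z.pt)

/-- A morphism `g : 𝒳' → 𝒳` is flat: for every smooth morphism `U' → 𝒳'` from a scheme the
composite `U' → 𝒳' → 𝒳` is flat. -/
def IsFlatMorphism {𝒳' 𝒳 : CatOverSch.{u}} (g : BasedFunctor 𝒳' 𝒳) : Prop :=
  ∀ x : 𝒳'.obj, IsSmoothOver 𝒳' x → IsFlatOver 𝒳 (g.obj x)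

/-! ### Quasi-coherent modules, open and closed substacks -/

/-- A semilinear map `h : M → N` along `φ : A → B` exhibits `N` as the base change `M ⊗_A B`. -/
def IsBaseChangeAlong {A B M N : Type*} [CommRing A] [CommRing B] [AddCommGroup M] [AddCommGroup N]
    [Module A M] [Module B N] (φ : A →+* B) (h : M →ₛₗ[φ] N) : Prop :=
  letI : Algebra A B := φ.toAlgebra
  letI : Module A N := Module.compHom N φ
  haveI : IsScalarTower A B N := ⟨fun a b n => by
    change (φ a * b) • n = φ a • (b • n)
    exact mul_smul _ _ _⟩
  IsBaseChange B
    ({ toFun := h, map_add' := h.map_add, map_smul' := fun a m => h.map_smulₛₗ a m } : M →ₗ[A] N)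

/-- A quasi-coherent module on `𝒳`: an `A`-module for every chart `Spec A → 𝒳`, functorially in the
chart and compatible with base change. -/
structure QCohModule (𝒳 : CatOverSch.{u}) where
  /-- The module on a chart. -/
  obj : AffineChart 𝒳 → Type u
  [addCommGroup : ∀ c, AddCommGroup (obj c)]
  [module : ∀ c, Module c.ring (obj c)]
  /-- The pullback map along a morphism of charts. -/
  map : ∀ {c d : AffineChart 𝒳} (f : c ⟶ d), obj d →ₛₗ[AffineChart.ringMap f] obj c
  map_id : ∀ (c : AffineChart 𝒳) (m : obj c), map (𝟙 c) m = m
  map_comp : ∀ {c d e : AffineChart 𝒳} (f : c ⟶ d) (g : d ⟶ e) (m : obj e),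
    map (f ≫ g) m = map f (map g m)
  isBaseChange : ∀ {c d : AffineChart 𝒳} (f : c ⟶ d),
    IsBaseChangeAlong (AffineChart.ringMap f) (map f)

attribute [instance] QCohModule.addCommGroup QCohModule.module

namespace QCohModule

variable {𝒳 𝒳' : CatOverSch.{u}}

/-- Coherent modules (on noetherian stacks: quasi-coherent modules of finite type). -/
def IsCoherent (F : QCohModule 𝒳) : Prop :=
  ∀ c : AffineChart 𝒳, Module.Finite c.ring (F.obj c)

/-- The pullback `g^*F` of a quasi-coherent module. -/
def pullback (F : QCohModule 𝒳) (g : BasedFunctor 𝒳' 𝒳) : QCohModule 𝒳' where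
  obj c := F.obj (c.push g)
  addCommGroup c := F.addCommGroup (c.push g)
  module c := F.module (c.push g)
  map f := F.map (AffineChart.pushHom g f)
  map_id c m := by
    have h : AffineChart.pushHom g (𝟙 c) = 𝟙 (c.push g) := by
      apply AffineChart.Hom.ext
      · exact g.map_id _
      · rfl
    refine Eq.trans ?_ (F.map_id (c.push g) m)
    exact congrArg (fun k : c.push g ⟶ c.push g => F.map k m) h
  map_comp {c d e} f k m := by
    have h : AffineChart.pushHom g (f ≫ k) =
        AffineChart.pushHom g f ≫ AffineChart.pushHom g k := by
      apply AffineChart.Hom.ext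
      · exact g.map_comp _ _
      · rfl
    refine Eq.trans ?_ (F.map_comp _ _ m)
    exact congrArg (fun l : c.push g ⟶ e.push g => F.map l m) h
  isBaseChange f := F.isBaseChange (AffineChart.pushHom g f)

/-- Two quasi-coherent modules are isomorphic. -/
def IsIsomorphic (F G : QCohModule 𝒳) : Prop :=
  ∃ e : ∀ c : AffineChart 𝒳, F.obj c ≃ₗ[c.ring] G.obj c,
    ∀ (c d : AffineChart 𝒳) (f : c ⟶ d) (m : F.obj d), e c (F.map f m) = G.map f (e d m)

end QCohModule

/-- An open substack of `𝒳`: an open subset of every chart, compatible with pullback. -/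
@[ext]
structure OpenSubstack (𝒳 : CatOverSch.{u}) where
  /-- The open subset of a chart. -/
  opens : ∀ c : AffineChart 𝒳, TopologicalSpace.Opens (PrimeSpectrum c.ring)
  mem_iff : ∀ {c d : AffineChart 𝒳} (f : c ⟶ d) (p : PrimeSpectrum c.ring),
    p ∈ opens c ↔ PrimeSpectrum.comap (AffineChart.ringMap f) p ∈ opens d

instance (𝒳 : CatOverSch.{u}) : LE (OpenSubstack 𝒳) :=
  ⟨fun U V => ∀ c, U.opens c ≤ V.opens c⟩

/-- The union of a set of open substacks. -/
def OpenSubstack.union {𝒳 : CatOverSch.{u}} (s : Set (OpenSubstack 𝒳)) : OpenSubstack 𝒳 where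
  opens c := ⨆ U ∈ s, U.opens c
  mem_iff f p := by
    simp only [TopologicalSpace.Opens.mem_iSup]
    exact exists_congr fun U => exists_congr fun _ => U.mem_iff f p

/-- A closed substack of `𝒳`: an ideal (the one defining the closed subscheme) of every chart,
compatible with base change. -/
@[ext]
structure ClosedSubstack (𝒳 : CatOverSch.{u}) where
  /-- The ideal on a chart. -/
  ideal : ∀ c : AffineChart 𝒳, Ideal c.ring
  map_eq : ∀ {c d : AffineChart 𝒳} (f : c ⟶ d),
    (ideal d).map (AffineChart.ringMap f) = ideal c

/-- The inverse image `g⁻¹(Z)` of a closed substack. -/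
def ClosedSubstack.pullback {𝒳' 𝒳 : CatOverSch.{u}} (Z : ClosedSubstack 𝒳)
    (g : BasedFunctor 𝒳' 𝒳) : ClosedSubstack 𝒳' where
  ideal c := Z.ideal (c.push g)
  map_eq f := Z.map_eq (AffineChart.pushHom g f)

/-! ### Local freeness, torsion, Fitting ideals -/

/-- The module `M` is locally free of finite rank (i.e., finitely generated and projective) with
all its ranks in `Δ`. -/
def LocallyFreeWithRanks (A M : Type*) [CommRing A] [AddCommGroup M] [Module A M]
    (Δ : Set ℕ) : Prop :=
  Module.Finite A M ∧ Module.Projective A M ∧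
    ∀ p : PrimeSpectrum A, Module.rankAtStalk (R := A) M p ∈ Δ

/-- The elements of `M` that vanish on the open subset `V` of `Spec A`, i.e., the kernel of
`M → Γ(V, M~)`. -/
def vanishingOn (A M : Type*) [CommRing A] [AddCommGroup M] [Module A M]
    (V : TopologicalSpace.Opens (PrimeSpectrum A)) : Submodule A M :=
  ⨅ p ∈ V, LinearMap.ker (LocalizedModule.mkLinearMap p.asIdeal.primeCompl M)

/-- The `n`th Fitting ideal of a finitely generated module: generated by the minors of size `k` of
all matrices of relations between the members of a generating family of `n + k` elements. -/
def fittingIdeal (A M : Type*) [CommRing A] [AddCommGroup M] [Module A M] (n : ℕ) : Ideal A :=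
  Ideal.span {a : A | ∃ (k : ℕ) (m : Fin (n + k) → M) (R : Matrix (Fin k) (Fin (n + k)) A)
    (e : Fin k → Fin (n + k)), Submodule.span A (Set.range m) = ⊤ ∧
      (∀ i, ∑ j, R i j • m j = 0) ∧ a = (R.submatrix id e).det}

namespace QCohModule

variable {𝒳 𝒳' : CatOverSch.{u}}

/-- `F` is locally free with ranks in `Δ` over the open substack `V`: this holds on every chart
that factors through `V`. -/
def IsLocallyFreeOn (F : QCohModule 𝒳) (V : OpenSubstack 𝒳) (Δ : Set ℕ) : Prop :=
  ∀ c : AffineChart 𝒳, V.opens c = ⊤ → LocallyFreeWithRanks c.ring (F.obj c) Δ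

/-- The union of all open substacks over which `F` is locally free with ranks in `Δ`. -/
def freeLocus (F : QCohModule 𝒳) (Δ : Set ℕ) : OpenSubstack 𝒳 :=
  OpenSubstack.union {V | F.IsLocallyFreeOn V Δ}

/-- The ideal `J_δ` of the schematic closure of the largest open substack over which `F` is locally
free of rank `δ`, on a (flat) chart. -/
def closureIdeal (F : QCohModule 𝒳) (δ : ℕ) (c : AffineChart 𝒳) : Ideal c.ring :=
  vanishingOn c.ring c.ring ((F.freeLocus {δ}).opens c)

/-- The ideal `F_0 (⋂_{δ ∈ Δ} J_δ) · ∏_{δ ∈ Δ} (F_δ(F) + J_δ)` on a (flat) chart. -/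
def centerIdeal (F : QCohModule 𝒳) (Δ : Set ℕ) (c : AffineChart 𝒳) : Ideal c.ring :=
  fittingIdeal c.ring (⨅ δ ∈ Δ, F.closureIdeal δ c : Ideal c.ring) 0 *
    ∏ᶠ (δ : ℕ) (_ : δ ∈ Δ), (fittingIdeal c.ring (F.obj c) δ ⊔ F.closureIdeal δ c)

/-- The strict transform of `F` along `π : 𝒳' → 𝒳` relative to the open substack `U` of `𝒳`, on a
(flat) chart of `𝒳'`: the pullback `π^*F` modulo the elements that vanish on `π⁻¹(U)`, i.e., modulo
the kernel of `π^*F → j_* j^* π^*F` for the inclusion `j : π⁻¹(U) → 𝒳'`. -/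
abbrev strictTransform (F : QCohModule 𝒳) (π : BasedFunctor 𝒳' 𝒳) (U : OpenSubstack 𝒳)
    (c : AffineChart 𝒳') : Type u :=
  (F.pullback π).obj c ⧸ vanishingOn c.ring ((F.pullback π).obj c) (U.opens (c.push π))

/-- The strict transform of `F` along `π`, a sheaf on the site of affine schemes smooth over `𝒳'`,
is locally free with ranks in `Δ`. -/
def StrictTransformLocallyFree (F : QCohModule 𝒳) (π : BasedFunctor 𝒳' 𝒳) (U : OpenSubstack 𝒳)
    (Δ : Set ℕ) : Prop :=
  ∀ c : AffineChart 𝒳', IsSmoothOver 𝒳' c.obj →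
    LocallyFreeWithRanks c.ring (F.strictTransform π U c) Δ

end QCohModule

/-! ### Blow-ups -/

/-- The inverse image under `f : T → Spec A` of the closed subscheme defined by `I` is an effective
Cartier divisor: locally on `T`, the inverse image ideal is generated by a nonzerodivisor. -/
def BecomesCartier {A : CommRingCat.{u}} (I : Ideal A) {T : Scheme.{u}} (f : T ⟶ Spec A) : Prop :=
  ∀ t : T, ∃ W : T.Opens, t ∈ W ∧ IsAffineOpen W ∧ ∃ a ∈ nonZeroDivisors Γ(T, W),
    I.map ((Scheme.ΓSpecIso A).inv ≫ f.appLE ⊤ W le_top).hom = Ideal.span {a}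

/-- `b : B → Spec A` is the blow-up of `Spec A` in the closed subscheme defined by `I`. -/
def IsSchemeBlowUp {A : CommRingCat.{u}} (I : Ideal A) {B : Scheme.{u}} (b : B ⟶ Spec A) : Prop :=
  BecomesCartier I b ∧
    ∀ (T : Scheme.{u}) (f : T ⟶ Spec A), BecomesCartier I f → ∃! g : T ⟶ B, g ≫ b = f

/-- `π : 𝒳' → 𝒳` is the blow-up `Bl_Z 𝒳 → 𝒳` of the stack `𝒳` in `Z`: for every smooth chart
`V = Spec A → 𝒳`, the fiber product `𝒳' ×_𝒳 V` (the category of objects `y` of `𝒳'` with a morphism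
`π y ⟶ v`) is a scheme (i.e., has a terminal object), namely the blow-up of `V` in `Z ×_𝒳 V`.
When `𝒳` is algebraic this determines the stack `𝒳'` over `𝒳` up to equivalence, and `𝒳'` is
algebraic since `π` is representable. -/
structure IsBlowUp {𝒳' 𝒳 : CatOverSch.{u}} (π : BasedFunctor 𝒳' 𝒳) (Z : ClosedSubstack 𝒳) :
    Prop where
  isStack : IsStack 𝒳'
  isBlowUp : ∀ c : AffineChart 𝒳, IsSmoothOver 𝒳 c.obj →
    ∃ t : CostructuredArrow π.toFunctor c.obj, Nonempty (IsTerminal t) ∧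
      IsSchemeBlowUp (Z.ideal c) (𝒳.p.map t.hom ≫ c.iso.inv)

end Flatify

end

/-!
The argument has an algebraic and a stack-theoretic part.

**Algebra.** Let `M` be a finite module over a noetherian ring `A`, let `V δ` be the locus where `M`
is free of rank `δ`, and let `J δ` be the ideal of functions vanishing on `V δ`. The ideal
`flatteningIdeal A M V Δ` is `F₀ (⋂ J δ) * ∏ (F_δ M + J δ)`. It commutes with flat base change
(`flatteningIdeal_map`), and its zero locus is the locus where `M` is not free of a rank in `Δ`
(`flatteningIdeal_le_iff`). Suppose that it becomes principal over an `A`-algebra `B`, generated by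
a nonzerodivisor `a`. Locally every factor is then generated by a single one of its generators,
which is a nonzerodivisor. The first factor kills `⋂ J δ`, and `F_n M * ∏ J δ ≤ ⋂ J δ` for the
product over the `δ ≤ n` in `Δ`, so every product of elements of these `J δ` kills `F_n (M ⊗ B)`.
Hence, for the least `δ` in `Δ` such that the factor `F_δ M + J δ` is generated by an element of
`F_δ M` that is not in `J δ`, all smaller Fitting ideals of `M ⊗ B` vanish and the `δ`th one is
generated by a nonzerodivisor that is a minor of a matrix of relations. Cramer's rule
shows that the quotient of `M ⊗ B` by its torsion is free of rank `δ`
(`exists_basis_quotient`, `locallyFreeWithRanks_quotient`).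

**Stacks.** The center is obtained by gluing the flattening ideals of the flat noetherian charts:
two such charts are compared through an atlas of their fiber product, which is flat over both of
them (`exists_flat_comparison`), and faithfully flat descent of ideals extends the result to all
charts (`exists_center`). The flat functoriality holds because both sides agree on smooth charts.

The blow-up of `Spec A` in `I` is `Proj` of the Rees algebra (`isSchemeBlowUp_blowUpHom`). The
blow-up of a stack `S` in `Z` is constructed as a sheaf of sets on the category `S`: a point over
`x` is a compatible family of lifts of the morphisms `y → Spec A`, for `y` over `x` and for the
smooth charts `Spec A` under `y`, to the blow-ups of the charts (`BlowUpPoint`). Compatibility for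
different charts is tested on objects over which `Z` is a Cartier divisor, where lifts are unique.
The category of elements of this sheaf is a stack (`isStack_elements`), and over a smooth chart it
is represented by the blow-up of the chart (`exists_universal_blowUpStack`).

A smooth chart of the blow-up has a smooth covering by an object over which `Z` is a Cartier divisor
(`exists_cartier_cover`). There the algebraic result applies, and local freeness descends
(`LocallyFreeWithRanks.of_faithfullyFlat`).
-/

noncomputable section

namespace Flatify

/-! ### Fitting ideals -/

section Minors

variable {A : Type*} [CommRing A] {m n : Type*}

/-- The ideal generated by the minors of size `k` of a matrix `X` that only use columns outside the
finite set `T`. -/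
def minorsOff (T : Finset n) (k : ℕ) (X : Matrix m n A) : Ideal A :=
  Ideal.span {a : A | ∃ (r : Fin k → m) (e : Fin k → n), (∀ j, e j ∉ T) ∧
    a = (X.submatrix r e).det}

lemma minorsOff_succ_le [DecidableEq n] (T : Finset n) (t : n) (k : ℕ) (X : Matrix m n A) :
    minorsOff T (k + 1) X ≤ minorsOff (insert t T) k X := by
  rw [minorsOff, Ideal.span_le]
  rintro _ ⟨r, e, he, rfl⟩
  -- expand along a column with index `t` if there is one; if there are two, the minor vanishes
  obtain ⟨j₀, hj₀⟩ : ∃ j₀, (∃ j, e j = t) → e j₀ = t := by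
    by_cases h : ∃ j, e j = t
    · exact ⟨h.choose, fun _ => h.choose_spec⟩
    · exact ⟨0, fun h' => absurd h' h⟩
  by_cases h : ∃ j, j ≠ j₀ ∧ e j = t
  · obtain ⟨j, hj, hjt⟩ := h
    have h0 := hj₀ ⟨j, hjt⟩
    have : (X.submatrix r e).det = 0 :=
      Matrix.det_zero_of_column_eq hj (fun i => by simp [hjt, h0])
    rw [this]
    exact zero_mem _
  · push Not at h
    rw [Matrix.det_succ_column _ j₀]
    refine sum_mem fun i _ => Ideal.mul_mem_left _ _ (Ideal.subset_span ?_)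
    refine ⟨r ∘ i.succAbove, e ∘ j₀.succAbove, fun j => ?_, ?_⟩
    · simp only [Finset.mem_insert, not_or]
      exact ⟨h _ (Fin.succAbove_ne _ _), he _⟩
    · rw [Matrix.submatrix_submatrix]

lemma minorsOff_add_card_le [DecidableEq n] (T : Finset n) (k : ℕ) (X : Matrix m n A) :
    minorsOff ∅ (k + T.card) X ≤ minorsOff T k X := by
  induction T using Finset.induction_on generalizing k with
  | empty => simp
  | insert t T ht ih =>
    rw [Finset.card_insert_of_notMem ht, ← add_assoc, add_right_comm]
    exact (ih (k + 1)).trans (minorsOff_succ_le T t k X)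

/-- Minors of a product of matrices are combinations of minors of the left factor. -/
lemma det_submatrix_mul_mem [Fintype n] {l : Type*} (k : ℕ) (X : Matrix m n A)
    (G : Matrix n l A) (r : Fin k → m) (e : Fin k → l) :
    ((X * G).submatrix r e).det ∈ minorsOff ∅ k X := by
  classical
  have h1 : ((X * G).submatrix r e).det =
      Matrix.detRowAlternating (fun i => ∑ j, G j (e i) • (fun a => X (r a) j)) := by
    rw [← Matrix.det_transpose]
    congr 1
    ext i a
    simp [Matrix.mul_apply, mul_comm]
  rw [h1, ← AlternatingMap.coe_multilinearMap, MultilinearMap.map_sum]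
  refine sum_mem fun p _ => ?_
  rw [MultilinearMap.map_smul_univ (Matrix.detRowAlternating (R := A) (n := Fin k)).toMultilinearMap
    (fun i => G (p i) (e i)) (fun i a => X (r a) (p i))]
  refine Ideal.mul_mem_left _ _ (Ideal.subset_span ⟨r, p, by simp, ?_⟩)
  rw [← Matrix.det_transpose]
  rfl

/-- The determinant of a matrix whose rows are combinations of vectors in `W` is a combination of
determinants of matrices with rows in `W`. -/
lemma det_mem_of_rows_mem_span {k : ℕ} (e : Fin k → n) (W : Set (n → A)) (I : Ideal A)
    (hW : ∀ S : Matrix (Fin k) n A, (∀ i, S i ∈ W) → (S.submatrix id e).det ∈ I)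
    (S : Matrix (Fin k) n A) (hS : ∀ i, S i ∈ Submodule.span A W) :
    (S.submatrix id e).det ∈ I := by
  classical
  suffices H : ∀ (s : Finset (Fin k)) (S : Matrix (Fin k) n A),
      (∀ i ∈ s, S i ∈ Submodule.span A W) → (∀ i ∉ s, S i ∈ W) →
        (S.submatrix id e).det ∈ I by
    exact H Finset.univ S (fun i _ => hS i) (fun i hi => absurd (Finset.mem_univ i) hi)
  intro s
  induction s using Finset.induction_on with
  | empty => exact fun S _ h => hW S (fun i => h i (by simp))
  | insert a s ha ih =>
    intro S h1 h2
    let L : (n → A) →ₗ[A] A :=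
      ((Matrix.detRowAlternating (R := A) (n := Fin k)).toMultilinearMap.toLinearMap
        (fun i => (S.submatrix id e) i) a).comp (LinearMap.funLeft A A e)
    have hL : ∀ x, L x = ((S.updateRow a x).submatrix id e).det := by
      intro x
      simp only [L, LinearMap.comp_apply, MultilinearMap.toLinearMap_apply]
      change Matrix.det _ = _
      congr 1
      ext i j
      by_cases hi : i = a
      · subst hi; simp [LinearMap.funLeft]
      · simp [hi]
    have h3 : Submodule.span A W ≤ Submodule.comap L (I : Submodule A A) := by
      rw [Submodule.span_le]
      intro w hw
      change L w ∈ I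
      rw [hL]
      refine ih _ (fun i hi => ?_) (fun i hi => ?_)
      · have : i ≠ a := fun h => ha (h ▸ hi)
        rw [Matrix.updateRow_ne this]
        exact h1 i (Finset.mem_insert_of_mem hi)
      · by_cases hia : i = a
        · subst hia; simpa using hw
        · rw [Matrix.updateRow_ne hia]
          exact h2 i (by simp [hia, hi])
    have h4 := h3 (h1 a (Finset.mem_insert_self _ _))
    change L (S a) ∈ I at h4
    rwa [hL, Matrix.updateRow_eq_self] at h4

end Minors

section Fitting

variable {A M : Type*} [CommRing A] [AddCommGroup M] [Module A M]

/-- The Fitting ideal is computed by the relations between the members of a single generating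
family. -/
lemma fittingIdeal_le_of_span_eq_top {n k' : ℕ} (x : Fin (n + k') → M)
    (hx : Submodule.span A (Set.range x) = ⊤) (I : Ideal A)
    (hI : ∀ (S : Matrix (Fin k') (Fin (n + k')) A) (e : Fin k' → Fin (n + k')),
      (∀ i, ∑ j, S i j • x j = 0) → (S.submatrix id e).det ∈ I) :
    fittingIdeal A M n ≤ I := by
  classical
  rw [fittingIdeal, Ideal.span_le]
  rintro _ ⟨k, y, R, e, hy, hR, rfl⟩
  have hxy : ∀ j, ∃ c : Fin (n + k') → A, ∑ i, c i • x i = y j := fun j =>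
    Submodule.mem_span_range_iff_exists_fun A |>.1 (by rw [hx]; trivial)
  have hyx : ∀ i, ∃ c : Fin (n + k) → A, ∑ j, c j • y j = x i := fun j =>
    Submodule.mem_span_range_iff_exists_fun A |>.1 (by rw [hy]; trivial)
  choose P hP using hxy
  choose Q hQ using hyx
  -- relations between the members of both families, the rows of `[1, -Q; 0, R]`, are corrected
  -- by the expression of `y` in terms of `x` to relations `S` between the members of `x`
  let V : Matrix (Fin (n + k') ⊕ Fin k) (Fin (n + k)) A := Matrix.fromRows (-Matrix.of Q) R
  let U : Matrix (Fin (n + k') ⊕ Fin k) (Fin (n + k')) A := Matrix.fromRows 1 0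
  let Pm : Matrix (Fin (n + k)) (Fin (n + k')) A := Matrix.of P
  let S : Matrix (Fin (n + k') ⊕ Fin k) (Fin (n + k')) A := U + V * Pm
  have hV : ∀ i, ∑ j, V i j • y j = -∑ j, U i j • x j := by
    rintro (i | i)
    · simp [V, U, hQ, Matrix.one_apply, ite_smul]
    · simp [V, U, hR]
  have hS : ∀ i, ∑ j, S i j • x j = 0 := by
    intro i
    have : ∑ j, (V * Pm) i j • x j = ∑ j, V i j • y j := by
      simp_rw [Matrix.mul_apply, Finset.sum_smul]
      rw [Finset.sum_comm]
      refine Finset.sum_congr rfl fun j _ => ?_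
      rw [← hP j, Finset.smul_sum]
      simp [Pm, mul_smul]
    simp only [S, Matrix.add_apply, add_smul, Finset.sum_add_distrib]
    rw [this, hV, add_neg_cancel]
  let G : Matrix (Fin (n + k') ⊕ Fin (n + k)) (Fin (n + k') ⊕ Fin (n + k)) A :=
    Matrix.fromBlocks 1 0 (-Pm) 1
  let SV : Matrix (Fin (n + k') ⊕ Fin k) (Fin (n + k') ⊕ Fin (n + k)) A := Matrix.fromCols S V
  have hUV : Matrix.fromCols U V = SV * G := by
    simp only [SV, G, Matrix.fromCols_mul_fromBlocks]
    simp [S]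
  let T : Finset (Fin (n + k') ⊕ Fin (n + k)) := Finset.univ.map Function.Embedding.inr
  have hT : k' + T.card = (n + k') + k := by simp [T]; omega
  let ρ : Fin (k' + T.card) ≃ Fin (n + k') ⊕ Fin k := (finCongr hT).trans finSumFinEquiv.symm
  have h1 : ((Matrix.fromCols U V).submatrix ρ (Sum.map id e ∘ ρ)).det =
      (R.submatrix id e).det := by
    have : (Matrix.fromCols U V).submatrix ρ (Sum.map id e ∘ ρ) =
        (Matrix.fromBlocks 1 ((-Matrix.of Q).submatrix id e) 0
          (R.submatrix id e)).submatrix ρ ρ := by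
      ext i j
      rcases h : ρ i with i' | i' <;> rcases h' : ρ j with j' | j' <;>
        simp [U, V, h, h']
    rw [this, Matrix.det_submatrix_equiv_self, Matrix.det_fromBlocks_zero₂₁, Matrix.det_one,
      one_mul]
  rw [SetLike.mem_coe, ← h1, hUV]
  have h2 := minorsOff_add_card_le T k' SV
    (det_submatrix_mul_mem _ SV G ρ (Sum.map id e ∘ ρ))
  refine (show minorsOff T k' SV ≤ I from ?_) h2
  rw [minorsOff, Ideal.span_le]
  rintro _ ⟨r, c, hc, rfl⟩
  have hc' : ∀ j, ∃ a, c j = Sum.inl a := by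
    intro j
    rcases h : c j with a | b
    · exact ⟨a, rfl⟩
    · exact absurd (h ▸ hc j) (by simp [T])
  choose c' hc' using hc'
  have := hI (S.submatrix r id) c' (fun i => hS (r i))
  have h3 : SV.submatrix r c = (S.submatrix r id).submatrix id c' := by
    ext i j
    simp [SV, hc']
  rwa [SetLike.mem_coe, h3]

lemma det_mem_fittingIdeal {n k : ℕ} (m : Fin (n + k) → M) (R : Matrix (Fin k) (Fin (n + k)) A)
    (e : Fin k → Fin (n + k)) (hm : Submodule.span A (Set.range m) = ⊤)
    (hR : ∀ i, ∑ j, R i j • m j = 0) : (R.submatrix id e).det ∈ fittingIdeal A M n :=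
  Ideal.subset_span ⟨k, m, R, e, hm, hR, rfl⟩

lemma exists_fin_add_span_eq_top [Module.Finite A M] (n : ℕ) :
    ∃ (k : ℕ) (x : Fin (n + k) → M), Submodule.span A (Set.range x) = ⊤ := by
  obtain ⟨k, s, hs⟩ := Module.Finite.exists_fin (R := A) (M := M)
  refine ⟨k, Fin.append 0 s, top_le_iff.1 (hs ▸ Submodule.span_mono ?_)⟩
  rintro _ ⟨i, rfl⟩
  exact ⟨Fin.natAdd n i, by simp⟩

/-- A free module of rank `d` has vanishing Fitting ideals of index less than `d`. -/
lemma fittingIdeal_eq_bot_of_basis {d n : ℕ} (b : Module.Basis (Fin d) A M) (h : n < d) :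
    fittingIdeal A M n = ⊥ := by
  obtain ⟨k, rfl⟩ := Nat.exists_eq_add_of_lt h
  rw [add_assoc] at b
  refine le_bot_iff.1 (fittingIdeal_le_of_span_eq_top b b.span_eq ⊥ fun S e hS => ?_)
  have : S.submatrix id e = 0 := by
    ext i j
    exact Fintype.linearIndependent_iff.1 b.linearIndependent _ (hS i) _
  simp [this, Matrix.det_zero]

lemma fittingIdeal_eq_top {n : ℕ} (x : Fin n → M) (hx : Submodule.span A (Set.range x) = ⊤) :
    fittingIdeal A M n = ⊤ := by
  rw [Ideal.eq_top_iff_one]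
  simpa using det_mem_fittingIdeal (n := n) (k := 0) x (Matrix.of Fin.elim0) Fin.elim0 hx
    (fun i => i.elim0)

lemma fittingIdeal_eq_top_of_le {n N : ℕ} (h : N ≤ n) (x : Fin N → M)
    (hx : Submodule.span A (Set.range x) = ⊤) : fittingIdeal A M n = ⊤ := by
  obtain ⟨k, rfl⟩ := Nat.exists_eq_add_of_le h
  refine fittingIdeal_eq_top (Fin.append x (0 : Fin k → M))
    (top_le_iff.1 (hx ▸ Submodule.span_mono ?_))
  rintro _ ⟨i, rfl⟩
  exact ⟨Fin.castAdd k i, by simp⟩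

/-- The `0`th Fitting ideal annihilates the module, by Cramer's rule. -/
lemma smul_eq_zero_of_mem_fittingIdeal_zero {a : A} (ha : a ∈ fittingIdeal A M 0) (m : M) :
    a • m = 0 := by
  suffices h : fittingIdeal A M 0 ≤ Module.annihilator A M from
    Module.mem_annihilator.1 (h ha) m
  rw [fittingIdeal, Ideal.span_le]
  rintro _ ⟨k, y, R, e, hy, hR, rfl⟩
  by_cases he : Function.Injective e
  · have he' : Function.Bijective e := by
      rw [Fintype.bijective_iff_injective_and_card]
      exact ⟨he, by simp⟩
    rw [SetLike.mem_coe, Module.mem_annihilator]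
    intro m
    have hm : m ∈ Submodule.span A (Set.range y) := by rw [hy]; trivial
    induction hm using Submodule.span_induction with
    | zero => simp
    | add _ _ _ _ h1 h2 => rw [smul_add, h1, h2, add_zero]
    | smul a _ _ h => rw [smul_comm, h, smul_zero]
    | mem m hm =>
      obtain ⟨j, rfl⟩ := hm
      obtain ⟨j, rfl⟩ := he'.2 j
      set D := R.submatrix id e with hD
      have h1 : ∀ i, ∑ j, D i j • y (e j) = 0 := by
        intro i
        rw [← hR i]
        exact he'.sum_comp (fun j => R i j • y j)
      have h2 : ∑ i, D.adjugate j i • ∑ l, D i l • y (e l) = D.det • y (e j) := by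
        simp_rw [Finset.smul_sum, smul_smul]
        rw [Finset.sum_comm]
        simp_rw [← Finset.sum_smul, ← Matrix.mul_apply, Matrix.adjugate_mul]
        simp [Matrix.one_apply, ite_smul]
      rw [← h2]
      simp [h1]
  · rw [Function.Injective] at he
    push Not at he
    obtain ⟨i, j, hij, hne⟩ := he
    rw [Matrix.det_zero_of_column_eq hne (fun l => by simp [hij])]
    exact zero_mem _

variable {B N : Type*} [CommRing B] [Algebra A B] [AddCommGroup N] [Module A N] [Module B N]
  [IsScalarTower A B N]

lemma span_range_eq_top_of_isBaseChange {h : M →ₗ[A] N} (hh : IsBaseChange B h) {ι : Type*}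
    (x : ι → M) (hx : Submodule.span A (Set.range x) = ⊤) :
    Submodule.span B (Set.range (h ∘ x)) = ⊤ := by
  rw [eq_top_iff]
  intro z _
  induction z using hh.inductionOn with
  | zero => exact zero_mem _
  | tmul m =>
    have hm : m ∈ Submodule.span A (Set.range x) := by rw [hx]; trivial
    have h1 := Submodule.mem_map_of_mem (f := h) hm
    rw [Submodule.map_span, ← Set.range_comp] at h1
    exact Submodule.span_le_restrictScalars A B _ h1
  | smul b z hz => exact Submodule.smul_mem _ _ (hz trivial)
  | add _ _ h1 h2 => exact add_mem (h1 trivial) (h2 trivial)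

/-- The relations between generators of a base change are generated by the relations between the
original generators. -/
lemma mem_span_relations_of_isBaseChange {h : M →ₗ[A] N} (hh : IsBaseChange B h) {ι : Type*}
    [Fintype ι] (x : ι → M) (hx : Submodule.span A (Set.range x) = ⊤) (b : ι → B)
    (hb : ∑ i, b i • h (x i) = 0) :
    b ∈ Submodule.span B {c : ι → B | ∃ a : ι → A, ∑ i, a i • x i = 0 ∧
      c = fun i => algebraMap A B (a i)} := by
  classical
  set K := Submodule.span B {c : ι → B | ∃ a : ι → A, ∑ i, a i • x i = 0 ∧
      c = fun i => algebraMap A B (a i)} with hK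
  let p : (ι → A) →ₗ[A] M := Fintype.linearCombination A x
  have hp : Function.Surjective p := by
    rw [← LinearMap.range_eq_top, Fintype.range_linearCombination, hx]
  let q : (ι → A) →ₗ[A] (ι → B) ⧸ K :=
    ((K.mkQ).restrictScalars A).comp (LinearMap.compLeft (Algebra.linearMap A B) ι)
  have hq : LinearMap.ker p ≤ LinearMap.ker q := by
    intro a ha
    rw [LinearMap.mem_ker] at ha ⊢
    refine (Submodule.Quotient.mk_eq_zero K).2 (Submodule.subset_span ⟨a, ha, ?_⟩)
    rfl
  let g : M →ₗ[A] (ι → B) ⧸ K :=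
    ((LinearMap.ker p).liftQ q hq).comp (p.quotKerEquivOfSurjective hp).symm.toLinearMap
  have hg : ∀ a, g (p a) = q a := by
    intro a
    have : (p.quotKerEquivOfSurjective hp).symm (p a) = Submodule.Quotient.mk a := by
      rw [LinearEquiv.symm_apply_eq]; rfl
    simp only [g, LinearMap.comp_apply, LinearEquiv.coe_coe, this]
    exact Submodule.liftQ_apply _ _ _
  have h1 : ∀ i, hh.lift g (h (x i)) = K.mkQ (Pi.single i 1) := by
    intro i
    rw [hh.lift_eq]
    have : x i = p (Pi.single i 1) := by simp [p]
    rw [this, hg]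
    change K.mkQ _ = _
    congr 1
    ext j
    by_cases hj : j = i
    · subst hj; simp
    · simp [hj]
  have h2 : K.mkQ b = 0 := by
    have := congrArg (hh.lift g) hb
    rw [map_zero, map_sum] at this
    simp_rw [map_smul, h1, ← map_smul] at this
    rw [← map_sum] at this
    rw [← this]
    congr 1
    ext j
    simp [Finset.sum_apply, Pi.single_apply]
  simpa using h2

/-- Fitting ideals commute with base change. -/
lemma fittingIdeal_map [Module.Finite A M] {h : M →ₗ[A] N} (hh : IsBaseChange B h) (n : ℕ) :
    (fittingIdeal A M n).map (algebraMap A B) = fittingIdeal B N n := by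
  apply le_antisymm
  · rw [fittingIdeal, Ideal.map_span, Ideal.span_le]
    rintro _ ⟨_, ⟨k, y, R, e, hy, hR, rfl⟩, rfl⟩
    rw [RingHom.map_det]
    refine det_mem_fittingIdeal (h ∘ y) (R.map (algebraMap A B)) e
      (span_range_eq_top_of_isBaseChange hh y hy) (fun i => ?_)
    have := congrArg h (hR i)
    simpa using this
  · obtain ⟨k, x, hx⟩ := exists_fin_add_span_eq_top (A := A) (M := M) n
    refine fittingIdeal_le_of_span_eq_top (h ∘ x)
      (span_range_eq_top_of_isBaseChange hh x hx) _ fun S e hS => ?_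
    refine det_mem_of_rows_mem_span e _ _ ?_ S
      (fun i => mem_span_relations_of_isBaseChange hh x hx (S i) (hS i))
    intro W hW
    choose a ha using hW
    have h1 : W.submatrix id e =
        (algebraMap A B).mapMatrix ((Matrix.of a).submatrix id e) := by
      ext i j
      simp [(ha i).2]
    rw [h1, ← RingHom.map_det]
    exact Ideal.mem_map_of_mem _ (det_mem_fittingIdeal x (Matrix.of a) e hx fun i => (ha i).1)

end Fitting

/-! ### Locally free modules and faithfully flat descent -/

section FreeAt

open TensorProduct

variable {A B M N : Type*} [CommRing A] [CommRing B] [Algebra A B] [AddCommGroup M] [Module A M]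
  [AddCommGroup N] [Module A N] [Module B N] [IsScalarTower A B N]

variable (A M) in
/-- The stalk of the module `M` at the prime `p` is free of rank `d`. -/
def FreeAt (p : PrimeSpectrum A) (d : ℕ) : Prop :=
  Module.Free (Localization.AtPrime p.asIdeal) (Localization.AtPrime p.asIdeal ⊗[A] M) ∧
    Module.finrank (Localization.AtPrime p.asIdeal) (Localization.AtPrime p.asIdeal ⊗[A] M) = d

lemma freeAt_iff (p : PrimeSpectrum A) (d : ℕ) :
    FreeAt A M p d ↔ p ∈ Module.freeLocus A M ∧ Module.rankAtStalk M p = d := by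
  rw [FreeAt, Module.mem_freeLocus_iff_tensor p (Localization.AtPrime p.asIdeal),
    Module.rankAtStalk_eq_finrank_tensorProduct]

lemma FreeAt.congr {M' : Type*} [AddCommGroup M'] [Module A M'] (e : M ≃ₗ[A] M')
    {p : PrimeSpectrum A} {d : ℕ} (h : FreeAt A M p d) : FreeAt A M' p d := by
  rw [freeAt_iff] at h ⊢
  rwa [← Module.freeLocus_congr e, ← Module.rankAtStalk_eq_of_equiv e]

lemma FreeAt.basis [Module.Finite A M] {p : PrimeSpectrum A} {d : ℕ} (h : FreeAt A M p d) :
    Nonempty (Module.Basis (Fin d) (Localization.AtPrime p.asIdeal)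
      (Localization.AtPrime p.asIdeal ⊗[A] M)) := by
  obtain ⟨h1, h2⟩ := h
  exact ⟨Module.finBasisOfFinrankEq _ _ h2⟩

/-- Flatness descends along faithfully flat ring homomorphisms. -/
lemma flat_of_flat_tensorProduct [Module.FaithfullyFlat A B] [Module.Flat B (B ⊗[A] M)] :
    Module.Flat A M := by
  have : Module.Flat A (B ⊗[A] M) := Module.Flat.trans A B _
  rw [Module.Flat.iff_lTensor_injectiveₛ]
  intro P _ _ N'
  rw [← Module.FaithfullyFlat.lTensor_injective_iff_injective A B]
  have h := Module.Flat.lTensor_preserves_injective_linearMap (M := B ⊗[A] M) N'.subtype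
    N'.injective_subtype
  have : (LinearMap.lTensor B (LinearMap.lTensor M N'.subtype)) =
      (TensorProduct.assoc A B M P).toLinearMap ∘ₗ (LinearMap.lTensor (B ⊗[A] M) N'.subtype) ∘ₗ
        (TensorProduct.assoc A B M N').symm.toLinearMap := by
    ext
    simp
  rw [this]
  simpa using h

/-- Finite presentation descends along faithfully flat ring homomorphisms. -/
lemma finitePresentation_of_tensorProduct [Module.FaithfullyFlat A B]
    [Module.FinitePresentation B (B ⊗[A] M)] : Module.FinitePresentation A M := by
  have : Module.Finite A M := Module.Finite.of_finite_tensorProduct_of_faithfullyFlat B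
  obtain ⟨n, f, hf⟩ := Module.Finite.exists_fin' A M
  have hf' : Function.Surjective (f.baseChange B) := f.lTensor_surjective B hf
  have h1 := Module.FinitePresentation.fg_ker (f.baseChange B) hf'
  have h2 : Function.Exact (LinearMap.lTensor B (LinearMap.ker f).subtype)
      (LinearMap.lTensor B f) :=
    lTensor_exact B (LinearMap.exact_subtype_ker_map f) hf
  let g : B ⊗[A] (LinearMap.ker f) →ₗ[B] LinearMap.ker (f.baseChange B) :=
    ((LinearMap.ker f).subtype.baseChange B).codRestrict _ (fun x => by
      have := h2.apply_apply_eq_zero x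
      exact this)
  have hg : Function.Bijective g := by
    constructor
    · have : Function.Injective ((LinearMap.ker f).subtype.baseChange B) :=
        Module.Flat.lTensor_preserves_injective_linearMap (M := B) _
          (LinearMap.ker f).injective_subtype
      intro x y hxy
      exact this (congrArg Subtype.val hxy)
    · rintro ⟨y, hy⟩
      obtain ⟨x, hx⟩ := (h2 y).1 hy
      exact ⟨x, Subtype.ext hx⟩
  have h3 : Module.Finite B (LinearMap.ker (f.baseChange B)) := Module.Finite.iff_fg.2 h1
  have h4 : Module.Finite B (B ⊗[A] (LinearMap.ker f)) :=
    Module.Finite.equiv (LinearEquiv.ofBijective g hg).symm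
  have h5 : Module.Finite A (LinearMap.ker f) :=
    Module.Finite.of_finite_tensorProduct_of_faithfullyFlat B
  exact Module.finitePresentation_of_surjective f hf (Module.Finite.iff_fg.1 h5)

/-- The stalk of a base change is the base change of the stalk. -/
lemma exists_stalk_equiv {h : M →ₗ[A] N} (hh : IsBaseChange B h) (q : PrimeSpectrum B) :
    ∃ _ : Algebra (Localization.AtPrime (PrimeSpectrum.comap (algebraMap A B) q).asIdeal)
        (Localization.AtPrime q.asIdeal),
      IsScalarTower A (Localization.AtPrime (PrimeSpectrum.comap (algebraMap A B) q).asIdeal)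
        (Localization.AtPrime q.asIdeal) ∧
      IsLocalHom (algebraMap
        (Localization.AtPrime (PrimeSpectrum.comap (algebraMap A B) q).asIdeal)
        (Localization.AtPrime q.asIdeal)) ∧
      Nonempty (Localization.AtPrime q.asIdeal ⊗[B] N ≃ₗ[Localization.AtPrime q.asIdeal]
        Localization.AtPrime q.asIdeal
          ⊗[Localization.AtPrime (PrimeSpectrum.comap (algebraMap A B) q).asIdeal]
          (Localization.AtPrime (PrimeSpectrum.comap (algebraMap A B) q).asIdeal ⊗[A] M)) := by
  let p := PrimeSpectrum.comap (algebraMap A B) q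
  let := Localization.AtPrime.algebraOfLiesOver p.asIdeal q.asIdeal
  refine ⟨inferInstance, inferInstance, inferInstance, ⟨?_⟩⟩
  exact (AlgebraTensorModule.congr (LinearEquiv.refl _ _) hh.equiv.symm).trans <|
    (AlgebraTensorModule.cancelBaseChange A B _ _ M).trans
    (AlgebraTensorModule.cancelBaseChange A (Localization.AtPrime p.asIdeal) _ _ M).symm

lemma FreeAt.of_isBaseChange {h : M →ₗ[A] N} (hh : IsBaseChange B h) {q : PrimeSpectrum B} {d : ℕ}
    (hp : FreeAt A M (PrimeSpectrum.comap (algebraMap A B) q) d) : FreeAt B N q d := by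
  obtain ⟨_, _, _, ⟨e⟩⟩ := exists_stalk_equiv hh q
  obtain ⟨h1, h2⟩ := hp
  refine ⟨Module.Free.of_equiv e.symm, ?_⟩
  rw [e.finrank_eq, Module.finrank_baseChange, h2]

/-- Freeness of stalks descends along flat ring homomorphisms. -/
lemma FreeAt.of_flat [Module.Flat A B] [Module.Finite A M] {h : M →ₗ[A] N} (hh : IsBaseChange B h)
    {q : PrimeSpectrum B} {d : ℕ} (hq : FreeAt B N q d) :
    FreeAt A M (PrimeSpectrum.comap (algebraMap A B) q) d := by
  obtain ⟨_, _, _, ⟨e⟩⟩ := exists_stalk_equiv hh q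
  obtain ⟨h1, h2⟩ := hq
  let Ap := Localization.AtPrime (PrimeSpectrum.comap (algebraMap A B) q).asIdeal
  have : Module.Flat A (Localization.AtPrime q.asIdeal) := Module.Flat.trans A B _
  have : Module.Flat Ap (Localization.AtPrime q.asIdeal) :=
    (Module.flat_iff_of_isLocalization Ap
      (PrimeSpectrum.comap (algebraMap A B) q).asIdeal.primeCompl _).2 this
  have : Module.FaithfullyFlat Ap (Localization.AtPrime q.asIdeal) :=
    Module.FaithfullyFlat.of_flat_of_isLocalHom
  have h3 := Module.Free.of_equiv e
  have : Module.Flat Ap (Ap ⊗[A] M) :=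
    flat_of_flat_tensorProduct (B := Localization.AtPrime q.asIdeal)
  have h4 : Module.Free Ap (Ap ⊗[A] M) := Module.free_of_flat_of_isLocalRing
  refine ⟨h4, ?_⟩
  rw [e.finrank_eq, Module.finrank_baseChange] at h2
  exact h2

lemma LocallyFreeWithRanks.exists_freeAt {Δ : Set ℕ} (h : LocallyFreeWithRanks A M Δ)
    (p : PrimeSpectrum A) : ∃ d ∈ Δ, FreeAt A M p d := by
  obtain ⟨_, _, h3⟩ := h
  refine ⟨_, h3 p, (freeAt_iff p _).2 ⟨?_, rfl⟩⟩
  rw [Module.freeLocus_eq_univ]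
  trivial

lemma locallyFreeWithRanks_of_freeAt [Module.FinitePresentation A M] {Δ : Set ℕ}
    (h : ∀ p : PrimeSpectrum A, ∃ d ∈ Δ, FreeAt A M p d) : LocallyFreeWithRanks A M Δ := by
  refine ⟨inferInstance, ?_, fun p => ?_⟩
  · rw [← Module.freeLocus_eq_univ_iff, Set.eq_univ_iff_forall]
    intro p
    obtain ⟨d, -, hd⟩ := h p
    exact ((freeAt_iff p d).1 hd).1
  · obtain ⟨d, hd, hd'⟩ := h p
    rw [((freeAt_iff p d).1 hd').2]
    exact hd

lemma FreeAt.exists_open [Module.FinitePresentation A M] {p : PrimeSpectrum A} {d : ℕ}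
    (h : FreeAt A M p d) :
    ∃ g : A, g ∉ p.asIdeal ∧ ∀ p' : PrimeSpectrum A, g ∉ p'.asIdeal → FreeAt A M p' d := by
  obtain ⟨h1, h2⟩ := (freeAt_iff p d).1 h
  obtain ⟨V, hV, hpV, hVc⟩ := (IsLocallyConstant.iff_exists_open _).1
    (Module.isLocallyConstant_rankAtStalk_freeLocus (R := A) (M := M)) ⟨p, h1⟩
  obtain ⟨W, hW, rfl⟩ := isOpen_induced_iff.1 hV
  obtain ⟨_, ⟨g, rfl⟩, hg, hgW⟩ :=
    PrimeSpectrum.isTopologicalBasis_basic_opens.exists_subset_of_mem_open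
    (⟨hpV, h1⟩ : p ∈ W ∩ Module.freeLocus A M) (hW.inter Module.isOpen_freeLocus)
  refine ⟨g, hg, fun p' hp' => (freeAt_iff p' d).2 ⟨(hgW hp').2, ?_⟩⟩
  rw [← h2]
  exact hVc ⟨p', (hgW hp').2⟩ (hgW hp').1

end FreeAt

/-! ### Elements vanishing on an open subset -/

section Vanishing

open TensorProduct

variable {A B M N : Type*} [CommRing A] [CommRing B] [Algebra A B] [AddCommGroup M] [Module A M]
  [AddCommGroup N] [Module A N] [Module B N] [IsScalarTower A B N]

lemma mem_vanishingOn {V : TopologicalSpace.Opens (PrimeSpectrum A)} {m : M} :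
    m ∈ vanishingOn A M V ↔ ∀ p ∈ V, ∃ s ∉ p.asIdeal, s • m = 0 := by
  simp only [vanishingOn, Submodule.mem_iInf, LinearMap.mem_ker]
  refine forall₂_congr fun p _ => ?_
  rw [IsLocalizedModule.eq_zero_iff p.asIdeal.primeCompl]
  constructor
  · rintro ⟨s, hs⟩
    exact ⟨s, s.2, hs⟩
  · rintro ⟨s, hs, h⟩
    exact ⟨⟨s, hs⟩, h⟩

lemma mem_vanishingOn_iff_pow {V : TopologicalSpace.Opens (PrimeSpectrum A)} {ι : Type*}
    {f : ι → A} (hV : ∀ p, p ∈ V ↔ ∃ i, f i ∉ p.asIdeal) {m : M} :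
    m ∈ vanishingOn A M V ↔ ∀ i, ∃ n : ℕ, f i ^ n • m = 0 := by
  rw [mem_vanishingOn]
  constructor
  · intro h i
    have : f i ∈ (Ideal.torsionOf A M m).radical := by
      rw [Ideal.radical_eq_sInf, Ideal.mem_sInf]
      rintro p ⟨hp, hp'⟩
      by_contra hi
      obtain ⟨s, hs, hs'⟩ := h ⟨p, hp'⟩ ((hV _).2 ⟨i, hi⟩)
      exact hs (hp ((Ideal.mem_torsionOf_iff m s).2 hs'))
    obtain ⟨n, hn⟩ := this
    exact ⟨n, (Ideal.mem_torsionOf_iff m _).1 hn⟩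
  · intro h p hp
    obtain ⟨i, hi⟩ := (hV p).1 hp
    obtain ⟨n, hn⟩ := h i
    exact ⟨f i ^ n, fun h' => hi (p.2.mem_of_pow_mem n h'), hn⟩

/-- The elements vanishing on a quasi-compact open subset commute with flat base change. -/
lemma vanishingOn_baseChange [Module.Flat A B] {h : M →ₗ[A] N} (hh : IsBaseChange B h)
    {V : TopologicalSpace.Opens (PrimeSpectrum A)} {V' : TopologicalSpace.Opens (PrimeSpectrum B)}
    {ι : Type*} [Finite ι] {f : ι → A} (hV : ∀ p, p ∈ V ↔ ∃ i, f i ∉ p.asIdeal)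
    (hV' : ∀ q, q ∈ V' ↔ PrimeSpectrum.comap (algebraMap A B) q ∈ V) :
    vanishingOn B N V' = Submodule.span B (h '' vanishingOn A M V) := by
  classical
  have := Fintype.ofFinite ι
  have hVB : ∀ q, q ∈ V' ↔ ∃ i, algebraMap A B (f i) ∉ q.asIdeal := fun q => by
    rw [hV', hV]; rfl
  apply le_antisymm
  · intro y hy
    rw [mem_vanishingOn_iff_pow hVB] at hy
    choose n hn using hy
    -- `y` lies in the kernel of the base change of the map `m ↦ (f i ^ n i • m)_i`
    let ψ : M →ₗ[A] (ι → M) := LinearMap.pi fun i => f i ^ n i • LinearMap.id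
    have hψ : ∀ m ∈ LinearMap.ker ψ, m ∈ vanishingOn A M V := by
      intro m hm
      rw [mem_vanishingOn_iff_pow hV]
      exact fun i => ⟨n i, congrFun (show ψ m = 0 from hm) i⟩
    obtain ⟨z, rfl⟩ := hh.equiv.surjective y
    have hz : LinearMap.lTensor B ψ z = 0 := by
      apply (TensorProduct.piRight A B B (fun _ : ι => M)).injective
      rw [map_zero]
      ext i
      apply hh.equiv.injective
      have key : ∀ z : B ⊗[A] M, hh.equiv (TensorProduct.piRight A B B (fun _ : ι => M)
          (LinearMap.lTensor B ψ z) i) = algebraMap A B (f i ^ n i) • hh.equiv z := by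
        intro z
        induction z with
        | zero => simp
        | add x y hx hy => simp only [map_add, Pi.add_apply, smul_add, hx, hy]
        | tmul b m =>
          rw [LinearMap.lTensor_tmul, TensorProduct.piRight_apply, TensorProduct.piRightHom_tmul,
            IsBaseChange.equiv_tmul, IsBaseChange.equiv_tmul]
          change b • h (f i ^ n i • m) = _
          rw [map_smul, algebraMap_smul, smul_comm]
      rw [Pi.zero_apply, map_zero, key, map_pow, hn i]
    have hex : Function.Exact (LinearMap.lTensor B (LinearMap.ker ψ).subtype)
        (LinearMap.lTensor B ψ) :=
      Module.Flat.lTensor_exact B (LinearMap.exact_subtype_ker_map ψ)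
    obtain ⟨w, rfl⟩ := (hex z).1 hz
    clear hz hn
    induction w with
    | zero => simp
    | add x y hx hy => simp only [map_add]; exact add_mem hx hy
    | tmul b m =>
      rw [LinearMap.lTensor_tmul, IsBaseChange.equiv_tmul]
      exact Submodule.smul_mem _ _ (Submodule.subset_span ⟨m.1, hψ m.1 m.2, rfl⟩)
  · rw [Submodule.span_le]
    rintro _ ⟨m, hm, rfl⟩
    rw [SetLike.mem_coe, mem_vanishingOn_iff_pow hVB]
    intro i
    obtain ⟨n, hn⟩ := (mem_vanishingOn_iff_pow hV).1 hm i
    refine ⟨n, ?_⟩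
    rw [← map_pow, algebraMap_smul, ← map_smul, hn, map_zero]

/-- Base change commutes with quotients. -/
lemma isBaseChange_mapQ {h : M →ₗ[A] N} (hh : IsBaseChange B h) (P : Submodule A M)
    (Q : Submodule B N) (hQ : Q = Submodule.span B (h '' P)) :
    ∃ h' : M ⧸ P →ₗ[A] N ⧸ Q, IsBaseChange B h' := by
  have hPQ : P ≤ (Q.restrictScalars A).comap h := fun m hm => by
    change h m ∈ Q
    rw [hQ]
    exact Submodule.subset_span ⟨m, hm, rfl⟩
  let h' : M ⧸ P →ₗ[A] N ⧸ Q := P.liftQ (((Q.mkQ).restrictScalars A).comp h) (by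
    intro m hm
    rw [LinearMap.mem_ker]
    exact (Submodule.Quotient.mk_eq_zero Q).2 (hPQ hm))
  have hh' : ∀ m, h' (P.mkQ m) = Q.mkQ (h m) := fun m => rfl
  refine ⟨h', IsBaseChange.of_lift_unique _ fun L _ _ _ _ g => ?_⟩
  let _ : AddCommGroup L := Module.addCommMonoidToAddCommGroup B
  let g' : N →ₗ[B] L := hh.lift (g.comp P.mkQ)
  have hg' : ∀ m, g' (h m) = g (P.mkQ m) := fun m => hh.lift_eq _ m
  have hker : Q ≤ LinearMap.ker g' := by
    rw [hQ, Submodule.span_le]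
    rintro _ ⟨m, hm, rfl⟩
    change g' (h m) = 0
    rw [hg', show P.mkQ m = 0 from (Submodule.Quotient.mk_eq_zero P).2 hm, map_zero]
  refine ⟨Q.liftQ g' hker, ?_, fun k hk => ?_⟩
  · ext m
    exact hg' m
  · apply Submodule.linearMap_qext
    apply hh.algHom_ext'
    ext m
    have := LinearMap.congr_fun hk (P.mkQ m)
    exact this.trans (hg' m).symm

end Vanishing

/-! ### Modules with an invertible Fitting ideal -/

section RaynaudGruson

variable {A M : Type*} [CommRing A] [AddCommGroup M] [Module A M]

lemma det_mem_fittingIdeal_of_card {ι κ : Type*} [Fintype ι] [Fintype κ] [DecidableEq κ] {n : ℕ}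
    (hc : Fintype.card ι = n + Fintype.card κ) (m : ι → M) (R : Matrix κ ι A) (e : κ → ι)
    (hm : Submodule.span A (Set.range m) = ⊤) (hR : ∀ i, ∑ j, R i j • m j = 0) :
    (R.submatrix id e).det ∈ fittingIdeal A M n := by
  let α : Fin (n + Fintype.card κ) ≃ ι := (finCongr hc.symm).trans (Fintype.equivFin ι).symm
  let β : Fin (Fintype.card κ) ≃ κ := (Fintype.equivFin κ).symm
  have := det_mem_fittingIdeal (m ∘ α) (R.submatrix β α) (α.symm ∘ e ∘ β)
    (by rw [Set.range_comp, α.range_eq_univ, Set.image_univ, hm])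
    (fun i => by
      rw [← hR (β i)]
      exact α.sum_comp (fun j => R (β i) j • m j))
  convert this using 1
  rw [← Matrix.det_submatrix_equiv_self β]
  congr 1
  ext i j
  simp

/-- If the `d`th Fitting ideal is generated by a minor that is a nonzerodivisor and the previous
Fitting ideal vanishes, then the module is free of rank `d` modulo torsion.  The columns that are
not used by the minor form a basis. -/
lemma exists_basis_quotient_of_minor {d k : ℕ} (x : Fin d → M) (y : Fin k → M)
    (hxy : Submodule.span A (Set.range (Sum.elim x y)) = ⊤) (L : Matrix (Fin k) (Fin d) A)
    (D : Matrix (Fin k) (Fin k) A) (hLD : ∀ i, ∑ j, L i j • x j + ∑ j, D i j • y j = 0)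
    (hD : D.det ∈ nonZeroDivisors A) (h1 : ∀ a ∈ fittingIdeal A M d, D.det ∣ a)
    (h0 : ∀ d', d' + 1 = d → fittingIdeal A M d' = ⊥)
    (T : Submodule A M) (hT : ∀ m, m ∈ T ↔ ∃ n : ℕ, D.det ^ n • m = 0) :
    Nonempty (Module.Basis (Fin d) A (M ⧸ T)) := by
  have hrel : ∀ i, ∑ j, (Matrix.fromCols L D) i j • (Sum.elim x y) j = 0 := fun i => by
    simpa using hLD i
  -- the coefficients of Cramer's rule are minors of `(L, D)`, hence divisible by `det D`
  have hu : ∀ i j, D.det ∣ (D.adjugate * L) i j := by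
    intro i j
    apply h1
    have h2 : (D.adjugate * L) i j =
        ((Matrix.fromCols L D).submatrix id (Function.update Sum.inr i (Sum.inl j))).det := by
      have h3 : (D.adjugate * L) i j = (D.adjugate.mulVec (fun a => L a j)) i := rfl
      rw [h3, ← Matrix.cramer_eq_adjugate_mulVec, Matrix.cramer_apply]
      congr 1
      ext a b
      by_cases hb : b = i
      · subst hb; simp
      · simp [hb]
    rw [h2]
    exact det_mem_fittingIdeal_of_card (by simp) _ _ _ hxy hrel
  choose u hu using hu
  -- so the generators `y` are combinations of the generators `x` modulo torsion
  have hy : ∀ i, T.mkQ (y i) = -∑ j, u i j • T.mkQ (x j) := by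
    intro i
    rw [eq_neg_iff_add_eq_zero, add_comm]
    simp_rw [← map_smul]
    rw [← map_sum, ← map_add]
    refine (Submodule.Quotient.mk_eq_zero T).2 ((hT _).2 ⟨1, ?_⟩)
    have h4 : ∑ l, D.adjugate i l • (∑ j, L l j • x j + ∑ j, D l j • y j) = 0 := by simp [hLD]
    simp_rw [smul_add, Finset.sum_add_distrib, Finset.smul_sum, smul_smul] at h4
    have h7 : ∀ {q : ℕ} (C : Matrix (Fin k) (Fin q) A) (z : Fin q → M),
        ∑ l, ∑ j, (D.adjugate i l * C l j) • z j = ∑ j, (D.adjugate * C) i j • z j := by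
      intro q C z
      rw [Finset.sum_comm]
      refine Finset.sum_congr rfl fun j _ => ?_
      rw [← Finset.sum_smul]
      rfl
    rw [h7, h7, Matrix.adjugate_mul] at h4
    simp_rw [hu] at h4
    rw [pow_one, smul_add, Finset.smul_sum, ← h4, add_comm]
    simp [mul_smul, Matrix.one_apply, ite_smul, add_comm]
  refine ⟨Module.Basis.mk (v := fun i => T.mkQ (x i)) ?_ ?_⟩
  · rw [Fintype.linearIndependent_iff]
    intro c hc j
    simp_rw [← map_smul] at hc
    rw [← map_sum] at hc
    obtain ⟨n, hn⟩ := (hT _).1 ((Submodule.Quotient.mk_eq_zero T).1 hc)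
    obtain ⟨d', rfl⟩ : ∃ d', d' + 1 = d := ⟨d - 1, by have := j.2; omega⟩
    -- a relation `c` between the members of `x` and the rows of `(L, D)` have the minor
    -- `det D ^ n * c j * det D`, which lies in the vanishing Fitting ideal of index `d - 1`
    let R : Matrix (Unit ⊕ Fin k) (Fin (d' + 1) ⊕ Fin k) A :=
      Matrix.fromBlocks (Matrix.of fun _ l => D.det ^ n * c l) 0 L D
    have h5 := det_mem_fittingIdeal_of_card (M := M) (n := d') (by simp; ring) _ R
      (Sum.map (fun _ => j) id) hxy (by
        rintro (i | i)
        · simp only [R, Fintype.sum_sum_type, Matrix.fromBlocks_apply₁₁, Matrix.of_apply,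
            Sum.elim_inl, Matrix.fromBlocks_apply₁₂, Matrix.zero_apply, zero_smul,
            Finset.sum_const_zero, add_zero, mul_smul]
          rw [← Finset.smul_sum, hn]
        · simpa [R] using hLD i)
    have h6 : R.submatrix id (Sum.map (fun _ : Unit => j) id) =
        Matrix.fromBlocks (Matrix.of fun _ _ => D.det ^ n * c j) 0
          (Matrix.of fun i _ => L i j) D := by
      ext (a | a) (b | b) <;> simp [R]
    rw [h0 d' rfl, Ideal.mem_bot, h6, Matrix.det_fromBlocks_zero₁₂, Matrix.det_unique,
      Matrix.of_apply, mul_comm, ← mul_assoc, ← pow_succ'] at h5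
    exact (mul_right_mem_nonZeroDivisors_eq_zero_iff (pow_mem hD _)).1 (by rwa [mul_comm])
  · rw [← Submodule.range_mkQ T, ← Submodule.map_top, ← hxy, Submodule.map_span, Submodule.span_le]
    rintro _ ⟨_, ⟨i | i, rfl⟩, rfl⟩
    · exact Submodule.subset_span ⟨i, rfl⟩
    · rw [SetLike.mem_coe, Sum.elim_inr, hy]
      exact neg_mem (sum_mem fun j _ => Submodule.smul_mem _ _ (Submodule.subset_span ⟨j, rfl⟩))

/-- `exists_basis_quotient_of_minor` for a minor given by a map `e` that selects its columns. -/
lemma exists_basis_quotient {d k : ℕ} (m : Fin (d + k) → M)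
    (R : Matrix (Fin k) (Fin (d + k)) A) (e : Fin k → Fin (d + k))
    (hm : Submodule.span A (Set.range m) = ⊤) (hR : ∀ i, ∑ j, R i j • m j = 0) {a : A}
    (haR : a = (R.submatrix id e).det)
    (ha : a ∈ nonZeroDivisors A) (h1 : ∀ b ∈ fittingIdeal A M d, a ∣ b)
    (h0 : ∀ d', d' + 1 = d → fittingIdeal A M d' = ⊥)
    (T : Submodule A M) (hT : ∀ m, m ∈ T ↔ ∃ n : ℕ, a ^ n • m = 0) :
    Nonempty (Module.Basis (Fin d) A (M ⧸ T)) := by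
  rcases subsingleton_or_nontrivial A with hA | hA
  · have : Subsingleton (M ⧸ T) := Module.subsingleton A _
    exact ⟨Module.Basis.mk (v := 0) (linearIndependent_of_subsingleton)
      (fun x _ => by rw [Subsingleton.elim x 0]; exact zero_mem _)⟩
  have he : Function.Injective e := by
    by_contra he
    rw [Function.Injective] at he
    push Not at he
    obtain ⟨i, j, hij, hne⟩ := he
    rw [Matrix.det_zero_of_column_eq hne (fun l => by simp [hij])] at haR
    exact nonZeroDivisors.ne_zero ha haR
  obtain ⟨σ, hσ⟩ : ∃ σ : Fin d ⊕ Fin k ≃ Fin (d + k), ∀ i, σ (Sum.inr i) = e i := by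
    classical
    have hc : Fintype.card {j // j ∉ Set.range e} = d := by
      rw [Fintype.card_subtype_compl, Fintype.card_fin]
      have : Fintype.card {j // j ∈ Set.range e} = k := by
        rw [← Fintype.card_congr (Equiv.ofInjective e he)]; simp
      rw [this]; omega
    refine ⟨((Fintype.equivFinOfCardEq hc).symm.sumCongr (Equiv.ofInjective e he)).trans
      ((Equiv.sumComm _ _).trans (Equiv.Set.sumCompl (Set.range e))), fun i => ?_⟩
    rfl
  subst haR
  have hD : R.submatrix id e = R.submatrix id (σ ∘ Sum.inr) := by
    congr 1; ext i; simp [hσ]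
  rw [hD] at ha h1 hT
  refine exists_basis_quotient_of_minor (m ∘ σ ∘ Sum.inl) (m ∘ σ ∘ Sum.inr) ?_
    (R.submatrix id (σ ∘ Sum.inl)) (R.submatrix id (σ ∘ Sum.inr)) (fun i => ?_) ha h1 h0 T hT
  · have : Sum.elim (m ∘ σ ∘ Sum.inl) (m ∘ σ ∘ Sum.inr) = m ∘ σ := by
      ext (i | i) <;> rfl
    rw [this, Set.range_comp, σ.range_eq_univ, Set.image_univ, hm]
  · rw [← hR i, ← σ.sum_comp, Fintype.sum_sum_type]
    rfl

end RaynaudGruson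

/-! ### The flattening ideal -/

section Center

open TensorProduct

variable {A B M N : Type*} [CommRing A] [CommRing B] [Algebra A B] [AddCommGroup M] [Module A M]
  [AddCommGroup N] [Module A N] [Module B N] [IsScalarTower A B N]

/-- If a product of ideals is generated by a nonzerodivisor, then locally each factor is generated
by a member of any given generating set. -/
lemma exists_generator_of_mul_eq_span {L₁ L₂ : Ideal A} {a : A} (ha : a ∈ nonZeroDivisors A)
    (h : L₁ * L₂ = Ideal.span {a}) {G : Set A} (hG : L₁ = Ideal.span G) (q : PrimeSpectrum A) :
    ∃ x ∈ G, ∃ g ∉ q.asIdeal, (∃ y, x * y = a * g) ∧ ∀ l ∈ L₁, ∃ c, g * l = c * x := by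
  have hdvd : ∀ x ∈ L₁, ∀ y ∈ L₂, ∃ g, x * y = a * g := fun x hx y hy =>
    Ideal.mem_span_singleton.1 (h ▸ Ideal.mul_mem_mul hx hy)
  obtain ⟨x, hx, y, hy, g, hg, hxy⟩ : ∃ x ∈ G, ∃ y ∈ L₂, ∃ g ∉ q.asIdeal, x * y = a * g := by
    by_contra! hcon
    have hle : L₁ * L₂ ≤ Ideal.span {a} * q.asIdeal := by
      rw [hG, Ideal.mul_le]
      intro l hl y hy
      induction hl using Submodule.span_induction with
      | mem x hx =>
        obtain ⟨g, hg⟩ := hdvd x (hG ▸ Ideal.subset_span hx) y hy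
        rw [hg]
        exact Ideal.mul_mem_mul (Ideal.mem_span_singleton_self a)
          (by_contra fun hgq => hcon x hx y hy g hgq hg)
      | zero => simp
      | add x₁ x₂ _ _ h₁ h₂ => rw [add_mul]; exact add_mem h₁ h₂
      | smul r x _ hx => rw [smul_eq_mul, mul_assoc]; exact Ideal.mul_mem_left _ _ hx
    have ha' : a ∈ Ideal.span {a} * q.asIdeal := hle (h ▸ Ideal.mem_span_singleton_self a)
    obtain ⟨r, hr, hra⟩ := Ideal.mem_span_singleton_mul.1 ha'
    have h1 : (1 - r) * a = 0 := by rw [sub_mul, one_mul, mul_comm, hra, sub_self]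
    have h2 : (1 - r) = 0 := (mul_right_mem_nonZeroDivisors_eq_zero_iff ha).1 h1
    exact q.2.ne_top ((Ideal.eq_top_iff_one _).2 ((sub_eq_zero.1 h2) ▸ hr))
  refine ⟨x, hx, g, hg, ⟨y, hxy⟩, fun l hl => ?_⟩
  obtain ⟨c, hc⟩ := hdvd l hl y hy
  refine ⟨c, ?_⟩
  have : (g * l - c * x) * a = 0 := by
    rw [sub_mul, mul_right_comm, mul_comm g a, ← hxy, mul_right_comm c x a, mul_comm c a, ← hc]
    ring
  exact sub_eq_zero.1 ((mul_right_mem_nonZeroDivisors_eq_zero_iff ha).1 this)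

variable (A M) in
/-- The ideal `F₀(⋂ J_δ) · ∏ (F_δ(M) + J_δ)`, where `J_δ` is the ideal of the schematic closure of
the open subset `V δ` of `Spec A`. -/
def flatteningIdeal (V : ℕ → TopologicalSpace.Opens (PrimeSpectrum A)) (Δ : Set ℕ) : Ideal A :=
  fittingIdeal A (⨅ δ ∈ Δ, vanishingOn A A (V δ) : Ideal A) 0 *
    ∏ᶠ (δ : ℕ) (_ : δ ∈ Δ), (fittingIdeal A M δ ⊔ vanishingOn A A (V δ))

open Classical in
/-- Only finitely many factors of the flattening ideal are nontrivial. -/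
lemma flatteningIdeal_eq (V : ℕ → TopologicalSpace.Opens (PrimeSpectrum A)) (Δ : Set ℕ) {t : ℕ}
    (x : Fin t → M) (hx : Submodule.span A (Set.range x) = ⊤) :
    flatteningIdeal A M V Δ = fittingIdeal A (⨅ δ ∈ Δ, vanishingOn A A (V δ) : Ideal A) 0 *
      ∏ δ ∈ (Finset.range (t + 1)).filter (· ∈ Δ),
        (fittingIdeal A M δ ⊔ vanishingOn A A (V δ)) := by
  rw [flatteningIdeal]
  congr 1
  apply finprod_mem_eq_prod_of_inter_mulSupport_eq
  ext δ
  simp only [Set.mem_inter_iff, Function.mem_mulSupport, Finset.coe_filter, Finset.mem_range,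
    Set.mem_ofPred_eq]
  constructor
  · rintro ⟨h1, h2⟩
    refine ⟨⟨?_, h1⟩, h2⟩
    by_contra h3
    rw [fittingIdeal_eq_top_of_le (by omega) x hx, top_sup_eq] at h2
    exact h2 Ideal.one_eq_top.symm
  · rintro ⟨⟨_, h1⟩, h2⟩
    exact ⟨h1, h2⟩

open Classical in
/-- Where the rank exceeds `n` the `n`th Fitting ideal vanishes; on the other strata one of the
factors `j δ` does. -/
lemma mul_prod_mem_iInf_vanishingOn [Module.Finite A M]
    {V : ℕ → TopologicalSpace.Opens (PrimeSpectrum A)} {Δ : Set ℕ}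
    (hV : ∀ δ, ∀ p ∈ V δ, FreeAt A M p δ) {n : ℕ} {f : A} (hf : f ∈ fittingIdeal A M n)
    (j : ℕ → A) (hj : ∀ δ ∈ Δ, δ ≤ n → j δ ∈ vanishingOn A A (V δ)) :
    f * ∏ δ ∈ (Finset.range (n + 1)).filter (· ∈ Δ), j δ ∈
      (⨅ δ ∈ Δ, vanishingOn A A (V δ) : Ideal A) := by
  simp only [Submodule.mem_iInf]
  intro δ hδ
  by_cases hδn : δ ≤ n
  · refine Ideal.mul_mem_left _ _ (Ideal.mem_of_dvd _ (Finset.dvd_prod_of_mem j ?_) (hj δ hδ hδn))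
    simp [hδ]
    omega
  · rw [mem_vanishingOn]
    intro p hp
    obtain ⟨b⟩ := (hV δ p hp).basis
    have h1 := fittingIdeal_eq_bot_of_basis b (n := n) (by omega)
    rw [← fittingIdeal_map (TensorProduct.isBaseChange A M (Localization.AtPrime p.asIdeal))] at h1
    have h2 : algebraMap A (Localization.AtPrime p.asIdeal) f = 0 := by
      have := Ideal.mem_map_of_mem (algebraMap A (Localization.AtPrime p.asIdeal)) hf
      rwa [h1, Ideal.mem_bot] at this
    obtain ⟨s, hs⟩ := (IsLocalization.map_eq_zero_iff p.asIdeal.primeCompl _ f).1 h2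
    exact ⟨s, s.2, by rw [smul_eq_mul, ← mul_assoc, hs, zero_mul]⟩

open Classical in
/-- If every factor of the flattening ideal becomes invertible with a generator in a given
generating set, then the base change of `M` is free modulo torsion. -/
lemma exists_basis_quotient_vanishingOn [Nontrivial B] [Module.Finite A M] {h : M →ₗ[A] N}
    (hh : IsBaseChange B h) {V : ℕ → TopologicalSpace.Opens (PrimeSpectrum A)} {Δ : Set ℕ}
    (hV : ∀ δ, ∀ p ∈ V δ, FreeAt A M p δ) {t : ℕ}
    (y : Fin t → M) (hy : Submodule.span A (Set.range y) = ⊤) {a : B} (ha : a ∈ nonZeroDivisors B)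
    {x₀ : A} (hx₀ : x₀ ∈ fittingIdeal A (⨅ δ ∈ Δ, vanishingOn A A (V δ) : Ideal A) 0)
    (hx₀a : algebraMap A B x₀ ∣ a) {G : ℕ → Set A} (hG : ∀ δ, G δ ⊆ {b : A | ∃ (k : ℕ)
      (m : Fin (δ + k) → M) (R : Matrix (Fin k) (Fin (δ + k)) A) (e : Fin k → Fin (δ + k)),
      Submodule.span A (Set.range m) = ⊤ ∧ (∀ i, ∑ j, R i j • m j = 0) ∧
        b = (R.submatrix id e).det})
    {x : ℕ → A} (hx : ∀ δ ∈ Δ, δ ≤ t → x δ ∈ G δ ∪ vanishingOn A A (V δ))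
    (hxa : ∀ δ ∈ Δ, δ ≤ t → algebraMap A B (x δ) ∣ a)
    (hxF : ∀ δ ∈ Δ, δ ≤ t → ∀ b ∈ fittingIdeal A M δ, algebraMap A B (x δ) ∣ algebraMap A B b)
    {U : TopologicalSpace.Opens (PrimeSpectrum B)} (hU : ∀ q, q ∈ U ↔ a ∉ q.asIdeal) :
    ∃ δ ∈ Δ, Nonempty (Module.Basis (Fin δ) B (N ⧸ vanishingOn B N U)) := by
  have hnzd : ∀ b : B, b ∣ a → b ∈ nonZeroDivisors B := by
    rintro b ⟨c, rfl⟩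
    exact (mul_mem_nonZeroDivisors.1 ha).1
  have hx₀' := hnzd _ hx₀a
  -- if the factors `x δ` of rank at most `n` are all of the second kind, then the `n`th Fitting
  -- ideal of the base change vanishes
  have key : ∀ n ≤ t, (∀ δ ∈ Δ, δ ≤ n → x δ ∈ vanishingOn A A (V δ)) →
      fittingIdeal B N n = ⊥ := by
    intro n hn hj
    rw [← fittingIdeal_map hh, Ideal.map_eq_bot_iff_le_ker]
    intro f hf
    have h1 := mul_prod_mem_iInf_vanishingOn hV hf x hj
    have h2 := congrArg Subtype.val (smul_eq_zero_of_mem_fittingIdeal_zero hx₀ ⟨_, h1⟩)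
    have h3 : x₀ * (f * ∏ δ ∈ (Finset.range (n + 1)).filter (· ∈ Δ), x δ) = 0 := h2
    have h4 := congrArg (algebraMap A B) h3
    rw [map_mul, map_mul, map_zero, mul_left_mem_nonZeroDivisors_eq_zero_iff hx₀', map_prod] at h4
    refine (mul_right_mem_nonZeroDivisors_eq_zero_iff (Submonoid.prod_mem _ fun δ hδ => ?_)).1 h4
    rw [Finset.mem_filter, Finset.mem_range] at hδ
    exact hnzd _ (hxa δ hδ.2 (by omega))
  have hex : ∃ δ, δ ∈ Δ ∧ δ ≤ t ∧ x δ ∉ vanishingOn A A (V δ) := by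
    by_contra! hcon
    have h1 := key t le_rfl hcon
    rw [← fittingIdeal_map hh, fittingIdeal_eq_top y hy, Ideal.map_top] at h1
    exact top_ne_bot h1
  obtain ⟨hδ, hδt, hδx⟩ := Nat.find_spec hex
  have hmin := fun δ' h => Nat.find_min hex (m := δ') h
  generalize Nat.find hex = δ at *
  refine ⟨δ, hδ, ?_⟩
  obtain ⟨k, m, R, e, hm, hR, hdet⟩ := hG δ ((hx δ hδ hδt).resolve_right hδx)
  set b := algebraMap A B (x δ) with hb
  let U' : TopologicalSpace.Opens (PrimeSpectrum B) := PrimeSpectrum.basicOpen b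
  have hT' : ∀ z, z ∈ vanishingOn B N U' ↔ ∃ n : ℕ, b ^ n • z = 0 := fun z => by
    rw [mem_vanishingOn_iff_pow (f := fun _ : Unit => b) (fun p => by simp [U'])]
    simp
  have hT : ∀ z, z ∈ vanishingOn B N U ↔ ∃ n : ℕ, a ^ n • z = 0 := fun z => by
    rw [mem_vanishingOn_iff_pow (f := fun _ : Unit => a) (fun p => by simp [hU])]
    simp
  obtain ⟨bas⟩ := exists_basis_quotient (A := B) (M := N) (h ∘ m) (R.map (algebraMap A B)) e
    (span_range_eq_top_of_isBaseChange hh m hm)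
    (fun i => by
      simp only [Matrix.map_apply, Function.comp_apply, algebraMap_smul, ← map_smul]
      rw [← map_sum, hR, map_zero])
    (a := b) (by rw [hb, hdet, RingHom.map_det]; rfl) (hnzd _ (hxa δ hδ hδt))
    (fun c hc => by
      rw [← fittingIdeal_map hh] at hc
      rw [← Ideal.mem_span_singleton]
      refine (Ideal.map_le_iff_le_comap.2 fun f hf => ?_ : _ ≤ Ideal.span {b}) hc
      exact Ideal.mem_span_singleton.2 (hxF δ hδ hδt f hf))
    (fun d' hd' => key d' (by omega) fun δ' hδ' hle => by
      by_contra hcon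
      exact hmin δ' (by omega) ⟨hδ', by omega, hcon⟩)
    (vanishingOn B N U') hT'
  have hTT : vanishingOn B N U' = vanishingOn B N U := by
    ext z
    rw [hT', hT]
    constructor
    · rintro ⟨n, hn⟩
      obtain ⟨c, hc⟩ := hxa δ hδ hδt
      exact ⟨n, by rw [hc, mul_pow, mul_comm, mul_smul, hn, smul_zero]⟩
    · rintro ⟨n, hn⟩
      rw [← hT', ← Submodule.Quotient.mk_eq_zero]
      apply bas.ext_elem
      intro i
      have h1 : a ^ n • (Submodule.Quotient.mk z : N ⧸ vanishingOn B N U') = 0 := by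
        rw [← Submodule.Quotient.mk_smul, hn, Submodule.Quotient.mk_zero]
      have h2 := congrArg (fun w => bas.repr w i) h1
      simp only [map_smul, Finsupp.smul_apply, smul_eq_mul, map_zero, Finsupp.zero_apply] at h2 ⊢
      exact (mul_left_mem_nonZeroDivisors_eq_zero_iff (pow_mem ha n)).1 h2
  rw [← hTT]
  exact ⟨bas⟩

lemma FreeAt.of_basis {d : ℕ} (b : Module.Basis (Fin d) A M) (p : PrimeSpectrum A) :
    FreeAt A M p d := by
  have := Module.Free.of_basis b
  refine ⟨inferInstance, ?_⟩
  have b' := b.baseChange (Localization.AtPrime p.asIdeal)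
  rw [Module.finrank_eq_card_basis b', Fintype.card_fin]

open Classical in
/-- Where the flattening ideal becomes invertible, the base change of `M` modulo torsion is locally
free. -/
theorem locallyFreeWithRanks_quotient [Module.Finite A M] {h : M →ₗ[A] N}
    (hh : IsBaseChange B h) {V : ℕ → TopologicalSpace.Opens (PrimeSpectrum A)} {Δ : Set ℕ}
    (hV : ∀ δ, ∀ p ∈ V δ, FreeAt A M p δ) {a : B} (ha : a ∈ nonZeroDivisors B)
    (hI : (flatteningIdeal A M V Δ).map (algebraMap A B) = Ideal.span {a})
    {U : TopologicalSpace.Opens (PrimeSpectrum B)} (hU : ∀ q, q ∈ U ↔ a ∉ q.asIdeal) :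
    LocallyFreeWithRanks B (N ⧸ vanishingOn B N U) Δ := by
  obtain ⟨t, y, hy⟩ := Module.Finite.exists_fin (R := A) (M := M)
  set J₀ : Ideal A := ⨅ δ ∈ Δ, vanishingOn A A (V δ) with hJ₀
  set L : ℕ → Ideal A := fun δ => fittingIdeal A M δ ⊔ vanishingOn A A (V δ) with hL
  set s := (Finset.range (t + 1)).filter (· ∈ Δ) with hs
  rw [flatteningIdeal_eq V Δ y hy, Ideal.map_mul,
    show Ideal.map (algebraMap A B) (∏ δ ∈ s, L δ) = ∏ δ ∈ s, (L δ).map (algebraMap A B) from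
      map_prod (Ideal.mapHom (algebraMap A B)) _ _] at hI
  have hUa : ∀ q, q ∈ U ↔ ∃ _ : Unit, (fun _ : Unit => a) () ∉ q.asIdeal := fun q => by
    simp [hU]
  -- near each point, all factors have a generator from their generating sets
  have hloc : ∀ q : PrimeSpectrum B, ∃ g ∉ q.asIdeal, ∃ δ ∈ Δ,
      ∃ (P : Type _) (_ : AddCommGroup P) (_ : Module B P) (_ : Module (Localization.Away g) P)
        (_ : IsScalarTower B (Localization.Away g) P) (f : (N ⧸ vanishingOn B N U) →ₗ[B] P),
        IsBaseChange (Localization.Away g) f ∧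
          Nonempty (Module.Basis (Fin δ) (Localization.Away g) P) := by
    intro q
    obtain ⟨_, ⟨x₀, hx₀, rfl⟩, g₀, hg₀, ⟨y₀, hy₀⟩, -⟩ :=
      exists_generator_of_mul_eq_span ha hI (G := algebraMap A B '' fittingIdeal A J₀ 0) rfl q
    have hδ : ∀ δ, ∃ (x : A) (g : B), g ∉ q.asIdeal ∧ (δ ∈ s →
        (x ∈ {b : A | ∃ (k : ℕ)
      (m : Fin (δ + k) → M) (R : Matrix (Fin k) (Fin (δ + k)) A) (e : Fin k → Fin (δ + k)),
      Submodule.span A (Set.range m) = ⊤ ∧ (∀ i, ∑ j, R i j • m j = 0) ∧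
        b = (R.submatrix id e).det} ∪ (vanishingOn A A (V δ) : Set A)) ∧
        (∃ y, algebraMap A B x * y = a * g) ∧
          ∀ b ∈ fittingIdeal A M δ, ∃ c, g * algebraMap A B b = c * algebraMap A B x) := by
      intro δ
      by_cases hδ : δ ∈ s
      · have h1 : (L δ).map (algebraMap A B) * ((fittingIdeal A J₀ 0).map (algebraMap A B) *
            ∏ δ' ∈ s.erase δ, (L δ').map (algebraMap A B)) = Ideal.span {a} := by
          rw [← hI, ← Finset.mul_prod_erase s _ hδ, mul_left_comm]
        obtain ⟨_, ⟨x, hx, rfl⟩, g, hg, hxy, hl⟩ := exists_generator_of_mul_eq_span ha h1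
          (G := algebraMap A B '' ({b : A | ∃ (k : ℕ)
              (m : Fin (δ + k) → M) (R : Matrix (Fin k) (Fin (δ + k)) A) (e : Fin k → Fin (δ + k)),
              Submodule.span A (Set.range m) = ⊤ ∧ (∀ i, ∑ j, R i j • m j = 0) ∧
                b = (R.submatrix id e).det} ∪ (vanishingOn A A (V δ) : Set A)))
          (by rw [← Ideal.map_span, Ideal.span_union, Ideal.span_eq]; rfl) q
        exact ⟨x, g, hg, fun _ => ⟨hx, hxy, fun b hb =>
          hl _ (Ideal.mem_map_of_mem _ (Ideal.mem_sup_left hb))⟩⟩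
      · exact ⟨0, 1, fun h => q.2.ne_top ((Ideal.eq_top_iff_one _).2 h), fun h => absurd h hδ⟩
    choose x g hg hx using hδ
    -- invert the functions that occur in these statements
    let G := g₀ * ∏ δ ∈ s, g δ
    have hG : G ∉ q.asIdeal := by
      intro hmem
      rcases q.2.mem_or_mem hmem with h1 | h1
      · exact hg₀ h1
      · obtain ⟨δ, -, h2⟩ := (q.2.prod_mem_iff).1 h1
        exact hg δ h2
    let C := Localization.Away G
    have hGu : IsUnit (algebraMap B C G) := IsLocalization.Away.algebraMap_isUnit G
    have hg₀u : IsUnit (algebraMap B C g₀) := isUnit_of_dvd_unit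
      (map_dvd _ (Dvd.intro _ rfl)) hGu
    have hgu : ∀ δ ∈ s, IsUnit (algebraMap B C (g δ)) := fun δ hδ => isUnit_of_dvd_unit
      (map_dvd _ ((Finset.dvd_prod_of_mem g hδ).mul_left g₀)) hGu
    have hnt : Nontrivial C := by
      obtain ⟨q', -⟩ : q ∈ Set.range (PrimeSpectrum.comap (algebraMap B C)) := by
        rw [PrimeSpectrum.localization_away_comap_range _ G]
        exact hG
      exact nontrivial_of_ne (0 : C) 1 fun h =>
        q'.2.ne_top ((Ideal.eq_top_iff_one _).2 (h ▸ zero_mem _))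
    have hmem : ∀ δ ∈ Δ, δ ≤ t → δ ∈ s := fun δ h1 h2 => by
      rw [hs, Finset.mem_filter, Finset.mem_range]
      exact ⟨by omega, h1⟩
    let UC : TopologicalSpace.Opens (PrimeSpectrum C) :=
      PrimeSpectrum.basicOpen (algebraMap B C a)
    have hUC : ∀ q, q ∈ UC ↔ PrimeSpectrum.comap (algebraMap B C) q ∈ U := fun q => by
      rw [hU]; rfl
    have hbc : IsBaseChange C (TensorProduct.mk B C N 1) := TensorProduct.isBaseChange B N C
    obtain ⟨δ, hδ, hb⟩ := exists_basis_quotient_vanishingOn (B := C) (hh.comp hbc) hV y hy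
      (a := algebraMap B C a) (IsLocalization.map_nonZeroDivisors_le (Submonoid.powers G) C
        (Submonoid.mem_map_of_mem _ ha))
      hx₀ (by
        have := congrArg (algebraMap B C) hy₀
        rw [map_mul, map_mul] at this
        rw [IsScalarTower.algebraMap_apply A B C]
        exact (hg₀u.dvd_mul_right).1 ⟨_, this.symm⟩) (G := fun δ => _) (fun δ => le_rfl)
      (x := x) (fun δ h1 h2 => (hx δ (hmem δ h1 h2)).1)
      (fun δ h1 h2 => by
        obtain ⟨-, ⟨y, hy⟩, -⟩ := hx δ (hmem δ h1 h2)
        have := congrArg (algebraMap B C) hy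
        rw [map_mul, map_mul] at this
        rw [IsScalarTower.algebraMap_apply A B C]
        exact ((hgu δ (hmem δ h1 h2)).dvd_mul_right).1 ⟨_, this.symm⟩)
      (fun δ h1 h2 b hb => by
        obtain ⟨-, -, h3⟩ := hx δ (hmem δ h1 h2)
        obtain ⟨c, hc⟩ := h3 b hb
        have := congrArg (algebraMap B C) hc
        rw [map_mul, map_mul] at this
        rw [IsScalarTower.algebraMap_apply A B C, IsScalarTower.algebraMap_apply A B C]
        exact ((hgu δ (hmem δ h1 h2)).dvd_mul_left).1 ⟨algebraMap B C c, by rw [this, mul_comm]⟩)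
      (U := UC) (fun q => Iff.rfl)
    obtain ⟨f, hf⟩ := isBaseChange_mapQ hbc (vanishingOn B N U) (vanishingOn C (C ⊗[B] N) UC)
      (vanishingOn_baseChange hbc hUa hUC)
    exact ⟨G, hG, δ, hδ, _, _, _, _, inferInstance, f, hf, hb⟩
  -- the quotient is finitely presented since it is locally free on a basic open covering
  choose g hg δ hδ P i1 i2 i3 i4 f hf hb using hloc
  have hfp : Module.FinitePresentation B (N ⧸ vanishingOn B N U) := by
    choose k hk using fun r : Set.range g => r.2
    have (r : Set.range g) : IsLocalization.Away r.1 (Localization.Away (g (k r))) := by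
      rw [← hk r]; infer_instance
    have (r : Set.range g) : IsLocalizedModule (Submonoid.powers r.1) (f (k r)) := by
      rw [isLocalizedModule_iff_isBaseChange (Submonoid.powers r.1) (Localization.Away (g (k r)))]
      exact hf (k r)
    refine Module.FinitePresentation.of_localizationSpan' (Set.range g) ?_
      (Rₚ := fun r => Localization.Away (g (k r))) (fun r => f (k r)) fun r => ?_
    · by_contra hne
      obtain ⟨m, hm, hle⟩ := Ideal.exists_le_maximal _ hne
      exact hg ⟨m, hm.isPrime⟩ (hle (Ideal.subset_span ⟨_, rfl⟩))
    · obtain ⟨b⟩ := hb (k r)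
      have := Module.Finite.of_basis b
      have := Module.Free.of_basis b
      exact Module.finitePresentation_of_projective _ _
  refine locallyFreeWithRanks_of_freeAt fun q => ⟨δ q, hδ q, ?_⟩
  obtain ⟨b⟩ := hb q
  obtain ⟨q', hq'⟩ : ∃ q' : PrimeSpectrum (Localization.Away (g q)),
      PrimeSpectrum.comap (algebraMap B _) q' = q := by
    have : q ∈ Set.range (PrimeSpectrum.comap (algebraMap B (Localization.Away (g q)))) := by
      rw [PrimeSpectrum.localization_away_comap_range _ (g q)]
      exact hg q
    exact this
  have := FreeAt.of_flat (hf q) (FreeAt.of_basis b q')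
  rwa [hq'] at this

end Center

/-! ### The zero locus and the flat base change of the flattening ideal -/

section CenterProperties

open TensorProduct

variable {A B M N : Type*} [CommRing A] [CommRing B] [Algebra A B] [AddCommGroup M] [Module A M]
  [AddCommGroup N] [Module A N] [Module B N] [IsScalarTower A B N]

lemma exists_finite_cover_of_isNoetherianRing [IsNoetherianRing A]
    (V : TopologicalSpace.Opens (PrimeSpectrum A)) :
    ∃ (n : ℕ) (f : Fin n → A), ∀ p, p ∈ V ↔ ∃ i, f i ∉ p.asIdeal := by
  obtain ⟨s, hs⟩ := (PrimeSpectrum.isOpen_iff _).1 V.2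
  obtain ⟨n, f, hf⟩ := Submodule.fg_iff_exists_fin_generating_family.1
    (IsNoetherian.noetherian (Ideal.span s))
  refine ⟨n, f, fun p => ?_⟩
  have h1 : p ∈ V ↔ ¬ p ∈ V.carrierᶜ := by simp
  rw [h1, hs, ← PrimeSpectrum.zeroLocus_span, PrimeSpectrum.mem_zeroLocus,
    SetLike.coe_subset_coe, ← hf, Submodule.span_le, Set.range_subset_iff]
  push Not
  rfl

lemma iInf_vanishingOn (V : ℕ → TopologicalSpace.Opens (PrimeSpectrum A)) (Δ : Set ℕ) :
    (⨅ δ ∈ Δ, vanishingOn A M (V δ)) = vanishingOn A M (⨆ δ ∈ Δ, V δ) := by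
  ext m
  simp only [Submodule.mem_iInf, mem_vanishingOn, TopologicalSpace.Opens.mem_iSup]
  exact ⟨fun h p ⟨δ, hδ, hp⟩ => h δ hδ p hp, fun h δ hδ p hp => h p ⟨δ, hδ, hp⟩⟩

/-- A flat base change of an ideal is the extended ideal. -/
lemma exists_isBaseChange_ideal_map [Module.Flat A B] (I : Ideal A) :
    ∃ h : I →ₗ[A] I.map (algebraMap A B), IsBaseChange B h := by
  let g : B ⊗[A] I →ₗ[B] B :=
    (TensorProduct.AlgebraTensorModule.rid A B B).toLinearMap ∘ₗ I.subtype.baseChange B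
  have hg : Function.Injective g :=
    (TensorProduct.AlgebraTensorModule.rid A B B).injective.comp
      (Module.Flat.lTensor_preserves_injective_linearMap (M := B) I.subtype I.injective_subtype)
  have hg' : ∀ b i, g (b ⊗ₜ i) = b * algebraMap A B i := fun b i => by
    simp [g, Algebra.smul_def, mul_comm]
  have hr : LinearMap.range g = I.map (algebraMap A B) := by
    apply le_antisymm
    · rintro _ ⟨z, rfl⟩
      induction z with
      | zero => simp
      | add x y hx hy => rw [map_add]; exact add_mem hx hy
      | tmul b i => rw [hg']; exact Ideal.mul_mem_left _ _ (Ideal.mem_map_of_mem _ i.2)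
    · refine Ideal.map_le_iff_le_comap.2 fun i hi => ⟨1 ⊗ₜ ⟨i, hi⟩, ?_⟩
      rw [hg', one_mul]
  let h : I →ₗ[A] I.map (algebraMap A B) :=
    LinearMap.codRestrict ((I.map (algebraMap A B)).restrictScalars A)
      (Algebra.linearMap A B ∘ₗ I.subtype) (fun i => Ideal.mem_map_of_mem _ i.2)
  refine ⟨h, IsBaseChange.of_equiv ((LinearEquiv.ofInjective g hg).trans
    (LinearEquiv.ofEq _ _ hr)) fun i => Subtype.ext ?_⟩
  change g (1 ⊗ₜ i) = _
  rw [hg', one_mul]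
  rfl

/-- The flattening ideal commutes with flat base change. -/
lemma flatteningIdeal_map [IsNoetherianRing A] [Module.Flat A B] [Module.Finite A M]
    {h : M →ₗ[A] N} (hh : IsBaseChange B h) {V : ℕ → TopologicalSpace.Opens (PrimeSpectrum A)}
    {V' : ℕ → TopologicalSpace.Opens (PrimeSpectrum B)} (Δ : Set ℕ)
    (hV : ∀ δ q, q ∈ V' δ ↔ PrimeSpectrum.comap (algebraMap A B) q ∈ V δ) :
    (flatteningIdeal A M V Δ).map (algebraMap A B) = flatteningIdeal B N V' Δ := by
  classical
  have hvan : ∀ (W : TopologicalSpace.Opens (PrimeSpectrum A))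
      (W' : TopologicalSpace.Opens (PrimeSpectrum B)),
      (∀ q, q ∈ W' ↔ PrimeSpectrum.comap (algebraMap A B) q ∈ W) →
      Ideal.map (algebraMap A B) (vanishingOn A A W) = vanishingOn B B W' := by
    intro W W' hW
    obtain ⟨n, f, hf⟩ := exists_finite_cover_of_isNoetherianRing W
    exact (vanishingOn_baseChange (IsBaseChange.linearMap A B) hf hW).symm
  obtain ⟨t, y, hy⟩ := Module.Finite.exists_fin (R := A) (M := M)
  rw [flatteningIdeal_eq V Δ y hy,
    flatteningIdeal_eq V' Δ (h ∘ y) (span_range_eq_top_of_isBaseChange hh y hy), Ideal.map_mul]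
  congr 1
  · obtain ⟨h', hh'⟩ := exists_isBaseChange_ideal_map (B := B)
      (⨅ δ ∈ Δ, vanishingOn A A (V δ) : Ideal A)
    rw [fittingIdeal_map hh']
    have : (⨅ δ ∈ Δ, vanishingOn A A (V δ) : Ideal A).map (algebraMap A B) =
        (⨅ δ ∈ Δ, vanishingOn B B (V' δ) : Ideal B) := by
      rw [iInf_vanishingOn, iInf_vanishingOn]
      apply hvan
      intro q
      simp only [TopologicalSpace.Opens.mem_iSup, hV]
    rw [this]
  · refine (map_prod (Ideal.mapHom (algebraMap A B)) _ _).trans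
      (Finset.prod_congr rfl fun δ _ => ?_)
    change Ideal.map _ _ = _
    rw [Ideal.map_sup, fittingIdeal_map hh, hvan _ _ (hV δ)]

lemma not_le_of_map_eq_top {p : PrimeSpectrum A} {I : Ideal A}
    (h : I.map (algebraMap A (Localization.AtPrime p.asIdeal)) = ⊤) :
    ¬ I ≤ p.asIdeal := fun hI => by
  have := Ideal.map_mono (f := algebraMap A (Localization.AtPrime p.asIdeal)) hI
  rw [h, Localization.AtPrime.map_eq_maximalIdeal] at this
  exact Ideal.IsPrime.ne_top' (top_le_iff.1 this)

/-- The zero locus of the flattening ideal is the locus where `M` is not free with rank in `Δ`. -/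
lemma flatteningIdeal_le_iff [IsNoetherianRing A] [Module.Finite A M]
    {V : ℕ → TopologicalSpace.Opens (PrimeSpectrum A)} (Δ : Set ℕ)
    (hV : ∀ δ p, p ∈ V δ ↔ FreeAt A M p δ) (p : PrimeSpectrum A) :
    flatteningIdeal A M V Δ ≤ p.asIdeal ↔ ¬ ∃ δ ∈ Δ, FreeAt A M p δ := by
  classical
  rw [← not_iff_not, not_not]
  constructor
  · intro h
    obtain ⟨g, hg, hgp⟩ := SetLike.not_le_iff_exists.1 h
    -- where the ideal is trivial, it is generated by `1`, and there is no `1`-torsion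
    let B := Localization.Away g
    have hI : (flatteningIdeal A M V Δ).map (algebraMap A B) = Ideal.span {1} := by
      rw [Ideal.span_singleton_one]
      exact Ideal.eq_top_of_isUnit_mem _ (Ideal.mem_map_of_mem _ hg)
        (IsLocalization.Away.algebraMap_isUnit g)
    have hbc := TensorProduct.isBaseChange A M B
    have hlf := locallyFreeWithRanks_quotient hbc (fun δ p hp => (hV δ p).1 hp)
      (one_mem (nonZeroDivisors B)) hI (U := ⊤)
      (fun q => ⟨fun _ h1 => q.2.ne_top ((Ideal.eq_top_iff_one _).2 h1), fun _ => trivial⟩)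
    obtain ⟨q, rfl⟩ : p ∈ Set.range (PrimeSpectrum.comap (algebraMap A B)) := by
      rw [PrimeSpectrum.localization_away_comap_range _ g]
      exact hgp
    obtain ⟨δ, hδ, hq⟩ := hlf.exists_freeAt q
    have hbot : vanishingOn B (B ⊗[A] M) ⊤ = ⊥ := by
      rw [eq_bot_iff]
      intro m hm
      obtain ⟨n, hn⟩ := (mem_vanishingOn_iff_pow (f := fun _ : Unit => (1 : B)) (fun q =>
        ⟨fun _ => ⟨(), fun h1 => q.2.ne_top ((Ideal.eq_top_iff_one _).2 h1)⟩,
          fun _ => TopologicalSpace.Opens.mem_top q⟩)).1 hm ()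
      simpa using hn
    exact ⟨δ, hδ, FreeAt.of_flat hbc (hq.congr (Submodule.quotEquivOfEqBot _ hbot))⟩
  · rintro ⟨δ₀, hδ₀, hp⟩
    obtain ⟨t, y, hy⟩ := Module.Finite.exists_fin (R := A) (M := M)
    rw [flatteningIdeal_eq V Δ y hy, p.2.mul_le, p.2.prod_le, not_or]
    constructor
    · apply not_le_of_map_eq_top
      set J₀ : Ideal A := ⨅ δ ∈ Δ, vanishingOn A A (V δ) with hJ₀
      rw [fittingIdeal_map (TensorProduct.isBaseChange A J₀ (Localization.AtPrime p.asIdeal))]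
      have : Subsingleton (Localization.AtPrime p.asIdeal ⊗[A] J₀) := by
        refine subsingleton_of_forall_eq 0 fun z => ?_
        induction z with
        | zero => rfl
        | add x y hx hy => rw [hx, hy, add_zero]
        | tmul b j =>
          have hj := j.2
          simp only [hJ₀, Submodule.mem_iInf] at hj
          obtain ⟨s, hs, hsj⟩ := mem_vanishingOn.1 (hj δ₀ hδ₀) p ((hV _ _).2 hp)
          have hu : IsUnit (algebraMap A (Localization.AtPrime p.asIdeal) s) :=
            IsLocalization.map_units _ (⟨s, hs⟩ : p.asIdeal.primeCompl)
          obtain ⟨v, hv⟩ := hu.exists_right_inv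
          have hb : b = s • (v * b) := by
            rw [Algebra.smul_def, ← mul_assoc, hv, one_mul]
          have hsj' : s • j = 0 := Subtype.ext hsj
          rw [hb, TensorProduct.smul_tmul, hsj', TensorProduct.tmul_zero]
      exact fittingIdeal_eq_top Fin.elim0 (Subsingleton.elim _ _)
    · rintro ⟨δ, hδ, hle⟩
      by_cases h : δ = δ₀
      · subst h
        obtain ⟨b⟩ := hp.basis
        refine not_le_of_map_eq_top ?_ (le_sup_left.trans hle)
        rw [fittingIdeal_map (TensorProduct.isBaseChange A M (Localization.AtPrime p.asIdeal))]
        exact fittingIdeal_eq_top b b.span_eq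
      · -- near `p` the rank is `δ₀`, so a neighbourhood of `p` is disjoint from `V δ`
        have := Module.finitePresentation_of_finite A M
        obtain ⟨g, hg, hg'⟩ := hp.exists_open
        obtain ⟨n, f, hf⟩ := exists_finite_cover_of_isNoetherianRing (V δ)
        have hnil : ∀ i, ∃ k : ℕ, (f i * g) ^ k = 0 := by
          intro i
          change IsNilpotent (f i * g)
          rw [← mem_nilradical, nilradical_eq_sInf, Ideal.mem_sInf]
          intro p' hp'
          by_contra hcon
          have h1 : f i ∉ p' := fun h => hcon (Ideal.mul_mem_right _ _ h)
          have h2 : g ∉ p' := fun h => hcon (Ideal.mul_mem_left _ _ h)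
          have h3 := (hV δ ⟨p', hp'⟩).1 ((hf ⟨p', hp'⟩).2 ⟨i, h1⟩)
          exact h (h3.2.symm.trans (hg' ⟨p', hp'⟩ h2).2)
        choose k hk using hnil
        have hgJ : g ^ (∑ i, k i) ∈ vanishingOn A A (V δ) := by
          rw [mem_vanishingOn_iff_pow hf]
          intro i
          refine ⟨k i, ?_⟩
          obtain ⟨l, hl⟩ := Nat.exists_eq_add_of_le
            (Finset.single_le_sum (f := k) (fun _ _ => Nat.zero_le _) (Finset.mem_univ i))
          rw [hl, pow_add, smul_eq_mul, ← mul_assoc, ← mul_pow, hk, zero_mul]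
        exact hg (p.2.mem_of_pow_mem _ (hle (Ideal.mem_sup_right hgJ)))

/-- Faithfully flat descent of ideals. -/
lemma map_comap_eq_of_faithfullyFlat [Module.FaithfullyFlat A B] (I : Ideal B)
    (hI : ∀ b ∈ I, (b ⊗ₜ 1 : B ⊗[A] B) ∈
      I.map (Algebra.TensorProduct.includeRight : B →ₐ[A] B ⊗[A] B)) :
    (I.comap (algebraMap A B)).map (algebraMap A B) = I := by
  refine le_antisymm Ideal.map_comap_le fun b hb => ?_
  set J := I.comap (algebraMap A B) with hJ
  let φ : (A ⧸ J) →ₗ[A] (B ⧸ I) := J.liftQ ((I.mkQ.restrictScalars A) ∘ₗ Algebra.linearMap A B)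
    (fun a ha => (Submodule.Quotient.mk_eq_zero I).2 ha)
  have hφ : Function.Injective φ := by
    rw [← LinearMap.ker_eq_bot]
    refine Submodule.ker_liftQ_eq_bot _ _ _ fun a ha => ?_
    exact (Submodule.Quotient.mk_eq_zero I).1 ha
  have hφ' := Module.Flat.lTensor_preserves_injective_linearMap (M := B) φ hφ
  have h1 : (b ⊗ₜ[A] (J.mkQ 1) : B ⊗[A] (A ⧸ J)) = 0 := by
    apply hφ'
    rw [map_zero, LinearMap.lTensor_tmul]
    have h2 : φ (J.mkQ 1) = I.mkQ 1 := congrArg I.mkQ (map_one (algebraMap A B))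
    rw [h2]
    have h3 : ∀ z ∈ I.map (Algebra.TensorProduct.includeRight : B →ₐ[A] B ⊗[A] B),
        LinearMap.lTensor B (I.mkQ.restrictScalars A) z = 0 := by
      intro z hz
      induction hz using Submodule.span_induction with
      | mem z hz =>
        obtain ⟨i, hi, rfl⟩ := hz
        change (1 : B) ⊗ₜ[A] (I.mkQ i) = 0
        rw [show I.mkQ i = 0 from (Submodule.Quotient.mk_eq_zero I).2 hi, TensorProduct.tmul_zero]
      | zero => simp
      | add x y _ _ hx hy => rw [map_add, hx, hy, add_zero]
      | smul r x _ hx =>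
        let e := (Algebra.TensorProduct.map (AlgHom.id A B) (Ideal.Quotient.mkₐ A I))
        have he : ∀ z, LinearMap.lTensor B (I.mkQ.restrictScalars A) z = e z := fun z => rfl
        rw [he] at hx ⊢
        rw [smul_eq_mul, map_mul, hx, mul_zero]
    exact h3 _ (hI b hb)
  -- `B/I ⊇ A/J` stays injective over `B`, and `b` maps to zero in `B ⊗ B/I`, hence in `B/JB`
  let ψ : B ⊗[A] (A ⧸ J) →ₗ[A] B ⧸ J.map (algebraMap A B) := TensorProduct.lift
    ((LinearMap.flip (J.liftQ (LinearMap.flip (((LinearMap.mul A B).compr₂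
      ((J.map (algebraMap A B)).mkQ.restrictScalars A)).compl₂ (Algebra.linearMap A B))) (by
        intro a ha
        ext b
        exact (Submodule.Quotient.mk_eq_zero _).2
          (Ideal.mul_mem_left _ _ (Ideal.mem_map_of_mem _ ha))))))
  have h2 : ψ (b ⊗ₜ[A] (J.mkQ 1)) = (J.map (algebraMap A B)).mkQ b := by
    change (J.map (algebraMap A B)).mkQ (b * algebraMap A B 1) = _
    rw [map_one, mul_one]
  rw [h1, map_zero] at h2
  exact (Submodule.Quotient.mk_eq_zero _).1 h2.symm

end CenterProperties

/-! ### Categories fibered in groupoids -/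

section Fibered

variable {S : CatOverSch.{u}}

namespace IsFiberedInGroupoids

lemma exists_lift_iso (hS : IsFiberedInGroupoids S) (x : S.obj) {T : Scheme.{u}}
    (f : T ⟶ S.p.obj x) :
    ∃ (y : S.obj) (φ : y ⟶ x) (e : T ≅ S.p.obj y), e.hom ≫ S.p.map φ = f := by
  obtain ⟨y, φ, h⟩ := hS.exists_lift x T f
  obtain rfl := IsHomLift.domain_eq S.p f φ
  exact ⟨y, φ, Iso.refl _, by simp [← IsHomLift.eq_of_isHomLift S.p f φ]⟩

lemma exists_factor (hS : IsFiberedInGroupoids S) {x y z : S.obj} (φ : x ⟶ z) (ψ : y ⟶ z)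
    (g : S.p.obj y ⟶ S.p.obj x) (h : g ≫ S.p.map φ = S.p.map ψ) :
    ∃ χ : y ⟶ x, S.p.map χ = g ∧ χ ≫ φ = ψ := by
  have := hS.cartesian φ
  refine ⟨Functor.IsStronglyCartesian.map S.p (S.p.map φ) φ h.symm ψ, ?_,
    Functor.IsStronglyCartesian.fac S.p (S.p.map φ) φ h.symm ψ⟩
  exact (IsHomLift.eq_of_isHomLift S.p g _).symm

lemma hom_ext (hS : IsFiberedInGroupoids S) {x y z : S.obj} (φ : x ⟶ z) {χ χ' : y ⟶ x}
    (h : S.p.map χ = S.p.map χ') (h' : χ ≫ φ = χ' ≫ φ) : χ = χ' := by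
  have := hS.cartesian φ
  have : S.p.IsHomLift (S.p.map χ) χ' := h ▸ inferInstance
  exact Functor.IsStronglyCartesian.ext S.p (S.p.map φ) φ (S.p.map χ) h'

/-- The base change of an arrow along a morphism from a scheme. -/
lemma exists_pullback (hS : IsFiberedInGroupoids S) {x y z : S.obj} (φ : x ⟶ z) (ψ : y ⟶ z) :
    ∃ (t : S.obj) (l : t ⟶ x) (r : t ⟶ y), l ≫ φ = r ≫ ψ ∧
      IsPullback (S.p.map l) (S.p.map r) (S.p.map φ) (S.p.map ψ) := by
  obtain ⟨t, l, e, he⟩ := hS.exists_lift_iso x (pullback.fst (S.p.map φ) (S.p.map ψ))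
  obtain ⟨r, hr, hr'⟩ := hS.exists_factor ψ (l ≫ φ)
    (e.inv ≫ pullback.snd (S.p.map φ) (S.p.map ψ)) (by
      rw [Category.assoc, ← pullback.condition, ← he]; simp)
  refine ⟨t, l, r, hr'.symm, ?_⟩
  refine (IsPullback.of_hasPullback (S.p.map φ) (S.p.map ψ)).of_iso e (Iso.refl _) (Iso.refl _)
    (Iso.refl _) (by simp [he]) (by simp [hr]) (by simp) (by simp)

end IsFiberedInGroupoids

end Fibered

/-! ### Atlases of fiber products -/

section Spans

variable {S : CatOverSch.{u}}

/-- The span `x ← w → y` is an étale atlas of the fiber product of `x` and `y`. -/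
def IsSpanAtlas {x y w : S.obj} (a : w ⟶ x) (b : w ⟶ y) : Prop :=
  ∀ (z : S.obj) (c : z ⟶ x) (d : z ⟶ y), ∃ (t : S.obj) (l : t ⟶ w) (r : t ⟶ z),
    l ≫ a = r ≫ c ∧ l ≫ b = r ≫ d ∧ Etale (S.p.map r) ∧ Surjective (S.p.map r) ∧
      ∀ (s : S.obj) (l' : s ⟶ w) (r' : s ⟶ z), l' ≫ a = r' ≫ c → l' ≫ b = r' ≫ d →
        ∃! m : s ⟶ t, m ≫ l = l' ∧ m ≫ r = r'

/-- The definition of `HasProp` without limits in the category of spans. -/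
lemma HasProp.exists_isSpanAtlas {P : MorphismProperty Scheme.{u}} {x : S.obj}
    (hx : HasProp P S x) (y : S.obj) :
    ∃ (w : S.obj) (a : w ⟶ x) (b : w ⟶ y), IsSpanAtlas a b ∧ P (S.p.map b) := by
  obtain ⟨w, hw, hP⟩ := hx y
  change BinaryFan x y at w
  refine ⟨w.pt, w.fst, w.snd, fun z c d => ?_, hP⟩
  obtain ⟨t, ⟨ht⟩, h1, h2⟩ := hw (BinaryFan.mk c d : BinaryFan x y)
  let l : (show BinaryFan x y from t.pt) ⟶ w := t.fst
  let r : (show BinaryFan x y from t.pt) ⟶ BinaryFan.mk c d := t.snd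
  refine ⟨(show BinaryFan x y from t.pt).pt, l.hom, r.hom, ?_, ?_, h1, h2, fun s l' r' hl hr => ?_⟩
  · exact (l.w ⟨WalkingPair.left⟩).trans (r.w ⟨WalkingPair.left⟩).symm
  · exact (l.w ⟨WalkingPair.right⟩).trans (r.w ⟨WalkingPair.right⟩).symm
  · let s' : BinaryFan x y := BinaryFan.mk (l' ≫ w.fst) (l' ≫ w.snd)
    let L : s' ⟶ w := { hom := l', w := by rintro ⟨_ | _⟩ <;> rfl }
    let R : s' ⟶ BinaryFan.mk c d :=
      { hom := r', w := by rintro ⟨_ | _⟩ <;> [exact hl.symm; exact hr.symm] }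
    let m : s' ⟶ (show BinaryFan x y from t.pt) := ht.lift (BinaryFan.mk (P := s') L R)
    have hm1 : m ≫ l = L := ht.fac (BinaryFan.mk (P := s') L R) ⟨WalkingPair.left⟩
    have hm2 : m ≫ r = R := ht.fac (BinaryFan.mk (P := s') L R) ⟨WalkingPair.right⟩
    refine ⟨m.hom, ⟨congrArg ConeMorphism.hom hm1, congrArg ConeMorphism.hom hm2⟩, ?_⟩
    rintro n ⟨hn1, hn2⟩
    let n' : s' ⟶ (show BinaryFan x y from t.pt) :=
      { hom := n, w := by
          rintro ⟨_ | _⟩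
          · change n ≫ (show BinaryFan x y from t.pt).fst = l' ≫ w.fst
            rw [← hn1, Category.assoc]
            exact congrArg (n ≫ ·) (l.w ⟨WalkingPair.left⟩).symm
          · change n ≫ (show BinaryFan x y from t.pt).snd = l' ≫ w.snd
            rw [← hn1, Category.assoc]
            exact congrArg (n ≫ ·) (l.w ⟨WalkingPair.right⟩).symm }
    have : n' = m := BinaryFan.IsLimit.hom_ext ht
      ((ConeMorphism.ext _ _ hn1 : n' ≫ l = L).trans hm1.symm)
      ((ConeMorphism.ext _ _ hn2 : n' ≫ r = R).trans hm2.symm)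
    exact congrArg ConeMorphism.hom this

lemma IsSpanAtlas.symm {x y w : S.obj} {a : w ⟶ x} {b : w ⟶ y} (h : IsSpanAtlas a b) :
    IsSpanAtlas b a := fun z c d => by
  obtain ⟨t, l, r, h1, h2, h3, h4, h5⟩ := h z d c
  exact ⟨t, l, r, h2, h1, h3, h4, fun s l' r' hl hr => h5 s l' r' hr hl⟩

/-- The product of two atlases of a fiber product is an atlas; if `x` has `P` and `y` has `Q` then
it can be used to compare `x` with `y`. -/
lemma exists_isSpanAtlas_of_hasProp {P Q : MorphismProperty Scheme.{u}}
    (hP : ∀ {X Y Z : Scheme.{u}} (f : X ⟶ Y) (g : Y ⟶ Z), Etale f → Surjective f → P g →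
      P (f ≫ g))
    (hQ : ∀ {X Y Z : Scheme.{u}} (f : X ⟶ Y) (g : Y ⟶ Z), Etale f → Surjective f → Q g →
      Q (f ≫ g)) {x y : S.obj} (hx : HasProp P S x) (hy : HasProp Q S y) :
    ∃ (w : S.obj) (a : w ⟶ x) (b : w ⟶ y), IsSpanAtlas a b ∧ Q (S.p.map a) ∧ P (S.p.map b) := by
  obtain ⟨w, a, b, hw, hb⟩ := hx.exists_isSpanAtlas y
  obtain ⟨w', b', a', hw', ha'⟩ := hy.exists_isSpanAtlas x
  replace hw' := hw'.symm
  obtain ⟨t, l, r, h1, h2, h3, h4, h5⟩ := hw w' a' b'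
  obtain ⟨t', l', r', h1', h2', h3', h4', h5'⟩ := hw' w a b
  refine ⟨t, l ≫ a, l ≫ b, fun z c d => ?_, ?_, ?_⟩
  · obtain ⟨z₁, l₁, r₁, e1, e2, e3, e4, e5⟩ := hw z c d
    obtain ⟨z₂, l₂, r₂, f1, f2, f3, f4, f5⟩ := hw' z₁ (l₁ ≫ a) (l₁ ≫ b)
    obtain ⟨m, ⟨hm1, hm2⟩, hm3⟩ := h5 z₂ (r₂ ≫ l₁) l₂ (by simp [f1]) (by simp [f2])
    refine ⟨z₂, m, r₂ ≫ r₁, ?_, ?_, ?_, ?_, ?_⟩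
    · rw [reassoc_of% hm1, e1, Category.assoc]
    · rw [reassoc_of% hm1, e2, Category.assoc]
    · rw [Functor.map_comp]; infer_instance
    · rw [Functor.map_comp]; infer_instance
    · intro s i j hi hj
      obtain ⟨n₁, ⟨hn1, hn2⟩, hn3⟩ := e5 s (i ≫ l) j (by simpa using hi) (by simpa using hj)
      obtain ⟨n₂, ⟨hn4, hn5⟩, hn6⟩ := f5 s (i ≫ r) n₁
        (by rw [Category.assoc, ← h1, reassoc_of% hn1])
        (by rw [Category.assoc, ← h2, reassoc_of% hn1])
      refine ⟨n₂, ⟨?_, by simp [reassoc_of% hn5, hn2]⟩, ?_⟩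
      · have := h5 s (i ≫ l) (i ≫ r) (by simp [h1]) (by simp [h2])
        refine this.unique ⟨?_, ?_⟩ ⟨rfl, rfl⟩
        · rw [Category.assoc, hm1, reassoc_of% hn5, hn1]
        · rw [Category.assoc, hm2, hn4]
      · rintro n ⟨hn, hn'⟩
        refine hn6 n ⟨?_, hn3 _ ⟨?_, by simpa using hn'⟩⟩
        · rw [← hm2, reassoc_of% hn]
        · rw [Category.assoc, ← hm1, reassoc_of% hn]
  · rw [h1, Functor.map_comp]
    exact hQ _ _ h3 h4 ha'
  · -- both products of `w` and `w'` agree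
    obtain ⟨m, ⟨hm1, hm2⟩, -⟩ := h5' t r l h1.symm h2.symm
    obtain ⟨n, ⟨hn1, hn2⟩, -⟩ := h5 t' r' l' h1'.symm h2'.symm
    have hmn : m ≫ n = 𝟙 _ := (h5 t l r h1 h2).unique
      ⟨by rw [Category.assoc, hn1, hm2], by rw [Category.assoc, hn2, hm1]⟩
      ⟨Category.id_comp _, Category.id_comp _⟩
    have hnm : n ≫ m = 𝟙 _ := (h5' t' l' r' h1' h2').unique
      ⟨by rw [Category.assoc, hm1, hn2], by rw [Category.assoc, hm2, hn1]⟩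
      ⟨Category.id_comp _, Category.id_comp _⟩
    have : IsIso m := ⟨n, hmn, hnm⟩
    have hl : S.p.map l = S.p.map m ≫ S.p.map r' := by rw [← Functor.map_comp, hm2]
    rw [Functor.map_comp]
    refine hP _ _ ?_ ?_ hb
    · rw [hl]; infer_instance
    · rw [hl]; infer_instance

lemma HasProp.mono {P Q : MorphismProperty Scheme.{u}} (h : P ≤ Q) {x : S.obj}
    (hx : HasProp P S x) : HasProp Q S x := fun y => by
  obtain ⟨w, hw, hw'⟩ := hx y
  exact ⟨w, hw, h _ hw'⟩

lemma IsSmoothOver.isFlatOver {x : S.obj} (hx : IsSmoothOver S x) : IsFlatOver S x :=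
  HasProp.mono (fun _ _ f h => by have : Smooth f := h; change Flat f; infer_instance) hx

lemma IsSmoothAtlas.isSmoothOver {x : S.obj} (hx : IsSmoothAtlas S x) : IsSmoothOver S x :=
  HasProp.mono (fun _ _ _ h => h.1) hx

lemma exists_flat_isSpanAtlas {x y : S.obj} (hx : IsFlatOver S x) (hy : IsFlatOver S y) :
    ∃ (w : S.obj) (a : w ⟶ x) (b : w ⟶ y), IsSpanAtlas a b ∧ Flat (S.p.map a) ∧
      Flat (S.p.map b) :=
  exists_isSpanAtlas_of_hasProp (P := @Flat) (Q := @Flat)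
    (fun _ _ _ _ _ => inferInstance) (fun _ _ _ _ _ => inferInstance) hx hy

end Spans

/-! ### Affine charts -/

section Charts

variable {S : CatOverSch.{u}}

/-- The morphism of charts given by a morphism of the underlying objects. -/
def AffineChart.mkHom {c d : AffineChart S} (f : c.obj ⟶ d.obj) : c ⟶ d :=
  show AffineChart.Hom c d from
  { hom := f
    ringHom := Spec.preimage (c.iso.hom ≫ S.p.map f ≫ d.iso.inv)
    comm := by simp }

@[simp] lemma AffineChart.homOf_mkHom {c d : AffineChart S} (f : c.obj ⟶ d.obj) :
    AffineChart.homOf (AffineChart.mkHom f) = f := rfl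

lemma AffineChart.homOf_comp {c d e : AffineChart S} (f : c ⟶ d) (g : d ⟶ e) :
    AffineChart.homOf (f ≫ g) = AffineChart.homOf f ≫ AffineChart.homOf g := rfl

lemma AffineChart.ringMap_comp {c d e : AffineChart S} (f : c ⟶ d) (g : d ⟶ e) :
    AffineChart.ringMap (f ≫ g) = (AffineChart.ringMap f).comp (AffineChart.ringMap g) := rfl

lemma AffineChart.hom_comm {c d : AffineChart S} (f : c ⟶ d) :
    Spec.map (CommRingCat.ofHom (AffineChart.ringMap f)) ≫ d.iso.hom =
      c.iso.hom ≫ S.p.map (AffineChart.homOf f) :=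
  AffineChart.Hom.comm (c := c) (d := d) f

lemma AffineChart.hom_ext {c d : AffineChart S} {f g : c ⟶ d}
    (h : AffineChart.homOf f = AffineChart.homOf g) : f = g := by
  apply AffineChart.Hom.ext
  · exact h
  · apply Spec.map_injective
    rw [← cancel_mono d.iso.hom]
    exact (AffineChart.hom_comm f).trans ((by rw [h]) : _ = _) |>.trans
      (AffineChart.hom_comm g).symm

/-- A ring homomorphism out of the ring of a chart gives a new chart. -/
lemma AffineChart.exists_of_ringHom (hS : IsFiberedInGroupoids S) (c : AffineChart S)
    {B : CommRingCat.{u}} (φ : c.ring ⟶ B) :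
    ∃ (x : S.obj) (i : Spec B ≅ S.p.obj x) (f : AffineChart.mk x B i ⟶ c),
      AffineChart.ringMap f = φ.hom := by
  obtain ⟨x, f, i, hi⟩ := hS.exists_lift_iso c.obj (Spec.map φ ≫ c.iso.hom)
  refine ⟨x, i, (show AffineChart.Hom _ _ from ⟨f, φ, hi.symm⟩), rfl⟩

/-- Morphisms of charts over a fixed chart correspond to ring homomorphisms. -/
lemma AffineChart.exists_factor (hS : IsFiberedInGroupoids S) {c d e : AffineChart S} (f : c ⟶ d)
    (g : e ⟶ d) (φ : c.ring →+* e.ring)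
    (h : φ.comp (AffineChart.ringMap f) = AffineChart.ringMap g) :
    ∃ k : e ⟶ c, k ≫ f = g ∧ AffineChart.ringMap k = φ := by
  have hh : (e.iso.inv ≫ Spec.map (CommRingCat.ofHom φ) ≫ c.iso.hom) ≫
      S.p.map (AffineChart.homOf f) = S.p.map (AffineChart.homOf g) := by
    have h1 := AffineChart.hom_comm f
    have h2 := AffineChart.hom_comm g
    rw [← h, CommRingCat.ofHom_comp, Spec.map_comp, Category.assoc, h1] at h2
    simp [h2]
  obtain ⟨k, hk, hk'⟩ := hS.exists_factor (AffineChart.homOf f) (AffineChart.homOf g) _ hh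
  let k' : e ⟶ c := show AffineChart.Hom _ _ from ⟨k, CommRingCat.ofHom φ, by simp [hk]⟩
  exact ⟨k', AffineChart.hom_ext hk', rfl⟩

/-- The fiber product of two charts over a third. -/
lemma AffineChart.exists_pullback (hS : IsFiberedInGroupoids S) {c d e : AffineChart S} (f : c ⟶ e)
    (g : d ⟶ e) :
    letI := (AffineChart.ringMap f).toAlgebra
    letI := (AffineChart.ringMap g).toAlgebra
    ∃ (x : S.obj) (i : Spec (CommRingCat.of (TensorProduct e.ring c.ring d.ring)) ≅ S.p.obj x)
      (l : AffineChart.mk x _ i ⟶ c) (r : AffineChart.mk x _ i ⟶ d), l ≫ f = r ≫ g ∧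
      AffineChart.ringMap l =
        (Algebra.TensorProduct.includeLeftRingHom : c.ring →+* TensorProduct e.ring c.ring d.ring) ∧
      AffineChart.ringMap r = (Algebra.TensorProduct.includeRight :
        d.ring →ₐ[e.ring] TensorProduct e.ring c.ring d.ring).toRingHom := by
  let := (AffineChart.ringMap f).toAlgebra
  let := (AffineChart.ringMap g).toAlgebra
  obtain ⟨x, i, l, hl⟩ := c.exists_of_ringHom hS
    (CommRingCat.ofHom (Algebra.TensorProduct.includeLeftRingHom :
      c.ring →+* TensorProduct e.ring c.ring d.ring))
  obtain ⟨r, hr, hr'⟩ := AffineChart.exists_factor hS g (l ≫ f)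
    (Algebra.TensorProduct.includeRight :
        d.ring →ₐ[e.ring] TensorProduct e.ring c.ring d.ring).toRingHom (by
      rw [AffineChart.ringMap_comp, hl]
      ext a
      exact (Algebra.TensorProduct.includeRight :
        d.ring →ₐ[e.ring] TensorProduct e.ring c.ring d.ring).commutes a)
  exact ⟨x, i, l, r, hr.symm, hl, hr'⟩

end Charts

/-! ### Flat comparison of charts -/

instance : MorphismProperty.RespectsIso (@Flat : MorphismProperty Scheme.{u}) :=
  MorphismProperty.IsStableUnderBaseChange.respectsIso

instance : IsZariskiLocalAtSource (@Etale : MorphismProperty Scheme.{u}) :=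
  HasRingHomProperty.instIsZariskiLocalAtSource

/-- A smooth surjective morphism to an affine scheme can be refined by an affine scheme. -/
lemma exists_affine_refinement {X Y : Scheme.{u}} [CompactSpace Y] (f : X ⟶ Y) [Smooth f]
    [Surjective f] : ∃ (B : CommRingCat.{u}) (g : Spec B ⟶ X), Etale g ∧ Surjective (g ≫ f) := by
  let 𝒰 := X.affineCover
  have ho : ∀ i, IsOpen (Set.range (𝒰.f i ≫ f)) := fun i => (𝒰.f i ≫ f).isOpenMap.isOpen_range
  obtain ⟨t, ht⟩ := isCompact_univ.elim_finite_subcover _ ho (fun y _ => by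
    obtain ⟨x, rfl⟩ := f.surjective y
    obtain ⟨z, hz⟩ := 𝒰.covers x
    exact Set.mem_iUnion.2 ⟨𝒰.idx x, z, by rw [Scheme.Hom.comp_apply, hz]⟩)
  let R : t → CommRingCat.{u} := fun i => X.affineOpenCover.X i.1
  let g' : (∐ fun i => Spec (R i)) ⟶ X := Sigma.desc fun i => 𝒰.f i.1
  have hg' : Etale g' := IsZariskiLocalAtSource.sigmaDesc (P := @Etale) fun i =>
    (inferInstance : Etale (𝒰.f i.1))
  refine ⟨_, inv (sigmaSpec R) ≫ g', inferInstance, ⟨fun y => ?_⟩⟩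
  obtain ⟨i, hi, z, rfl⟩ := Set.mem_iUnion₂.1 (ht (Set.mem_univ y))
  have h : (Sigma.ι (fun i => Spec (R i)) ⟨i, hi⟩ ≫ sigmaSpec R) ≫
      (inv (sigmaSpec R) ≫ g') ≫ f = 𝒰.f i ≫ f := by
    simp only [Category.assoc, IsIso.hom_inv_id_assoc]
    exact Sigma.ι_desc_assoc _ _ _
  exact ⟨_, congrArg (fun φ => φ z) h⟩

section Comparison

variable {S : CatOverSch.{u}}

lemma AffineChart.flat_iff {c d : AffineChart S} (f : c ⟶ d) :
    (AffineChart.ringMap f).Flat ↔ Flat (S.p.map (AffineChart.homOf f)) := by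
  rw [← MorphismProperty.cancel_left_of_respectsIso @Flat c.iso.hom, ← AffineChart.hom_comm,
    MorphismProperty.cancel_right_of_respectsIso @Flat, Flat.SpecMap_iff]
  rfl

lemma AffineChart.faithfullyFlat_iff {c d : AffineChart S} (f : c ⟶ d) :
    (AffineChart.ringMap f).FaithfullyFlat ↔ Flat (S.p.map (AffineChart.homOf f)) ∧
      Surjective (S.p.map (AffineChart.homOf f)) := by
  rw [← AffineChart.flat_iff,
    ← MorphismProperty.cancel_left_of_respectsIso @Surjective c.iso.hom, ← AffineChart.hom_comm,
    MorphismProperty.cancel_right_of_respectsIso @Surjective,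
    RingHom.FaithfullyFlat.iff_flat_and_comap_surjective, surjective_iff]
  rfl

/-- The point of the scheme underlying a chart that corresponds to a prime ideal. -/
def AffineChart.pt (c : AffineChart S) (q : PrimeSpectrum c.ring) : S.p.obj c.obj :=
  c.iso.hom (show Spec c.ring from q)

lemma AffineChart.map_pt {c d : AffineChart S} (f : c ⟶ d) (q : PrimeSpectrum c.ring) :
    S.p.map (AffineChart.homOf f) (c.pt q) =
      d.pt (PrimeSpectrum.comap (AffineChart.ringMap f) q) :=
  (congrArg (fun φ : Spec c.ring ⟶ _ => φ (show Spec c.ring from q))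
    (AffineChart.hom_comm f)).symm

lemma AffineChart.pt_bijective (c : AffineChart S) : Function.Bijective c.pt :=
  c.iso.hom.homeomorph.bijective

lemma exists_chart_of_mem (hS : IsFiberedInGroupoids S) (z : S.obj) (s : S.p.obj z) :
    ∃ (c : AffineChart S) (m : c.obj ⟶ z) (q : PrimeSpectrum c.ring),
      IsOpenImmersion (S.p.map m) ∧ S.p.map m (c.pt q) = s := by
  let 𝒰 := (S.p.obj z).affineCover
  obtain ⟨q, hq⟩ := 𝒰.covers s
  obtain ⟨y, m, i, hi⟩ := hS.exists_lift_iso z (𝒰.f (𝒰.idx s))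
  refine ⟨⟨y, _, i⟩, m, q, ?_, ?_⟩
  · have : S.p.map m = i.inv ≫ 𝒰.f (𝒰.idx s) := by rw [← hi]; simp
    rw [this]; infer_instance
  · exact (congrArg (fun φ => φ q) hi).trans hq

/-- A chart mapping to two objects that are flat over `S` maps locally to a chart that is flat over
both of them. -/
lemma exists_flat_comparison (hS : IsFiberedInGroupoids S) {c d e : AffineChart S}
    (hc : IsFlatOver S c.obj) (hd : IsFlatOver S d.obj) (f : e ⟶ c) (k : e ⟶ d)
    (q : PrimeSpectrum e.ring) :
    ∃ (e' τ : AffineChart S) (h : e' ⟶ e) (j : e' ⟶ τ) (a : τ ⟶ c) (b : τ ⟶ d)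
      (q' : PrimeSpectrum e'.ring), (AffineChart.ringMap h).Flat ∧ (AffineChart.ringMap a).Flat ∧
      (AffineChart.ringMap b).Flat ∧ h ≫ f = j ≫ a ∧ h ≫ k = j ≫ b ∧
        PrimeSpectrum.comap (AffineChart.ringMap h) q' = q := by
  obtain ⟨w, a, b, hw, ha, hb⟩ := exists_flat_isSpanAtlas hc hd
  obtain ⟨t, l, r, h1, h2, h3, h4, -⟩ := hw e.obj (AffineChart.homOf f) (AffineChart.homOf k)
  obtain ⟨s, hs⟩ := (S.p.map r).surjective (e.pt q)
  obtain ⟨τ, m, qτ, hm, hqτ⟩ := exists_chart_of_mem hS w (S.p.map l s)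
  obtain ⟨t', l', r', e1, e2⟩ := hS.exists_pullback l m
  obtain ⟨s', hs', -⟩ := Scheme.Pullback.exists_preimage_pullback s (τ.pt qτ) hqτ.symm
  obtain ⟨e', n, q', hn, hq'⟩ := exists_chart_of_mem hS t' (e2.isoPullback.inv s')
  have hl' : IsOpenImmersion (S.p.map l') := MorphismProperty.of_isPullback e2.flip hm
  refine ⟨e', τ, AffineChart.mkHom (n ≫ l' ≫ r), AffineChart.mkHom (n ≫ r'),
    AffineChart.mkHom (m ≫ a), AffineChart.mkHom (m ≫ b), q', ?_, ?_, ?_, ?_, ?_, ?_⟩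
  · rw [AffineChart.flat_iff, AffineChart.homOf_mkHom, Functor.map_comp, Functor.map_comp]
    infer_instance
  · rw [AffineChart.flat_iff, AffineChart.homOf_mkHom, Functor.map_comp]
    infer_instance
  · rw [AffineChart.flat_iff, AffineChart.homOf_mkHom, Functor.map_comp]
    infer_instance
  · apply AffineChart.hom_ext
    simp only [AffineChart.homOf_comp, AffineChart.homOf_mkHom, Category.assoc, ← h1]
    rw [reassoc_of% e1]
  · apply AffineChart.hom_ext
    simp only [AffineChart.homOf_comp, AffineChart.homOf_mkHom, Category.assoc, ← h2]
    rw [reassoc_of% e1]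
  · apply e.pt_bijective.1
    rw [← AffineChart.map_pt, AffineChart.homOf_mkHom, Functor.map_comp, Functor.map_comp,
      Scheme.Hom.comp_apply, Scheme.Hom.comp_apply, hq', ← hs, ← hs']
    exact congrArg (S.p.map r) (congrArg (fun φ => φ s') e2.isoPullback_inv_fst)

/-- Every chart is covered by a chart that maps to a given atlas. -/
lemma exists_cover_of_isSmoothAtlas (hS : IsFiberedInGroupoids S) {d : AffineChart S}
    (hd : IsSmoothAtlas S d.obj) (c : AffineChart S) :
    ∃ (e : AffineChart S) (f : e ⟶ c) (_ : e ⟶ d), (AffineChart.ringMap f).FaithfullyFlat ∧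
      Smooth (S.p.map (AffineChart.homOf f)) := by
  obtain ⟨w, a, b, -, hb, hb'⟩ := hd.exists_isSpanAtlas c.obj
  have : CompactSpace (S.p.obj c.obj) := c.iso.hom.homeomorph.compactSpace
  obtain ⟨B, g, hg, hg'⟩ := exists_affine_refinement (S.p.map b)
  obtain ⟨y, m, i, hi⟩ := hS.exists_lift_iso w g
  have hm : S.p.map m = i.inv ≫ g := by rw [← hi]; simp
  have hm' : Smooth (S.p.map m) := by rw [hm]; infer_instance
  refine ⟨⟨y, B, i⟩, AffineChart.mkHom (m ≫ b), AffineChart.mkHom (m ≫ a), ?_, ?_⟩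
  · rw [AffineChart.faithfullyFlat_iff, AffineChart.homOf_mkHom]
    constructor
    · rw [Functor.map_comp]; infer_instance
    · rw [Functor.map_comp, hm, Category.assoc]; infer_instance
  · rw [AffineChart.homOf_mkHom, Functor.map_comp]; infer_instance

end Comparison

/-! ### The free locus -/

section FreeLocus

open TensorProduct

variable {S : CatOverSch.{u}}

lemma QCohModule.exists_isBaseChange (F : QCohModule S) {c d : AffineChart S} (f : c ⟶ d) :
    letI := (AffineChart.ringMap f).toAlgebra
    ∃ (_ : Module d.ring (F.obj c)) (_ : IsScalarTower d.ring c.ring (F.obj c))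
      (h : F.obj d →ₗ[d.ring] F.obj c), IsBaseChange c.ring h := by
  let := (AffineChart.ringMap f).toAlgebra
  let i : Module d.ring (F.obj c) := Module.compHom (F.obj c) (AffineChart.ringMap f)
  have i' : IsScalarTower d.ring c.ring (F.obj c) := ⟨fun a b n => by
    change (AffineChart.ringMap f a * b) • n = AffineChart.ringMap f a • (b • n)
    exact mul_smul _ _ _⟩
  exact ⟨i, i', { toFun := F.map f, map_add' := (F.map f).map_add, map_smul' := fun a m =>
    (F.map f).map_smulₛₗ a m }, F.isBaseChange f⟩

lemma freeAt_of_comap (F : QCohModule S) {c d : AffineChart S} (f : c ⟶ d)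
    {q : PrimeSpectrum c.ring} {δ : ℕ}
    (h : FreeAt d.ring (F.obj d) (PrimeSpectrum.comap (AffineChart.ringMap f) q) δ) :
    FreeAt c.ring (F.obj c) q δ := by
  let := (AffineChart.ringMap f).toAlgebra
  obtain ⟨_, _, _, hh⟩ := F.exists_isBaseChange f
  exact FreeAt.of_isBaseChange hh h

lemma freeAt_iff_of_flat {F : QCohModule S} (hF : F.IsCoherent) {c d : AffineChart S} (f : c ⟶ d)
    (hf : (AffineChart.ringMap f).Flat) {q : PrimeSpectrum c.ring} {δ : ℕ} :
    FreeAt d.ring (F.obj d) (PrimeSpectrum.comap (AffineChart.ringMap f) q) δ ↔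
      FreeAt c.ring (F.obj c) q δ := by
  refine ⟨freeAt_of_comap F f, fun h => ?_⟩
  let := (AffineChart.ringMap f).toAlgebra
  have : Module.Flat d.ring c.ring := hf
  have := hF d
  obtain ⟨_, _, _, hh⟩ := F.exists_isBaseChange f
  exact FreeAt.of_flat hh h

/-- Two morphisms to a flat chart detect the same free stalks. -/
lemma freeAt_comap_iff (hS : IsFiberedInGroupoids S) {F : QCohModule S} (hF : F.IsCoherent)
    {c d e : AffineChart S} (hc : IsFlatOver S c.obj) (hd : IsFlatOver S d.obj) (f : e ⟶ c)
    (k : e ⟶ d) (q : PrimeSpectrum e.ring) (δ : ℕ) :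
    FreeAt c.ring (F.obj c) (PrimeSpectrum.comap (AffineChart.ringMap f) q) δ ↔
      FreeAt d.ring (F.obj d) (PrimeSpectrum.comap (AffineChart.ringMap k) q) δ := by
  obtain ⟨e', τ, h, j, a, b, q', -, ha, hb, h1, h2, rfl⟩ := exists_flat_comparison hS hc hd f k q
  rw [← PrimeSpectrum.comap_comp_apply, ← PrimeSpectrum.comap_comp_apply,
    ← AffineChart.ringMap_comp, ← AffineChart.ringMap_comp, h1, h2, AffineChart.ringMap_comp,
    AffineChart.ringMap_comp, PrimeSpectrum.comap_comp_apply, PrimeSpectrum.comap_comp_apply,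
    freeAt_iff_of_flat hF a ha, freeAt_iff_of_flat hF b hb]

/-- A point of the fiber product of charts over given points. -/
lemma exists_pullback_chart (hS : IsFiberedInGroupoids S) {c d e : AffineChart S} (f : c ⟶ e)
    (g : d ⟶ e) {p : PrimeSpectrum c.ring} {q : PrimeSpectrum d.ring}
    (hpq : PrimeSpectrum.comap (AffineChart.ringMap f) p =
      PrimeSpectrum.comap (AffineChart.ringMap g) q) :
    ∃ (t : AffineChart S) (l : t ⟶ c) (r : t ⟶ d) (s : PrimeSpectrum t.ring), l ≫ f = r ≫ g ∧
      PrimeSpectrum.comap (AffineChart.ringMap l) s = p ∧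
        PrimeSpectrum.comap (AffineChart.ringMap r) s = q := by
  obtain ⟨t, l, r, h1, h2⟩ := hS.exists_pullback (AffineChart.homOf f) (AffineChart.homOf g)
  obtain ⟨s, hs, hs'⟩ := Scheme.Pullback.exists_preimage_pullback (c.pt p) (d.pt q)
    (f := S.p.map (AffineChart.homOf f)) (g := S.p.map (AffineChart.homOf g))
    (by rw [AffineChart.map_pt, AffineChart.map_pt, hpq])
  obtain ⟨t', m, s', -, hs''⟩ := exists_chart_of_mem hS t (h2.isoPullback.inv s)
  refine ⟨t', AffineChart.mkHom (m ≫ l), AffineChart.mkHom (m ≫ r), s', ?_, ?_, ?_⟩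
  · apply AffineChart.hom_ext
    simp [AffineChart.homOf_comp, h1]
  · apply c.pt_bijective.1
    rw [← AffineChart.map_pt, AffineChart.homOf_mkHom, Functor.map_comp, Scheme.Hom.comp_apply,
      hs'', ← hs]
    exact congrArg (fun φ => φ s) h2.isoPullback_inv_fst
  · apply d.pt_bijective.1
    rw [← AffineChart.map_pt, AffineChart.homOf_mkHom, Functor.map_comp, Scheme.Hom.comp_apply,
      hs'', ← hs']
    exact congrArg (fun φ => φ s) h2.isoPullback_inv_snd

lemma finitePresentation_obj (hS : IsNoetherianStack S) {F : QCohModule S}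
    (hF : F.IsCoherent) (c : AffineChart S) : Module.FinitePresentation c.ring (F.obj c) := by
  obtain ⟨d, hd, _⟩ := hS.exists_noetherian_atlas
  obtain ⟨e, f, k, hf, -⟩ := exists_cover_of_isSmoothAtlas hS.toIsFiberedInGroupoids hd c
  have := hF d
  have := Module.finitePresentation_of_finite d.ring (F.obj d)
  have h1 : Module.FinitePresentation e.ring (F.obj e) := by
    let := (AffineChart.ringMap k).toAlgebra
    obtain ⟨_, _, h, hh⟩ := F.exists_isBaseChange k
    exact Module.FinitePresentation.of_equiv hh.equiv
  let := (AffineChart.ringMap f).toAlgebra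
  have : Module.FaithfullyFlat c.ring e.ring := hf
  obtain ⟨_, _, h, hh⟩ := F.exists_isBaseChange f
  have : Module.FinitePresentation e.ring (e.ring ⊗[c.ring] F.obj c) :=
    Module.FinitePresentation.of_equiv hh.equiv.symm
  exact finitePresentation_of_tensorProduct (B := e.ring)

/-- A basic open subset of a chart is a chart. -/
lemma exists_chart_basicOpen (hS : IsFiberedInGroupoids S) (c : AffineChart S) (g : c.ring) :
    ∃ (c' : AffineChart S) (f : c' ⟶ c), (AffineChart.ringMap f).Flat ∧
      Set.range (PrimeSpectrum.comap (AffineChart.ringMap f)) = PrimeSpectrum.basicOpen g := by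
  obtain ⟨x, i, f, hf⟩ := c.exists_of_ringHom hS
    (CommRingCat.ofHom (algebraMap c.ring (Localization.Away g)))
  refine ⟨_, f, ?_, ?_⟩
  · rw [hf]
    exact RingHom.flat_algebraMap_iff.2 inferInstance
  · rw [hf]
    exact PrimeSpectrum.localization_away_comap_range _ g

lemma exists_freeAt_of_mem_freeLocus {F : QCohModule S} (hF : F.IsCoherent)
    (hS : IsFiberedInGroupoids S) {Δ : Set ℕ}
    {c : AffineChart S} {p : PrimeSpectrum c.ring} (hp : p ∈ (F.freeLocus Δ).opens c) :
    ∃ δ ∈ Δ, FreeAt c.ring (F.obj c) p δ := by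
  simp only [QCohModule.freeLocus, OpenSubstack.union, TopologicalSpace.Opens.mem_iSup] at hp
  obtain ⟨V, hV, hpV⟩ := hp
  obtain ⟨_, ⟨g, rfl⟩, hg, hgV⟩ :=
    PrimeSpectrum.isTopologicalBasis_basic_opens.exists_subset_of_mem_open hpV (V.opens c).2
  obtain ⟨c', f, hf, hr⟩ := exists_chart_basicOpen hS c g
  obtain ⟨q, rfl⟩ : p ∈ Set.range (PrimeSpectrum.comap (AffineChart.ringMap f)) := by
    rw [hr]
    exact hg
  have h1 := hV c' (by
    rw [eq_top_iff]
    intro q' _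
    rw [V.mem_iff f]
    apply hgV
    exact hr.le ⟨_, rfl⟩)
  obtain ⟨δ, hδ, h2⟩ := h1.exists_freeAt q
  exact ⟨δ, hδ, (freeAt_iff_of_flat hF f hf).2 h2⟩

lemma isLocallyFreeOn_freeLocus (hS : IsNoetherianStack S) {F : QCohModule S}
    (hF : F.IsCoherent) (Δ : Set ℕ) : F.IsLocallyFreeOn (F.freeLocus Δ) Δ := fun c hc => by
  have := finitePresentation_obj hS hF c
  refine locallyFreeWithRanks_of_freeAt fun p => ?_
  exact exists_freeAt_of_mem_freeLocus hF hS.toIsFiberedInGroupoids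
    (hc ▸ TopologicalSpace.Opens.mem_top p)

lemma isGreatest_freeLocus (hS : IsNoetherianStack S) {F : QCohModule S}
    (hF : F.IsCoherent) (Δ : Set ℕ) :
    IsGreatest {V : OpenSubstack S | F.IsLocallyFreeOn V Δ} (F.freeLocus Δ) :=
  ⟨isLocallyFreeOn_freeLocus hS hF Δ, fun V hV c =>
    le_iSup₂_of_le (f := fun (U : OpenSubstack S) (_ : U ∈ {V | F.IsLocallyFreeOn V Δ}) =>
      U.opens c) V hV le_rfl⟩

/-- The open substack of the points whose images in a noetherian atlas have free stalks. -/
lemma exists_openSubstack_freeAt (hS : IsNoetherianStack S) {F : QCohModule S}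
    (hF : F.IsCoherent) (Δ : Set ℕ) : ∃ V : OpenSubstack S, F.IsLocallyFreeOn V Δ ∧
    ∀ (c d : AffineChart S), IsFlatOver S d.obj → IsNoetherianRing d.ring → ∀ (f : c ⟶ d)
      (p : PrimeSpectrum c.ring) (δ : ℕ), δ ∈ Δ →
        FreeAt d.ring (F.obj d) (PrimeSpectrum.comap (AffineChart.ringMap f) p) δ →
          p ∈ V.opens c := by
  have hS' := hS.toIsFiberedInGroupoids
  obtain ⟨d, hd, _⟩ := hS.exists_noetherian_atlas
  have hd' := hd.isSmoothOver.isFlatOver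
  let V : ∀ c : AffineChart S, Set (PrimeSpectrum c.ring) := fun c => {p | ∃ (e : AffineChart S)
    (f : e ⟶ c) (k : e ⟶ d) (q : PrimeSpectrum e.ring),
    PrimeSpectrum.comap (AffineChart.ringMap f) q = p ∧ ∃ δ ∈ Δ,
      FreeAt d.ring (F.obj d) (PrimeSpectrum.comap (AffineChart.ringMap k) q) δ}
  have hVmem : ∀ {c : AffineChart S} {p : PrimeSpectrum c.ring}, p ∈ V c → ∀ {e : AffineChart S}
      (f : e ⟶ c) (k : e ⟶ d) (q : PrimeSpectrum e.ring),
      PrimeSpectrum.comap (AffineChart.ringMap f) q = p → ∃ δ ∈ Δ,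
        FreeAt d.ring (F.obj d) (PrimeSpectrum.comap (AffineChart.ringMap k) q) δ := by
    rintro c p ⟨e', f', k', q', hq', δ, hδ, h⟩ e f k q hq
    obtain ⟨t, l, r, s, h1, rfl, rfl⟩ := exists_pullback_chart hS' f' f (hq'.trans hq.symm)
    refine ⟨δ, hδ, ?_⟩
    rw [← PrimeSpectrum.comap_comp_apply, ← AffineChart.ringMap_comp] at h ⊢
    exact (freeAt_comap_iff hS' hF hd' hd' _ _ s δ).1 h
  have hopen : ∀ c, IsOpen (V c) := by
    intro c
    obtain ⟨e, f, k, hf, hf'⟩ := exists_cover_of_isSmoothAtlas hS' hd c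
    have hq : Topology.IsQuotientMap (PrimeSpectrum.comap (AffineChart.ringMap f)) :=
      PrimeSpectrum.isQuotientMap_of_generalizingMap
        (RingHom.FaithfullyFlat.iff_flat_and_comap_surjective.1 hf).2
        (RingHom.Flat.generalizingMap_comap hf.flat)
    rw [← hq.isOpen_preimage, isOpen_iff_mem_nhds]
    intro q hqV
    obtain ⟨δ, hδ, h⟩ := hVmem hqV f k q rfl
    have := finitePresentation_obj hS hF d
    obtain ⟨g, hg, hg'⟩ := h.exists_open
    refine Filter.mem_of_superset ((PrimeSpectrum.isOpen_basicOpen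
      (a := AffineChart.ringMap k g)).mem_nhds hg) fun q' hq' => ?_
    exact ⟨e, f, k, q', rfl, δ, hδ, hg' _ hq'⟩
  refine ⟨⟨fun c => ⟨V c, hopen c⟩, fun {c c'} f p => ?_⟩, fun c hc => ?_, ?_⟩
  · constructor
    · rintro ⟨e, g, k, q, rfl, h⟩
      exact ⟨e, g ≫ f, k, q, by rw [AffineChart.ringMap_comp, PrimeSpectrum.comap_comp_apply], h⟩
    · rintro ⟨e, g, k, q, hq, δ, hδ, h⟩
      obtain ⟨t, l, r, s, h1, rfl, rfl⟩ := exists_pullback_chart hS' g f hq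
      refine ⟨t, r, l ≫ k, s, rfl, δ, hδ, ?_⟩
      rwa [AffineChart.ringMap_comp, PrimeSpectrum.comap_comp_apply]
  · have := finitePresentation_obj hS hF c
    refine locallyFreeWithRanks_of_freeAt fun p => ?_
    obtain ⟨e, f, k, hf, hf'⟩ := exists_cover_of_isSmoothAtlas hS' hd c
    obtain ⟨q, rfl⟩ := (RingHom.FaithfullyFlat.iff_flat_and_comap_surjective.1 hf).2 p
    have hp : PrimeSpectrum.comap (AffineChart.ringMap f) q ∈ V c := by
      have : PrimeSpectrum.comap (AffineChart.ringMap f) q ∈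
        (⊤ : TopologicalSpace.Opens (PrimeSpectrum c.ring)) := TopologicalSpace.Opens.mem_top _
      rw [← hc] at this
      exact this
    obtain ⟨δ, hδ, h⟩ := hVmem hp f k q rfl
    exact ⟨δ, hδ, (freeAt_iff_of_flat hF f hf.flat).2 (freeAt_of_comap F k h)⟩
  · intro c d' hd'' _ f p δ hδ h
    obtain ⟨e, g, k, hg, -⟩ := exists_cover_of_isSmoothAtlas hS' hd c
    obtain ⟨q, rfl⟩ := (RingHom.FaithfullyFlat.iff_flat_and_comap_surjective.1 hg).2 p
    refine ⟨e, g, k, q, rfl, δ, hδ, ?_⟩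
    rw [← PrimeSpectrum.comap_comp_apply, ← AffineChart.ringMap_comp] at h
    exact (freeAt_comap_iff hS' hF hd'' hd' _ _ q δ).1 h

/-- On a flat noetherian chart, the largest open substack over which `F` is locally
free with ranks in `Δ` consists of the points with free stalks. -/
lemma mem_freeLocus_iff (hS : IsNoetherianStack S) {F : QCohModule S}
    (hF : F.IsCoherent) {Δ : Set ℕ} {d : AffineChart S} (hd : IsFlatOver S d.obj)
    (hd' : IsNoetherianRing d.ring) (p : PrimeSpectrum d.ring) :
    p ∈ (F.freeLocus Δ).opens d ↔ ∃ δ ∈ Δ, FreeAt d.ring (F.obj d) p δ := by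
  refine ⟨exists_freeAt_of_mem_freeLocus hF hS.toIsFiberedInGroupoids, ?_⟩
  rintro ⟨δ, hδ, h⟩
  obtain ⟨V, hV, hV'⟩ := exists_openSubstack_freeAt hS hF Δ
  refine (isGreatest_freeLocus hS hF Δ).2 hV d (hV' d d hd hd' (𝟙 d) p δ hδ ?_)
  exact h

end FreeLocus

/-! ### The center -/

section CenterSubstack

open TensorProduct

/-- An inclusion of ideals can be checked flat-locally. -/
lemma ideal_le_of_flat_local {A : Type u} [CommRing A] {I J : Ideal A}
    (h : ∀ p : PrimeSpectrum A, ∃ (B : Type u) (_ : CommRing B) (φ : A →+* B) (q : PrimeSpectrum B),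
      φ.Flat ∧ PrimeSpectrum.comap φ q = p ∧ I.map φ ≤ J.map φ) : I ≤ J := by
  intro a ha
  by_contra haJ
  have hne : J.colon {a} ≠ ⊤ := by
    rw [Ne, Ideal.eq_top_iff_one, Submodule.mem_colon_singleton, one_smul]
    exact haJ
  obtain ⟨m, hm, hle⟩ := Ideal.exists_le_maximal _ hne
  obtain ⟨B, _, φ, q, hφ, hq, hIJ⟩ := h ⟨m, hm.isPrime⟩
  let := φ.toAlgebra
  have : Module.Flat A B := hφ
  obtain ⟨p, hp⟩ : ∃ p, p = PrimeSpectrum.comap (algebraMap A B) q := ⟨_, rfl⟩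
  have hpm : p.asIdeal = m := hp.trans hq ▸ rfl
  have : q.asIdeal.LiesOver p.asIdeal := ⟨by rw [hp]; rfl⟩
  let Ap := Localization.AtPrime p.asIdeal
  let Bq := Localization.AtPrime q.asIdeal
  let := Localization.AtPrime.algebraOfLiesOver p.asIdeal q.asIdeal
  have : Module.Flat A Bq := Module.Flat.trans A B _
  have : Module.Flat Ap Bq := (Module.flat_iff_of_isLocalization Ap p.asIdeal.primeCompl _).2 this
  have : Module.FaithfullyFlat Ap Bq := Module.FaithfullyFlat.of_flat_of_isLocalHom
  have h1 : algebraMap A B a ∈ J.map (algebraMap A B) := hIJ (Ideal.mem_map_of_mem _ ha)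
  have h2 : algebraMap A Ap a ∈ J.map (algebraMap A Ap) := by
    rw [← Ideal.comap_map_eq_self_of_faithfullyFlat (B := Bq) (J.map (algebraMap A Ap)),
      Ideal.mem_comap, Ideal.map_map, ← IsScalarTower.algebraMap_eq,
      ← IsScalarTower.algebraMap_apply, IsScalarTower.algebraMap_apply A B Bq,
      IsScalarTower.algebraMap_eq A B Bq, ← Ideal.map_map]
    exact Ideal.mem_map_of_mem _ h1
  obtain ⟨s, hs, hsJ⟩ := (IsLocalization.algebraMap_mem_map_algebraMap_iff
    p.asIdeal.primeCompl Ap J a).1 h2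
  apply hs
  rw [hpm]
  exact hle (Submodule.mem_colon_singleton.2 hsJ)

/-- A ring with a faithfully flat noetherian algebra is noetherian. -/
lemma isNoetherianRing_of_faithfullyFlat (A B : Type*) [CommRing A] [CommRing B] [Algebra A B]
    [Module.FaithfullyFlat A B] [IsNoetherianRing B] : IsNoetherianRing A := by
  rw [isNoetherianRing_iff, isNoetherian_iff']
  have hmono : StrictMono (fun I : Ideal A => I.map (algebraMap A B)) :=
    Monotone.strictMono_of_injective (fun _ _ h => Ideal.map_mono h)
      (Ideal.map_injective_of_faithfullyFlat (A := A) (B := B))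
  have : WellFoundedGT (Ideal B) := inferInstance
  exact hmono.wellFoundedGT

variable {S : CatOverSch.{u}}

lemma centerIdeal_eq (F : QCohModule S) (Δ : Set ℕ) (c : AffineChart S) :
    F.centerIdeal Δ c =
      flatteningIdeal c.ring (F.obj c) (fun δ => (F.freeLocus {δ}).opens c) Δ := rfl

lemma centerIdeal_map {F : QCohModule S} (hF : F.IsCoherent) (Δ : Set ℕ) {c d : AffineChart S}
    [IsNoetherianRing d.ring] (f : c ⟶ d) (hf : (AffineChart.ringMap f).Flat) :
    (F.centerIdeal Δ d).map (AffineChart.ringMap f) = F.centerIdeal Δ c := by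
  let := (AffineChart.ringMap f).toAlgebra
  have : Module.Flat d.ring c.ring := hf
  have := hF d
  obtain ⟨_, _, h, hh⟩ := F.exists_isBaseChange f
  exact flatteningIdeal_map hh Δ fun δ q => (F.freeLocus {δ}).mem_iff f q

lemma Ideal.map_ringMap_comp {c d e : AffineChart S} (f : c ⟶ d) (g : d ⟶ e) (I : Ideal e.ring) :
    I.map (AffineChart.ringMap (f ≫ g)) =
      (I.map (AffineChart.ringMap g)).map (AffineChart.ringMap f) := by
  rw [Ideal.map_map, AffineChart.ringMap_comp]

/-- The extended center ideal does not depend on the flat noetherian chart. -/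
lemma map_centerIdeal_eq (hS : IsFiberedInGroupoids S) {F : QCohModule S} (hF : F.IsCoherent)
    (Δ : Set ℕ) {c d e : AffineChart S} (hc : IsFlatOver S c.obj) (hd : IsFlatOver S d.obj)
    [IsNoetherianRing c.ring] [IsNoetherianRing d.ring] (f : e ⟶ c) (k : e ⟶ d) :
    (F.centerIdeal Δ c).map (AffineChart.ringMap f) =
      (F.centerIdeal Δ d).map (AffineChart.ringMap k) := by
  have key : ∀ q : PrimeSpectrum e.ring, ∃ (B : Type u) (_ : CommRing B) (φ : e.ring →+* B)
      (q' : PrimeSpectrum B), φ.Flat ∧ PrimeSpectrum.comap φ q' = q ∧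
        ((F.centerIdeal Δ c).map (AffineChart.ringMap f)).map φ =
          ((F.centerIdeal Δ d).map (AffineChart.ringMap k)).map φ := by
    intro q
    obtain ⟨e', τ, h, j, a, b, q', hh, ha, hb, h1, h2, rfl⟩ :=
      exists_flat_comparison hS hc hd f k q
    refine ⟨_, _, AffineChart.ringMap h, q', hh, rfl, ?_⟩
    rw [← Ideal.map_ringMap_comp, ← Ideal.map_ringMap_comp, h1, h2, Ideal.map_ringMap_comp,
      Ideal.map_ringMap_comp, centerIdeal_map hF Δ a ha, centerIdeal_map hF Δ b hb]
  apply le_antisymm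
  · refine ideal_le_of_flat_local fun q => ?_
    obtain ⟨B, i, φ, q', h1, h2, h3⟩ := key q
    exact ⟨B, i, φ, q', h1, h2, h3.le⟩
  · refine ideal_le_of_flat_local fun q => ?_
    obtain ⟨B, i, φ, q', h1, h2, h3⟩ := key q
    exact ⟨B, i, φ, q', h1, h2, h3.ge⟩

lemma exists_pullback_faithfullyFlat (hS : IsFiberedInGroupoids S) {c d e : AffineChart S}
    (g : c ⟶ e) (f : d ⟶ e) (hf : (AffineChart.ringMap f).FaithfullyFlat) :
    ∃ (t : AffineChart S) (l : t ⟶ c) (r : t ⟶ d), l ≫ g = r ≫ f ∧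
      (AffineChart.ringMap l).FaithfullyFlat := by
  let := (AffineChart.ringMap f).toAlgebra
  let := (AffineChart.ringMap g).toAlgebra
  have : Module.FaithfullyFlat e.ring d.ring := hf
  obtain ⟨x, i, l, r, h, hl, -⟩ := AffineChart.exists_pullback hS g f
  refine ⟨_, l, r, h, ?_⟩
  rw [hl]
  exact (RingHom.faithfullyFlat_algebraMap_iff (R := c.ring) (S := c.ring ⊗[e.ring] d.ring)).2
    inferInstance

lemma map_ringMap_injective {c d : AffineChart S} (f : c ⟶ d)
    (hf : (AffineChart.ringMap f).FaithfullyFlat) :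
    Function.Injective (fun I : Ideal d.ring => I.map (AffineChart.ringMap f)) := by
  let := (AffineChart.ringMap f).toAlgebra
  have : Module.FaithfullyFlat d.ring c.ring := hf
  exact Ideal.map_injective_of_faithfullyFlat (A := d.ring) (B := c.ring)

lemma comap_map_ringMap {c d : AffineChart S} (f : c ⟶ d)
    (hf : (AffineChart.ringMap f).FaithfullyFlat) (I : Ideal d.ring) :
    (I.map (AffineChart.ringMap f)).comap (AffineChart.ringMap f) = I := by
  let := (AffineChart.ringMap f).toAlgebra
  have : Module.FaithfullyFlat d.ring c.ring := hf
  exact Ideal.comap_map_eq_self_of_faithfullyFlat (A := d.ring) (B := c.ring) I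

/-- The center ideals on flat noetherian charts glue to a closed substack. -/
lemma exists_center (hS : IsNoetherianStack S) {F : QCohModule S} (hF : F.IsCoherent) (Δ : Set ℕ) :
    ∃ Z : ClosedSubstack S, ∀ c : AffineChart S, IsFlatOver S c.obj → IsNoetherianRing c.ring →
      Z.ideal c = F.centerIdeal Δ c := by
  have hS' := hS.toIsFiberedInGroupoids
  obtain ⟨d, hd, _⟩ := hS.exists_noetherian_atlas
  have hd' := hd.isSmoothOver.isFlatOver
  let I := F.centerIdeal Δ d
  -- the functions that lie in the ideal extended from the atlas, on all charts that map to it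
  let Z : ∀ c : AffineChart S, Ideal c.ring := fun c => ⨅ (e : AffineChart S) (f : e ⟶ c)
    (k : e ⟶ d), (I.map (AffineChart.ringMap k)).comap (AffineChart.ringMap f)
  have key : ∀ {c e : AffineChart S} (f : e ⟶ c) (k : e ⟶ d),
      (AffineChart.ringMap f).FaithfullyFlat →
      (Z c).map (AffineChart.ringMap f) = I.map (AffineChart.ringMap k) := by
    intro c e f k hf
    have h1 : Z c = (I.map (AffineChart.ringMap k)).comap (AffineChart.ringMap f) := by
      refine le_antisymm (iInf_le_of_le e (iInf₂_le_of_le f k le_rfl)) ?_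
      refine le_iInf fun e' => le_iInf₂ fun f' k' a ha => ?_
      obtain ⟨t, l, r, h2, h3⟩ := exists_pullback_faithfullyFlat hS' f' f hf
      rw [Ideal.mem_comap, ← comap_map_ringMap l h3 (I.map (AffineChart.ringMap k')),
        ← Ideal.map_ringMap_comp, map_centerIdeal_eq hS' hF Δ hd' hd' (l ≫ k') (r ≫ k),
        Ideal.map_ringMap_comp, Ideal.mem_comap, ← RingHom.comp_apply,
        ← AffineChart.ringMap_comp, h2, AffineChart.ringMap_comp]
      exact Ideal.mem_map_of_mem _ ha
    rw [h1]
    let := (AffineChart.ringMap f).toAlgebra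
    have : Module.FaithfullyFlat c.ring e.ring := hf
    refine map_comap_eq_of_faithfullyFlat (A := c.ring) (B := e.ring) _ fun b hb => ?_
    obtain ⟨x, i, l, r, h2, hl, hr⟩ := AffineChart.exists_pullback hS' f f
    have h3 := map_centerIdeal_eq hS' hF Δ hd' hd' (l ≫ k) (r ≫ k)
    rw [Ideal.map_ringMap_comp, Ideal.map_ringMap_comp, hl, hr] at h3
    have h4 := Ideal.mem_map_of_mem (Algebra.TensorProduct.includeLeftRingHom :
      e.ring →+* e.ring ⊗[c.ring] e.ring) hb
    rw [h3] at h4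
    exact h4
  refine ⟨⟨Z, fun {c c'} f => ?_⟩, fun c hc _ => ?_⟩
  · obtain ⟨e, g, k, hg, -⟩ := exists_cover_of_isSmoothAtlas hS' hd c'
    obtain ⟨t, l, r, h1, h2⟩ := exists_pullback_faithfullyFlat hS' f g hg
    apply map_ringMap_injective l h2
    change Ideal.map _ _ = Ideal.map _ _
    rw [← Ideal.map_ringMap_comp, h1, Ideal.map_ringMap_comp, key g k hg,
      ← Ideal.map_ringMap_comp, key l (r ≫ k) h2]
  · obtain ⟨e, g, k, hg, -⟩ := exists_cover_of_isSmoothAtlas hS' hd c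
    apply map_ringMap_injective g hg
    change Ideal.map _ (Z c) = Ideal.map _ _
    rw [key g k hg, map_centerIdeal_eq hS' hF Δ hc hd' g k]

/-- The ring of a smooth chart of a noetherian stack is noetherian. -/
lemma isNoetherianRing_of_isSmoothOver (hS : IsNoetherianStack S) {c : AffineChart S}
    (hc : IsSmoothOver S c.obj) : IsNoetherianRing c.ring := by
  obtain ⟨d, hd, _⟩ := hS.exists_noetherian_atlas
  obtain ⟨w, a, b, -, ha, hb⟩ := exists_isSpanAtlas_of_hasProp
    (P := @Smooth) (Q := fun _ _ f => Smooth f ∧ Surjective f)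
    (fun f g _ _ (_ : Smooth g) => (inferInstance : Smooth (f ≫ g)))
    (fun f g _ _ h => by
      obtain ⟨_, _⟩ := h
      exact ⟨inferInstance, inferInstance⟩) hc hd
  obtain ⟨_, _⟩ := ha
  have hb : Smooth (S.p.map b) := hb
  have : CompactSpace (S.p.obj c.obj) := c.iso.hom.homeomorph.compactSpace
  obtain ⟨B, g, hg, hg'⟩ := exists_affine_refinement (S.p.map a)
  obtain ⟨φ, hφ⟩ := Spec.map_surjective (g ≫ S.p.map a ≫ c.iso.inv)
  obtain ⟨ψ, hψ⟩ := Spec.map_surjective (g ≫ S.p.map b ≫ d.iso.inv)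
  have h1 : φ.hom.FaithfullyFlat := by
    rw [← flat_and_surjective_SpecMap_iff, hφ, ← Category.assoc]
    exact ⟨inferInstance, inferInstance⟩
  have h2 : Smooth (Spec.map ψ) := by rw [hψ]; infer_instance
  have h3 : LocallyOfFiniteType (Spec.map ψ) := inferInstance
  rw [HasRingHomProperty.Spec_iff (P := @LocallyOfFiniteType)] at h3
  have h4 : IsNoetherianRing B := by
    let := ψ.hom.toAlgebra
    have : Algebra.FiniteType d.ring B := h3
    exact Algebra.FiniteType.isNoetherianRing d.ring B
  let := φ.hom.toAlgebra
  have : Module.FaithfullyFlat c.ring B := h1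
  exact isNoetherianRing_of_faithfullyFlat c.ring B

/-- A closed substack of a noetherian stack is determined by its ideals on smooth charts. -/
lemma ClosedSubstack.ext_of_isSmoothOver (hS : IsNoetherianStack S) {Z Z' : ClosedSubstack S}
    (h : ∀ c : AffineChart S, IsSmoothOver S c.obj → Z.ideal c = Z'.ideal c) : Z = Z' := by
  obtain ⟨d, hd, _⟩ := hS.exists_noetherian_atlas
  ext1
  funext c
  obtain ⟨e, g, k, hg, -⟩ := exists_cover_of_isSmoothAtlas hS.toIsFiberedInGroupoids hd c
  apply map_ringMap_injective g hg
  change Ideal.map _ _ = Ideal.map _ _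
  rw [Z.map_eq g, Z'.map_eq g, ← Z.map_eq k, ← Z'.map_eq k, h d hd.isSmoothOver]

open Classical in
/-- The center of the blow-up: the closed substack defined by the center ideals.  (The empty
closed substack when the center ideals do not glue.) -/
def center (S : CatOverSch.{u}) (F : QCohModule S) (Δ : Set ℕ) : ClosedSubstack S :=
  if h : ∃ Z : ClosedSubstack S, ∀ c : AffineChart S, IsSmoothOver S c.obj →
    Z.ideal c = F.centerIdeal Δ c then h.choose
  else ⟨fun _ => ⊤, fun _ => Ideal.map_top _⟩

lemma center_ideal_eq (hS : IsNoetherianStack S) {F : QCohModule S} (hF : F.IsCoherent)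
    (Δ : Set ℕ) {c : AffineChart S} (hc : IsFlatOver S c.obj) (hc' : IsNoetherianRing c.ring) :
    (center S F Δ).ideal c = F.centerIdeal Δ c := by
  obtain ⟨Z, hZ⟩ := exists_center hS hF Δ
  have h : ∃ Z : ClosedSubstack S, ∀ c : AffineChart S, IsSmoothOver S c.obj →
      Z.ideal c = F.centerIdeal Δ c :=
    ⟨Z, fun c hc => hZ c hc.isFlatOver (isNoetherianRing_of_isSmoothOver hS hc)⟩
  have h1 : center S F Δ = Z := by
    apply ClosedSubstack.ext_of_isSmoothOver hS
    intro c hc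
    rw [center, dif_pos h, h.choose_spec c hc,
      hZ c hc.isFlatOver (isNoetherianRing_of_isSmoothOver hS hc)]
  rw [h1, hZ c hc hc']

lemma center_ideal_fg (hS : IsNoetherianStack S) (F : QCohModule S) (Δ : Set ℕ)
    (c : AffineChart S) : ((center S F Δ).ideal c).FG := by
  obtain ⟨d, hd, _⟩ := hS.exists_noetherian_atlas
  obtain ⟨e, f, k, hf, -⟩ := exists_cover_of_isSmoothAtlas hS.toIsFiberedInGroupoids hd c
  let := (AffineChart.ringMap f).toAlgebra
  have : Module.FaithfullyFlat c.ring e.ring := hf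
  apply Ideal.FG.of_FG_map_of_faithfullyFlat (S := e.ring)
  change (Ideal.map (AffineChart.ringMap f) _).FG
  rw [ClosedSubstack.map_eq _ f, ← ClosedSubstack.map_eq _ k]
  exact ((isNoetherianRing_iff_ideal_fg d.ring).1 inferInstance _).map _

lemma centerIdeal_le_iff (hS : IsNoetherianStack S) {F : QCohModule S} (hF : F.IsCoherent)
    (Δ : Set ℕ) {c : AffineChart S} (hc : IsFlatOver S c.obj) (hc' : IsNoetherianRing c.ring)
    (p : PrimeSpectrum c.ring) :
    F.centerIdeal Δ c ≤ p.asIdeal ↔ p ∉ (F.freeLocus Δ).opens c := by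
  have := hF c
  rw [mem_freeLocus_iff hS hF hc hc', centerIdeal_eq]
  refine flatteningIdeal_le_iff Δ (fun δ p => ?_) p
  rw [mem_freeLocus_iff hS hF hc hc']
  simp

lemma zeroLocus_center (hS : IsNoetherianStack S) {F : QCohModule S} (hF : F.IsCoherent)
    (Δ : Set ℕ) (c : AffineChart S) :
    PrimeSpectrum.zeroLocus ((center S F Δ).ideal c : Set c.ring) =
      ((F.freeLocus Δ).opens c : Set (PrimeSpectrum c.ring))ᶜ := by
  obtain ⟨d, hd, _⟩ := hS.exists_noetherian_atlas
  obtain ⟨e, f, k, hf, -⟩ := exists_cover_of_isSmoothAtlas hS.toIsFiberedInGroupoids hd c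
  ext p
  obtain ⟨q, rfl⟩ := (RingHom.FaithfullyFlat.iff_flat_and_comap_surjective.1 hf).2 p
  rw [PrimeSpectrum.mem_zeroLocus, SetLike.coe_subset_coe, PrimeSpectrum.comap_asIdeal,
    ← Ideal.map_le_iff_le_comap, ClosedSubstack.map_eq _ f, ← ClosedSubstack.map_eq _ k,
    Ideal.map_le_iff_le_comap, ← PrimeSpectrum.comap_asIdeal,
    center_ideal_eq hS hF Δ hd.isSmoothOver.isFlatOver inferInstance,
    centerIdeal_le_iff hS hF Δ hd.isSmoothOver.isFlatOver inferInstance,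
    ← (F.freeLocus Δ).mem_iff, Set.mem_compl_iff, SetLike.mem_coe, ← (F.freeLocus Δ).mem_iff]

/-- The center is functorial with respect to flat morphisms. -/
lemma center_pullback {S' : CatOverSch.{u}} (g : BasedFunctor S' S) {F : QCohModule S}
    {F' : QCohModule S'} (Δ : Set ℕ) (hS : IsNoetherianStack S) (hS' : IsNoetherianStack S')
    (hg : IsFlatMorphism g) (hF : F.IsCoherent) (e : F'.IsIsomorphic (F.pullback g)) :
    center S' F' Δ = (center S F Δ).pullback g := by
  obtain ⟨e, -⟩ := e
  have hF' : F'.IsCoherent := fun c => by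
    have : Module.Finite c.ring ((F.pullback g).obj c) := hF (c.push g)
    exact Module.Finite.equiv (e c).symm
  apply ClosedSubstack.ext_of_isSmoothOver hS'
  intro c hc
  have hc' := isNoetherianRing_of_isSmoothOver hS' hc
  have hgc : IsFlatOver S (c.push g).obj := hg c.obj hc
  have hgc' : IsNoetherianRing (c.push g).ring := hc'
  rw [center_ideal_eq hS' hF' Δ hc.isFlatOver hc']
  refine Eq.trans ?_ (center_ideal_eq hS hF Δ hgc hgc').symm
  rw [centerIdeal_eq, centerIdeal_eq]
  have : Module.Finite c.ring (F'.obj c) := hF' c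
  have h1 := flatteningIdeal_map (A := c.ring) (B := c.ring) (M := F'.obj c)
    (N := (F.pullback g).obj c) (IsBaseChange.ofEquiv (e c))
    (V := fun δ => (F'.freeLocus {δ}).opens c) (V' := fun δ => (F.freeLocus {δ}).opens (c.push g))
    Δ (fun δ q => by
      have h2 := mem_freeLocus_iff hS hF (Δ := {δ}) hgc hgc' q
      have h3 := mem_freeLocus_iff hS' hF' (Δ := {δ}) hc.isFlatOver hc' q
      simp only [Set.mem_singleton_iff, exists_eq_left] at h2 h3
      refine h2.trans (Iff.trans ⟨fun h => ?_, fun h => ?_⟩ h3.symm)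
      · exact FreeAt.congr (e c).symm h
      · exact FreeAt.congr (e c) h)
  rw [Algebra.algebraMap_self, Ideal.map_id] at h1
  exact h1

end CenterSubstack

/-! ### Charts of the blow-up -/

section Rees

open Polynomial

variable {A : Type u} [CommRing A] (I : Ideal A)

/-- The part of degree `n` of the Rees algebra. -/
def reesGrading (n : ℕ) : Submodule A (reesAlgebra I) where
  carrier := {f | ∀ m ≠ n, (f : A[X]).coeff m = 0}
  add_mem' hf hg m hm := by simp [hf m hm, hg m hm]
  zero_mem' m _ := by simp
  smul_mem' a f hf m hm := by simp [hf m hm]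

variable {I} in
lemma mem_reesGrading {n : ℕ} {f : reesAlgebra I} :
    f ∈ reesGrading I n ↔ (f : A[X]) = monomial n ((f : A[X]).coeff n) := by
  constructor
  · intro h
    ext m
    rw [coeff_monomial]
    split_ifs with hm
    · rw [hm]
    · exact h m (Ne.symm hm)
  · intro h m hm
    rw [h, coeff_monomial, if_neg (Ne.symm hm)]

/-- A homogeneous element of the Rees algebra. -/
def reesMonomial (n : ℕ) (r : A) (hr : r ∈ I ^ n) : reesAlgebra I :=
  ⟨monomial n r, reesAlgebra.monomial_mem.2 hr⟩

lemma reesMonomial_mem (n : ℕ) (r : A) (hr : r ∈ I ^ n) :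
    reesMonomial I n r hr ∈ reesGrading I n := fun m hm => by
  simp [reesMonomial, coeff_monomial, Ne.symm hm]

instance : SetLike.GradedMonoid (reesGrading I) where
  one_mem m hm := by simp [coeff_one, hm]
  mul_mem i j f g hf hg := by
    rw [mem_reesGrading] at hf hg
    intro m hm
    rw [MulMemClass.coe_mul, hf, hg, monomial_mul_monomial, coeff_monomial, if_neg (Ne.symm hm)]

/-- The homogeneous components of an element of the Rees algebra. -/
def reesComponent (n : ℕ) : reesAlgebra I →+ reesGrading I n where
  toFun f := ⟨reesMonomial I n ((f : A[X]).coeff n) (f.2 n), reesMonomial_mem I n _ _⟩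
  map_zero' := Subtype.ext (Subtype.ext (by simp [reesMonomial]))
  map_add' f g := Subtype.ext (Subtype.ext (by simp [reesMonomial]))

lemma coe_reesComponent (n : ℕ) (f : reesAlgebra I) :
    ((reesComponent I n f : reesAlgebra I) : A[X]) = monomial n ((f : A[X]).coeff n) := rfl

lemma reesComponent_coeAddMonoidHom (n : ℕ) (x : DirectSum ℕ fun i => reesGrading I i) :
    reesComponent I n (DirectSum.coeAddMonoidHom (reesGrading I) x) = x n := by
  induction x using DirectSum.induction_on with
  | zero => simp
  | of m f =>
    rw [DirectSum.coeAddMonoidHom_of]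
    apply Subtype.ext
    apply Subtype.ext
    rw [coe_reesComponent]
    by_cases h : m = n
    · subst h
      rw [DirectSum.of_eq_same]
      exact (mem_reesGrading.1 f.2).symm
    · rw [DirectSum.of_eq_of_ne _ _ _ (Ne.symm h), f.2 n (Ne.symm h), monomial_zero_right]
      rfl
  | add x y hx hy => rw [map_add, map_add, hx, hy, DirectSum.add_apply]

lemma mk_reesComponent_apply (f : reesAlgebra I) (n : ℕ) :
    DirectSum.mk (fun i => reesGrading I i) (f : A[X]).support (fun n => reesComponent I n f) n =
      reesComponent I n f := by
  by_cases hn : n ∈ (f : A[X]).support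
  · exact DirectSum.mk_apply_of_mem hn
  · refine (DirectSum.mk_apply_of_notMem hn).trans ?_
    apply Subtype.ext
    apply Subtype.ext
    rw [coe_reesComponent, notMem_support_iff.1 hn, monomial_zero_right]
    rfl

instance : DirectSum.Decomposition (reesGrading I) where
  decompose' f := DirectSum.mk _ (f : A[X]).support fun n => reesComponent I n f
  left_inv f := by
    have key : ∀ n, reesComponent I n (DirectSum.coeAddMonoidHom (reesGrading I)
        (DirectSum.mk _ (f : A[X]).support fun n => reesComponent I n f)) =
        reesComponent I n f := fun n => by
      rw [reesComponent_coeAddMonoidHom, mk_reesComponent_apply]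
    apply Subtype.ext
    ext n
    have := congrArg (fun z : reesGrading I n => ((z : reesAlgebra I) : A[X]).coeff n) (key n)
    simpa [coe_reesComponent] using this
  right_inv x := DFinsupp.ext fun n =>
    (mk_reesComponent_apply I _ n).trans (reesComponent_coeAddMonoidHom I n x)

instance : GradedAlgebra (reesGrading I) where

/-- The degree one element of the Rees algebra given by an element of the ideal. -/
def reesVar (a : A) (ha : a ∈ I) : reesAlgebra I := reesMonomial I 1 a (by rwa [pow_one])

lemma reesVar_mem (a : A) (ha : a ∈ I) : reesVar I a ha ∈ reesGrading I 1 :=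
  reesMonomial_mem I 1 a _

lemma coe_reesVar_pow (a : A) (ha : a ∈ I) (n : ℕ) :
    ((reesVar I a ha ^ n : reesAlgebra I) : A[X]) = monomial n (a ^ n) := by
  rw [SubmonoidClass.coe_pow]
  change (monomial 1 a) ^ n = _
  rw [monomial_pow, one_mul]

/-- The coordinate ring of the chart of the blow-up where the ideal is generated by `a`. -/
abbrev ReesChart (a : A) (ha : a ∈ I) : Type u :=
  HomogeneousLocalization.Away (reesGrading I) (reesVar I a ha)

/-- The structure map of a chart of the blow-up. -/
def toReesChart (a : A) (ha : a ∈ I) : A →+* ReesChart I a ha :=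
  (HomogeneousLocalization.fromZeroRingHom (reesGrading I) _).comp
    (algebraMap A (reesGrading I 0))

lemma val_toReesChart (a : A) (ha : a ∈ I) (r : A) :
    (toReesChart I a ha r).val =
      algebraMap (reesAlgebra I) (Localization.Away (reesVar I a ha)) (algebraMap A _ r) := by
  rw [← Localization.mk_one_eq_algebraMap]
  rfl

/-- The elements of a chart of the blow-up are the fractions `f / aⁿ` with `f ∈ Iⁿ`. -/
lemma exists_mul_eq_toReesChart (a : A) (ha : a ∈ I) (c : ReesChart I a ha) :
    ∃ n, ∃ f ∈ I ^ n, c * toReesChart I a ha (a ^ n) = toReesChart I a ha f := by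
  obtain ⟨n, x, hx, rfl⟩ := HomogeneousLocalization.Away.mk_surjective _ (reesVar_mem I a ha) c
  have hx' : x ∈ reesGrading I n := by simpa using hx
  rw [mem_reesGrading] at hx'
  refine ⟨n, (x : A[X]).coeff n, x.2 n, ?_⟩
  · apply HomogeneousLocalization.val_injective
    rw [HomogeneousLocalization.val_mul, val_toReesChart,
      val_toReesChart, HomogeneousLocalization.Away.val_mk,
      ← Localization.mk_one_eq_algebraMap, ← Localization.mk_one_eq_algebraMap,
      Localization.mk_mul, Localization.mk_eq_mk_iff, Localization.r_iff_exists]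
    refine ⟨1, Subtype.ext ?_⟩
    simp only [OneMemClass.coe_one, one_mul, mul_one, MulMemClass.coe_mul, coe_reesVar_pow]
    rw [hx']
    simp only [coeff_monomial_same]
    change monomial n _ * C (a ^ n) = monomial n (a ^ n) * C _
    rw [monomial_mul_C, monomial_mul_C, mul_comm]

/-- The quotient of two elements of the ideal in a chart of the blow-up. -/
lemma isLocalizationElem_mul (a : A) (ha : a ∈ I) (r : A) (hr : r ∈ I) :
    HomogeneousLocalization.Away.isLocalizationElem (reesVar_mem I a ha) (reesVar_mem I r hr) *
      toReesChart I a ha a = toReesChart I a ha r := by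
  apply HomogeneousLocalization.val_injective
  rw [HomogeneousLocalization.val_mul, val_toReesChart,
      val_toReesChart, HomogeneousLocalization.Away.val_mk,
      ← Localization.mk_one_eq_algebraMap, ← Localization.mk_one_eq_algebraMap,
      Localization.mk_mul, Localization.mk_eq_mk_iff, Localization.r_iff_exists]
  refine ⟨1, Subtype.ext ?_⟩
  simp only [OneMemClass.coe_one, one_mul, mul_one, MulMemClass.coe_mul, coe_reesVar_pow]
  change monomial 1 (r ^ 1) * C a = monomial 1 (a ^ 1) * C r
  rw [monomial_mul_C, monomial_mul_C, pow_one, pow_one, mul_comm]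

/-- The generator of the ideal is a nonzerodivisor on the chart: in the Rees algebra, multiplication
by `a` and by the variable `aX` of degree one have the same kernel. -/
lemma eq_zero_of_mul_toReesChart (a : A) (ha : a ∈ I) (c : ReesChart I a ha)
    (hc : c * toReesChart I a ha a = 0) : c = 0 := by
  obtain ⟨n, x, hx, rfl⟩ := HomogeneousLocalization.Away.mk_surjective _ (reesVar_mem I a ha) c
  apply HomogeneousLocalization.val_injective
  have hc' := congrArg HomogeneousLocalization.val hc
  rw [HomogeneousLocalization.val_mul, val_toReesChart, HomogeneousLocalization.val_zero,
    HomogeneousLocalization.Away.val_mk, ← Localization.mk_one_eq_algebraMap, Localization.mk_mul,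
    ← Localization.mk_zero 1, Localization.mk_eq_mk_iff, Localization.r_iff_exists] at hc'
  obtain ⟨⟨_, k, rfl⟩, hk⟩ := hc'
  rw [HomogeneousLocalization.val_zero, HomogeneousLocalization.Away.val_mk,
    ← Localization.mk_zero 1, Localization.mk_eq_mk_iff, Localization.r_iff_exists]
  refine ⟨⟨_, k + 1, rfl⟩, ?_⟩
  apply Subtype.ext
  have hk' := congrArg Subtype.val hk
  simp only [OneMemClass.coe_one, one_mul, mul_one, mul_zero, MulMemClass.coe_mul,
    coe_reesVar_pow, ZeroMemClass.coe_zero] at hk' ⊢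
  change monomial k (a ^ k) * ((x : A[X]) * C a) = 0 at hk'
  have : monomial (k + 1) (a ^ (k + 1)) = X * (monomial k (a ^ k) * C a) := by
    rw [monomial_mul_C, X_mul_monomial, pow_succ]
  rw [this]
  linear_combination X * hk'

lemma mem_nonZeroDivisors_of_mul_eq_zero {R : Type*} [CommRing R] {x : R}
    (h : ∀ c, c * x = 0 → c = 0) : x ∈ nonZeroDivisors R :=
  mem_nonZeroDivisors_iff_right.2 h

lemma toReesChart_mem_nonZeroDivisors (a : A) (ha : a ∈ I) :
    toReesChart I a ha a ∈ nonZeroDivisors (ReesChart I a ha) :=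
  mem_nonZeroDivisors_of_mul_eq_zero (eq_zero_of_mul_toReesChart I a ha)

lemma map_toReesChart (a : A) (ha : a ∈ I) :
    I.map (toReesChart I a ha) = Ideal.span {toReesChart I a ha a} := by
  refine le_antisymm (Ideal.map_le_iff_le_comap.2 fun r hr => ?_)
    ((Ideal.span_singleton_le_iff_mem _).2 (Ideal.mem_map_of_mem _ ha))
  exact Ideal.mem_span_singleton'.2 ⟨_, isLocalizationElem_mul I a ha r hr⟩

/-- A homomorphism from a chart of the blow-up is determined by its restriction to the base if the
generator of the ideal becomes a nonzerodivisor. -/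
lemma ReesChart.ringHom_ext {B : Type*} [CommRing B] (a : A) (ha : a ∈ I)
    {χ χ' : ReesChart I a ha →+* B} (h : χ.comp (toReesChart I a ha) = χ'.comp (toReesChart I a ha))
    (hB : χ (toReesChart I a ha a) ∈ nonZeroDivisors B) : χ = χ' := by
  ext c
  obtain ⟨n, f, hf, hc⟩ := exists_mul_eq_toReesChart I a ha c
  have h' : ∀ r, χ (toReesChart I a ha r) = χ' (toReesChart I a ha r) := RingHom.congr_fun h
  have h1 := congrArg χ hc
  have h2 := congrArg χ' hc
  rw [map_mul] at h1 h2
  rw [← h', ← h', ← h1] at h2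
  have hn : χ (toReesChart I a ha (a ^ n)) ∈ nonZeroDivisors B := by
    have := pow_mem hB n
    rwa [← RingHom.comp_apply, ← map_pow (χ.comp (toReesChart I a ha))] at this
  exact (mul_cancel_right_mem_nonZeroDivisors hn).1 h2.symm

/-- The universal property of the charts of the blow-up. -/
lemma ReesChart.exists_ringHom {B : Type*} [CommRing B] (a : A) (ha : a ∈ I) (φ : A →+* B)
    (hB : φ a ∈ nonZeroDivisors B) (hI : I.map φ = Ideal.span {φ a}) :
    ∃ χ : ReesChart I a ha →+* B, χ.comp (toReesChart I a ha) = φ := by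
  let L := Localization.Away (φ a)
  let ψ : reesAlgebra I →+* L :=
    (eval₂RingHom ((algebraMap B L).comp φ) 1).comp (reesAlgebra I).toSubring.subtype
  have hψ : ψ (reesVar I a ha) = algebraMap B L (φ a) := by
    change eval₂ _ _ (monomial 1 a) = _
    simp
  have hψ' : ∀ r, ψ (algebraMap A _ r) = algebraMap B L (φ r) := fun r => by
    change eval₂ _ _ (C r) = _
    simp
  let θ : Localization.Away (reesVar I a ha) →+* L :=
    IsLocalization.Away.lift (reesVar I a ha) (g := ψ)
      (by rw [hψ]; exact IsLocalization.Away.algebraMap_isUnit _)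
  have hinj : Function.Injective (algebraMap B L) :=
    IsLocalization.injective L (Submonoid.powers_le.2 hB)
  have hθ : ∀ r, θ (toReesChart I a ha r).val = algebraMap B L (φ r) := fun r => by
    rw [val_toReesChart, IsLocalization.Away.lift_eq, hψ']
  have hrange : ∀ c : ReesChart I a ha, θ c.val ∈ (algebraMap B L).range := fun c => by
    obtain ⟨n, f, hf, hc⟩ := exists_mul_eq_toReesChart I a ha c
    have h1 := congrArg (fun x : ReesChart I a ha => θ x.val) hc
    simp only [HomogeneousLocalization.val_mul, map_mul, hθ] at h1
    have h2 : φ f ∈ Ideal.span {φ a ^ n} := by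
      rw [← Ideal.span_singleton_pow, ← hI, ← Ideal.map_pow]
      exact Ideal.mem_map_of_mem _ hf
    obtain ⟨b, hb⟩ := Ideal.mem_span_singleton'.1 h2
    refine ⟨b, ?_⟩
    rw [← hb, map_mul, map_pow, map_pow] at h1
    exact (((IsLocalization.Away.algebraMap_isUnit (φ a)).pow n).mul_left_inj.1 h1).symm
  let ρ : ReesChart I a ha →+* (algebraMap B L).range :=
    (θ.comp (algebraMap (ReesChart I a ha) (Localization.Away (reesVar I a ha)))).codRestrict _
      hrange
  -- `θ` takes values in `B`, since `φ f` is divisible by `φ a ^ n` for `f` in `I ^ n`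
  refine ⟨(RingEquiv.ofLeftInverse (Function.leftInverse_invFun hinj)).symm.toRingHom.comp ρ, ?_⟩
  ext r
  rw [RingHom.comp_apply]
  change (RingEquiv.ofLeftInverse (Function.leftInverse_invFun hinj)).symm (ρ _) = _
  rw [RingEquiv.symm_apply_eq]
  exact Subtype.ext (hθ r)

end Rees

/-! ### The blow-up of an affine scheme -/

section BlowUpScheme

open Polynomial

/-- The positive part of the Rees algebra is generated in degree one. -/
lemma reesMonomial_mem_span {A : Type u} [CommRing A] (I : Ideal A) (n : ℕ) {r : A}
    (hr : r ∈ I ^ (n + 1)) :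
    reesMonomial I (n + 1) r hr ∈
      Ideal.span (Set.range fun a : I => reesVar I a.1 a.2) := by
  suffices H : ∀ s (_ : s ∈ I ^ n * I) (h : s ∈ I ^ (n + 1)), reesMonomial I (n + 1) s h ∈
      Ideal.span (Set.range fun a : I => reesVar I a.1 a.2) from H r (by rwa [← pow_succ]) hr
  intro s hs
  induction hs using Submodule.mul_induction_on' with
  | mem_mul_mem s hs a ha =>
    intro h
    have : reesMonomial I (n + 1) (s * a) h = reesMonomial I n s hs * reesVar I a ha :=
      Subtype.ext (monomial_mul_monomial n 1 s a).symm
    rw [this]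
    exact Ideal.mul_mem_left _ _ (Ideal.subset_span ⟨⟨a, ha⟩, rfl⟩)
  | add x hx y hy hx' hy' =>
    intro h
    rw [← pow_succ] at hx hy
    have : reesMonomial I (n + 1) (x + y) h =
        reesMonomial I (n + 1) x hx + reesMonomial I (n + 1) y hy :=
      Subtype.ext ((monomial (n + 1)).map_add x y)
    rw [this]
    exact add_mem (hx' hx) (hy' hy)

lemma irrelevant_le_span_reesVar {A : Type u} [CommRing A] (I : Ideal A) :
    (HomogeneousIdeal.irrelevant (reesGrading I)).toIdeal ≤
      Ideal.span (Set.range fun a : I => reesVar I a.1 a.2) := by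
  classical
  intro x hx
  have hx0 : GradedRing.proj (reesGrading I) 0 x = 0 :=
    (HomogeneousIdeal.mem_irrelevant_iff _ _).1 hx
  rw [← DirectSum.sum_support_decompose (reesGrading I) x]
  refine Ideal.sum_mem _ fun n _ => ?_
  rcases n with _ | n
  · rw [GradedRing.proj_apply] at hx0
    rw [hx0]
    exact zero_mem _
  · have h := ((DirectSum.decompose (reesGrading I) x) (n + 1)).2
    have h' := mem_reesGrading.1 h
    have : ((DirectSum.decompose (reesGrading I) x (n + 1) : reesGrading I (n + 1)) :
        reesAlgebra I) = reesMonomial I (n + 1) _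
          ((DirectSum.decompose (reesGrading I) x (n + 1)).1.2 (n + 1)) := Subtype.ext h'
    rw [this]
    exact reesMonomial_mem_span I n _

variable {A : CommRingCat.{u}} (I : Ideal A)

/-- The blow-up of `Spec A` in `I`: the projective spectrum of the Rees algebra. -/
def blowUpScheme : Scheme.{u} := Proj (reesGrading I)

/-- The structure map of the blow-up. -/
def blowUpHom : blowUpScheme I ⟶ Spec A :=
  Proj.toSpecZero (reesGrading I) ≫
    Spec.map (CommRingCat.ofHom (algebraMap A (reesGrading I 0)))

/-- The chart of the blow-up where the ideal is generated by `a`. -/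
def blowUpChart (a : A) (ha : a ∈ I) : Spec (.of (ReesChart I a ha)) ⟶ blowUpScheme I :=
  Proj.awayι (reesGrading I) (reesVar I a ha) (reesVar_mem I a ha) one_pos

instance (a : A) (ha : a ∈ I) : IsOpenImmersion (blowUpChart I a ha) := by
  unfold blowUpChart blowUpScheme
  infer_instance

lemma blowUpChart_blowUpHom (a : A) (ha : a ∈ I) :
    blowUpChart I a ha ≫ blowUpHom I = Spec.map (CommRingCat.ofHom (toReesChart I a ha)) := by
  have h := Proj.awayι_toSpecZero_assoc (reesGrading I) (reesVar I a ha) (reesVar_mem I a ha)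
    one_pos (Spec.map (CommRingCat.ofHom (algebraMap A (reesGrading I 0))))
  refine h.trans ?_
  rw [← Spec.map_comp]
  rfl

lemma exists_mem_range_blowUpChart (x : blowUpScheme I) :
    ∃ a ha, x ∈ Set.range (blowUpChart I a ha) := by
  have h := Proj.iSup_basicOpen_eq_top (reesGrading I) _ (irrelevant_le_span_reesVar I)
  have hx : x ∈ (⊤ : (blowUpScheme I).Opens) := trivial
  obtain ⟨a, ha⟩ := TopologicalSpace.Opens.mem_iSup.1 (h.ge hx)
  have h' := Proj.opensRange_awayι (reesGrading I) (reesVar I a.1 a.2) (reesVar_mem I a.1 a.2)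
    one_pos
  exact ⟨a.1, a.2, h'.ge ha⟩

/-- On the chart given by `a`, the chart given by `r` is the locus where `r / a` is invertible. -/
lemma blowUpChart_mem_range (a : A) (ha : a ∈ I) (r : A) (hr : r ∈ I)
    (x : Spec (.of (ReesChart I a ha)))
    (hx : HomogeneousLocalization.Away.isLocalizationElem (reesVar_mem I a ha)
      (reesVar_mem I r hr) ∉ x.asIdeal) :
    blowUpChart I a ha x ∈ Set.range (blowUpChart I r hr) := by
  have h := Proj.awayι_preimage_basicOpen (reesGrading I) (reesVar_mem I a ha) one_pos
    (reesVar_mem I r hr) one_pos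
  have h' := Proj.opensRange_awayι (reesGrading I) (reesVar I r hr) (reesVar_mem I r hr) one_pos
  have h1 : x ∈ PrimeSpectrum.basicOpen (HomogeneousLocalization.Away.isLocalizationElem
    (reesVar_mem I a ha) (reesVar_mem I r hr)) := hx
  exact h'.ge (h.ge h1)

/-- A morphism `T → Spec A` makes `I` Cartier at `t` if, in an affine neighbourhood of `t`, the
ideal is generated by a nonzerodivisor. -/
def IsCartierAt {T : Scheme.{u}} (f : T ⟶ Spec A) (t : T) : Prop :=
  ∃ (B : CommRingCat.{u}) (w : Spec B ⟶ T) (φ : A ⟶ B), IsOpenImmersion w ∧ t ∈ Set.range w ∧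
    w ≫ f = Spec.map φ ∧ ∃ b ∈ nonZeroDivisors B, I.map φ.hom = Ideal.span {b}

variable {I}

lemma map_span_nonZeroDivisors_of_ringEquiv {B C : Type*} [CommRing B] [CommRing C] (e : B ≃+* C)
    {φ : A →+* B} (h : ∃ b ∈ nonZeroDivisors B, I.map φ = Ideal.span {b}) :
    ∃ b ∈ nonZeroDivisors C, I.map ((e : B →+* C).comp φ) = Ideal.span {b} := by
  obtain ⟨b, hb, hI⟩ := h
  refine ⟨e b, mem_nonZeroDivisors_of_mul_eq_zero fun c hc => ?_, ?_⟩
  · have h1 : e.symm c * b = 0 := by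
      apply e.injective
      rw [map_mul, e.apply_symm_apply, hc, map_zero]
    have h2 := (mem_nonZeroDivisors_iff_right.1 hb) _ h1
    simpa using h2
  · rw [← Ideal.map_map, hI, Ideal.map_span, Set.image_singleton]
    rfl

lemma fromSpec_comp_eq {T : Scheme.{u}} (f : T ⟶ Spec A) {W : T.Opens} (hW : IsAffineOpen W) :
    hW.fromSpec ≫ f = Spec.map ((Scheme.ΓSpecIso A).inv ≫ f.appLE ⊤ W le_top) := by
  have h1 := (isAffineOpen_top (Spec A)).SpecMap_appLE_fromSpec f hW le_top
  rw [← h1, IsAffineOpen.fromSpec_top, Scheme.isoSpec_Spec_inv, ← Spec.map_comp]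

/-- The condition on affine open subsets in `BecomesCartier`, in terms of open immersions of affine
schemes. -/
lemma becomesCartier_iff {T : Scheme.{u}} (f : T ⟶ Spec A) :
    BecomesCartier I f ↔ ∀ t, IsCartierAt I f t := by
  constructor
  · intro h t
    obtain ⟨W, ht, hW, hI⟩ := h t
    refine ⟨Γ(T, W), hW.fromSpec, _, inferInstance, ?_, fromSpec_comp_eq f hW, hI⟩
    rw [hW.range_fromSpec]
    exact ht
  · intro h t
    obtain ⟨B, w, φ, hw, ht, hwf, hI⟩ := h t
    have hW := isAffineOpen_opensRange w
    refine ⟨w.opensRange, ht, hW, ?_⟩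
    let k : Spec Γ(T, w.opensRange) ≅ Spec B := IsOpenImmersion.isoOfRangeEq hW.fromSpec w
      hW.range_fromSpec
    have hk : k.hom ≫ w = hW.fromSpec := IsOpenImmersion.isoOfRangeEq_hom_fac _ _ _
    let θ : B ≅ Γ(T, w.opensRange) :=
      ⟨Spec.preimage k.hom, Spec.preimage k.inv,
        Spec.map_injective (by simp [Spec.map_comp, Spec.map_id]),
        Spec.map_injective (by simp [Spec.map_comp, Spec.map_id])⟩
    have key : φ ≫ θ.hom = (Scheme.ΓSpecIso A).inv ≫ f.appLE ⊤ w.opensRange le_top := by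
      apply Spec.map_injective
      rw [← fromSpec_comp_eq f hW, ← hk, Category.assoc, hwf, Spec.map_comp, Spec.map_preimage]
    rw [← key]
    exact map_span_nonZeroDivisors_of_ringEquiv θ.commRingCatIsoToRingEquiv hI

/-- In a ring where an ideal becomes generated by a nonzerodivisor, it is locally generated by the
image of one of its elements. -/
lemma exists_generator_of_map_eq_span {A B : Type*} [CommRing A] [CommRing B] {I : Ideal A}
    {φ : A →+* B} {b : B} (hb : b ∈ nonZeroDivisors B) (hI : I.map φ = Ideal.span {b})
    (q : PrimeSpectrum B) : ∃ r ∈ I, ∃ c, c ∉ q.asIdeal ∧ φ r = c * b := by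
  by_contra! H
  have h : I.map φ ≤ q.asIdeal * Ideal.span {b} := by
    refine Ideal.map_le_iff_le_comap.2 fun r hr => ?_
    obtain ⟨c, hc⟩ := Ideal.mem_span_singleton'.1 (hI ▸ Ideal.mem_map_of_mem φ hr)
    by_cases hcq : c ∈ q.asIdeal
    · rw [Ideal.mem_comap, ← hc]
      exact Ideal.mul_mem_mul hcq (Ideal.mem_span_singleton_self b)
    · exact absurd hc.symm (H r hr c hcq)
  have hb' : b ∈ q.asIdeal * Ideal.span {b} := h (hI ▸ Ideal.mem_span_singleton_self b)
  obtain ⟨z, hz, hzb⟩ := Ideal.mem_mul_span_singleton.1 hb'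
  have : (1 - z) * b = 0 := by linear_combination -hzb
  have h1 := (mem_nonZeroDivisors_iff_right.1 hb) _ this
  exact q.2.ne_top ((Ideal.eq_top_iff_one _).2 (by rwa [← sub_eq_zero.1 h1] at hz))

lemma mem_nonZeroDivisors_of_flat {A B : Type*} [CommRing A] [CommRing B] {φ : A →+* B}
    (hφ : φ.Flat) {b : A} (hb : b ∈ nonZeroDivisors A) : φ b ∈ nonZeroDivisors B := by
  algebraize [φ]
  refine mem_nonZeroDivisors_of_mul_eq_zero fun c hc => ?_
  have h1 : IsSMulRegular B b := Module.Flat.isSMulRegular_of_nonZeroDivisors hb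
  refine h1 ?_
  change b • c = b • (0 : B)
  rw [smul_zero, Algebra.smul_def, mul_comm]
  exact hc

/-- The Cartier property passes along flat morphisms. -/
lemma IsCartierAt.comp_flat {T T' : Scheme.{u}} (g : T' ⟶ T) [Flat g] {f : T ⟶ Spec A} {t : T'}
    (h : IsCartierAt I f (g t)) : IsCartierAt I (g ≫ f) t := by
  obtain ⟨B, w, φ, hw, ht, hwf, b, hb, hI⟩ := h
  obtain ⟨B', w', hw', ht', hle⟩ := Scheme.exists_affine_mem_range_and_range_subset
    (U := g ⁻¹ᵁ w.opensRange) (x := t) ht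
  have hr : Set.range (w' ≫ g) ⊆ Set.range w := by
    rintro _ ⟨x, rfl⟩
    exact hle ⟨x, rfl⟩
  let k := IsOpenImmersion.lift w (w' ≫ g) hr
  have hk : k ≫ w = w' ≫ g := IsOpenImmersion.lift_fac _ _ _
  have hkflat : Flat k := by
    have : Flat (k ≫ w) := by rw [hk]; infer_instance
    have sq : IsPullback (𝟙 _) k (k ≫ w) w := IsPullback.of_isLimit' ⟨by simp⟩
      (PullbackCone.IsLimit.mk _ (fun s => s.fst) (fun s => by simp)
        (fun s => by rw [← cancel_mono w, Category.assoc, s.condition])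
        (fun s m h _ => by simpa using h))
    exact MorphismProperty.of_isPullback (P := @Flat) sq this
  obtain ⟨ψ, hkψ⟩ : ∃ ψ, k = Spec.map ψ := ⟨_, (Spec.map_preimage k).symm⟩
  have hψ : ψ.hom.Flat := Flat.SpecMap_iff.1 (hkψ ▸ hkflat)
  refine ⟨B', w', φ ≫ ψ, hw', ht', ?_, ψ b, mem_nonZeroDivisors_of_flat hψ hb, ?_⟩
  · rw [← Category.assoc, ← hk, Category.assoc, hwf, Spec.map_comp, hkψ]
  · rw [CommRingCat.hom_comp, ← Ideal.map_map, hI, Ideal.map_span, Set.image_singleton]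

/-- At a point where the ideal is Cartier, it is generated by the image of one of its elements in
a neighbourhood. -/
lemma IsCartierAt.exists_generator {T : Scheme.{u}} {f : T ⟶ Spec A} {t : T}
    (h : IsCartierAt I f t) : ∃ (B : CommRingCat.{u}) (w : Spec B ⟶ T) (φ : A ⟶ B),
      IsOpenImmersion w ∧ t ∈ Set.range w ∧ w ≫ f = Spec.map φ ∧
        ∃ r ∈ I, φ r ∈ nonZeroDivisors B ∧ I.map φ.hom = Ideal.span {φ r} := by
  obtain ⟨B, w, φ, hw, ⟨q, rfl⟩, hwf, b, hb, hI⟩ := h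
  obtain ⟨r, hr, c, hc, hrc⟩ := exists_generator_of_map_eq_span hb hI q
  let B' := CommRingCat.of (Localization.Away c)
  let ψ : B ⟶ B' := CommRingCat.ofHom (algebraMap B (Localization.Away c))
  have hψ : IsOpenImmersion (Spec.map ψ) := inferInstanceAs
    (IsOpenImmersion (Spec.map (CommRingCat.ofHom (algebraMap B (Localization.Away c)))))
  have hflat : ψ.hom.Flat := RingHom.flat_algebraMap_iff.2 inferInstance
  have hunit : IsUnit (ψ c) := IsLocalization.Away.algebraMap_isUnit c
  have hφr : (φ ≫ ψ) r = ψ c * ψ b := by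
    rw [CommRingCat.comp_apply, ← map_mul]
    exact congrArg ψ hrc
  refine ⟨B', Spec.map ψ ≫ w, φ ≫ ψ, inferInstance, ?_, ?_, r, hr, ?_, ?_⟩
  · obtain ⟨y, hy⟩ : q ∈ Set.range (Spec.map ψ) := by
      have := PrimeSpectrum.localization_away_comap_range (Localization.Away c) c
      exact this.ge hc
    exact ⟨y, by rw [← hy]; rfl⟩
  · rw [Category.assoc, hwf, Spec.map_comp]
  · rw [hφr]
    exact mul_mem hunit.mem_nonZeroDivisors (mem_nonZeroDivisors_of_flat hflat hb)
  · rw [CommRingCat.hom_comp, ← Ideal.map_map, hI, Ideal.map_span, Set.image_singleton, hφr]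
    exact (Ideal.span_singleton_mul_left_unit hunit _).symm

/-- A morphism to the blow-up factors through the chart of `r` if the ideal becomes generated by the
nonzerodivisor `r`: at a point of the chart of `a` we have `a = y r` and `(r / a) a = r`, hence
`(r / a) y = 1`, so that the point lies in the chart of `r`. -/
lemma exists_eq_comp_blowUpChart {B : CommRingCat.{u}} {φ : A ⟶ B} {r : A} (hr : r ∈ I)
    (hB : φ r ∈ nonZeroDivisors B) (hI : I.map φ.hom = Ideal.span {φ r})
    (g : Spec B ⟶ blowUpScheme I) (hg : g ≫ blowUpHom I = Spec.map φ) :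
    ∃ k, g = k ≫ blowUpChart I r hr := by
  have hrange : Set.range g ⊆ Set.range (blowUpChart I r hr) := by
    rintro _ ⟨s, rfl⟩
    obtain ⟨a, ha, hs⟩ := exists_mem_range_blowUpChart I (g s)
    obtain ⟨B', w, hw, ⟨s', rfl⟩, hle⟩ := Scheme.exists_affine_mem_range_and_range_subset
      (U := g ⁻¹ᵁ (blowUpChart I a ha).opensRange) (x := s) hs
    have hr' : Set.range (w ≫ g) ⊆ Set.range (blowUpChart I a ha) := by
      rintro _ ⟨x, rfl⟩
      exact hle ⟨x, rfl⟩
    let k := IsOpenImmersion.lift (blowUpChart I a ha) (w ≫ g) hr'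
    have hk : k ≫ blowUpChart I a ha = w ≫ g := IsOpenImmersion.lift_fac _ _ _
    obtain ⟨χ, hχ⟩ : ∃ ψ, k = Spec.map ψ := ⟨_, (Spec.map_preimage k).symm⟩
    obtain ⟨ψ, rfl⟩ : ∃ ψ, w = Spec.map ψ := ⟨_, (Spec.map_preimage w).symm⟩
    have hflat : ψ.hom.Flat := Flat.SpecMap_iff.1 inferInstance
    have hcomp : CommRingCat.ofHom (toReesChart I a ha) ≫ χ = φ ≫ ψ := by
      apply Spec.map_injective
      rw [Spec.map_comp, Spec.map_comp, ← blowUpChart_blowUpHom, ← hχ, ← Category.assoc, hk,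
        Category.assoc, hg]
    have hcomp' : ∀ x, χ.hom (toReesChart I a ha x) = ψ.hom (φ.hom x) := fun x =>
      congrArg (fun h : A ⟶ B' => h.hom x) hcomp
    have hz := congrArg χ.hom (isLocalizationElem_mul I a ha r hr)
    obtain ⟨y, hy⟩ := Ideal.mem_span_singleton'.1 (hI ▸ Ideal.mem_map_of_mem φ.hom ha)
    rw [map_mul, hcomp', hcomp', ← hy, map_mul] at hz
    have hnz := mem_nonZeroDivisors_of_flat hflat hB
    have hunit : χ.hom (HomogeneousLocalization.Away.isLocalizationElem (reesVar_mem I a ha)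
        (reesVar_mem I r hr)) * ψ.hom y = 1 := by
      refine (mul_cancel_right_mem_nonZeroDivisors hnz).1 ?_
      rw [one_mul, mul_assoc]
      exact hz
    have hmem := blowUpChart_mem_range I a ha r hr (k s') (fun hmem => by
      rw [hχ] at hmem
      have h1 : χ.hom (HomogeneousLocalization.Away.isLocalizationElem (reesVar_mem I a ha)
        (reesVar_mem I r hr)) ∈ s'.asIdeal := hmem
      exact s'.2.ne_top ((Ideal.eq_top_iff_one _).2 (hunit ▸ Ideal.mul_mem_right _ _ h1)))
    have h2 : blowUpChart I a ha (k s') = g ((Spec.map ψ) s') :=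
      congrArg (fun h : Spec B' ⟶ blowUpScheme I => h s') hk
    rwa [h2] at hmem
  exact ⟨IsOpenImmersion.lift _ g hrange, (IsOpenImmersion.lift_fac _ _ _).symm⟩

lemma eq_of_comp_blowUpHom_eq_specMap {B : CommRingCat.{u}} {φ : A ⟶ B} {r : A} (hr : r ∈ I)
    (hB : φ r ∈ nonZeroDivisors B) (hI : I.map φ.hom = Ideal.span {φ r})
    (g g' : Spec B ⟶ blowUpScheme I) (hg : g ≫ blowUpHom I = Spec.map φ)
    (hg' : g' ≫ blowUpHom I = Spec.map φ) : g = g' := by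
  obtain ⟨k, rfl⟩ := exists_eq_comp_blowUpChart hr hB hI g hg
  obtain ⟨k', rfl⟩ := exists_eq_comp_blowUpChart hr hB hI g' hg'
  obtain ⟨χ, rfl⟩ : ∃ ψ, k = Spec.map ψ := ⟨_, (Spec.map_preimage k).symm⟩
  obtain ⟨χ', rfl⟩ : ∃ ψ, k' = Spec.map ψ := ⟨_, (Spec.map_preimage k').symm⟩
  rw [Category.assoc, blowUpChart_blowUpHom, ← Spec.map_comp] at hg hg'
  have h1 := Spec.map_injective hg
  have h2 := Spec.map_injective hg'
  have h1' : χ.hom.comp (toReesChart I r hr) = φ.hom := congrArg CommRingCat.Hom.hom h1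
  have h2' : χ'.hom.comp (toReesChart I r hr) = φ.hom := congrArg CommRingCat.Hom.hom h2
  have : χ = χ' := by
    ext1
    refine ReesChart.ringHom_ext I r hr (h1'.trans h2'.symm) ?_
    rwa [← RingHom.comp_apply, h1']
  rw [this]

/-- An open cover of a scheme given by an open immersion around each point. -/
def openCoverOfPoints (T : Scheme.{u}) (X : T → Scheme.{u}) (w : ∀ t, X t ⟶ T)
    (hw : ∀ t, IsOpenImmersion (w t)) (ht : ∀ t, t ∈ Set.range (w t)) : T.OpenCover where
  I₀ := T
  X := X
  f := w
  mem₀ := by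
    rw [Scheme.presieve₀_mem_precoverage_iff]
    exact ⟨fun x => ⟨x, ht x⟩, hw⟩

lemma eq_of_openCoverOfPoints {T Y : Scheme.{u}} {X : T → Scheme.{u}} (w : ∀ t, X t ⟶ T)
    (hw : ∀ t, IsOpenImmersion (w t)) (ht : ∀ t, t ∈ Set.range (w t)) (g g' : T ⟶ Y)
    (h : ∀ t, w t ≫ g = w t ≫ g') : g = g' :=
  (openCoverOfPoints T X w hw ht).hom_ext _ _ h

lemma exists_glue {T Y : Scheme.{u}} {X : T → Scheme.{u}} (w : ∀ t, X t ⟶ T)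
    (hw : ∀ t, IsOpenImmersion (w t)) (ht : ∀ t, t ∈ Set.range (w t)) (g : ∀ t, X t ⟶ Y)
    (h : ∀ s t, pullback.fst (w s) (w t) ≫ g s = pullback.snd (w s) (w t) ≫ g t) :
    ∃ G : T ⟶ Y, ∀ t, w t ≫ G = g t :=
  ⟨(openCoverOfPoints T X w hw ht).glueMorphisms g h,
    (openCoverOfPoints T X w hw ht).ι_glueMorphisms g h⟩

/-- Morphisms to the blow-up are determined by their composites to the base if the ideal becomes
Cartier. -/
lemma eq_of_comp_blowUpHom_eq {T : Scheme.{u}} {f : T ⟶ Spec A} (hf : ∀ t, IsCartierAt I f t)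
    (g g' : T ⟶ blowUpScheme I) (hg : g ≫ blowUpHom I = f) (hg' : g' ≫ blowUpHom I = f) :
    g = g' := by
  choose B w φ hw ht hwf r hr hB hI using fun t => (hf t).exists_generator
  refine eq_of_openCoverOfPoints w hw ht _ _ fun t => ?_
  refine eq_of_comp_blowUpHom_eq_specMap (hr t) (hB t) (hI t) _ _ ?_ ?_
  · rw [Category.assoc, hg]
    exact hwf t
  · rw [Category.assoc, hg']
    exact hwf t

/-- `Proj` of the Rees algebra is the blow-up. -/
lemma isSchemeBlowUp_blowUpHom (I : Ideal A) : IsSchemeBlowUp I (blowUpHom I) := by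
  refine ⟨(becomesCartier_iff _).2 fun t => ?_, fun T f hf => ?_⟩
  · obtain ⟨a, ha, ht⟩ := exists_mem_range_blowUpChart I t
    exact ⟨_, blowUpChart I a ha, _, inferInstance, ht, blowUpChart_blowUpHom I a ha, _,
      toReesChart_mem_nonZeroDivisors I a ha, map_toReesChart I a ha⟩
  · rw [becomesCartier_iff] at hf
    choose B w φ hw ht hwf r hr hB hI using fun t => (hf t).exists_generator
    have hlift : ∀ t, ∃ g : Spec (B t) ⟶ blowUpScheme I, g ≫ blowUpHom I = w t ≫ f := fun t => by
      obtain ⟨χ, hχ⟩ := ReesChart.exists_ringHom I (r t) (hr t) (φ t).hom (hB t) (hI t)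
      refine ⟨Spec.map (CommRingCat.ofHom χ) ≫ blowUpChart I (r t) (hr t), ?_⟩
      rw [Category.assoc, blowUpChart_blowUpHom, ← Spec.map_comp, ← CommRingCat.ofHom_comp, hχ,
        hwf]
      rfl
    choose g hg using hlift
    obtain ⟨G, hG⟩ := exists_glue w hw ht g fun s t => by
      refine eq_of_comp_blowUpHom_eq (f := pullback.fst (w s) (w t) ≫ w s ≫ f) (fun x => ?_)
        _ _ ?_ ?_
      · rw [← Category.assoc]
        exact (hf _).comp_flat _
      · rw [Category.assoc, hg]
      · rw [Category.assoc, hg, ← Category.assoc, ← pullback.condition, Category.assoc]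
    have hG' : G ≫ blowUpHom I = f := by
      refine eq_of_openCoverOfPoints w hw ht _ _ fun t => ?_
      rw [← Category.assoc, hG]
      exact hg t
    exact ⟨G, hG', fun G' hG'' => eq_of_comp_blowUpHom_eq hf _ _ hG'' hG'⟩

end BlowUpScheme

/-! ### Sheaves of sets on a stack and their categories of elements -/

section Elements

/-- A presheaf of sets on (the category underlying) a category over schemes. -/
structure PresheafOn (S : CatOverSch.{u}) where
  /-- The set of sections over an object. -/
  sec : S.obj → Type (u + 1)
  /-- The restriction maps. -/
  res : ∀ {x y : S.obj}, (x ⟶ y) → sec y → sec x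
  res_id : ∀ (x : S.obj) (s : sec x), res (𝟙 x) s = s
  res_comp : ∀ {x y z : S.obj} (f : x ⟶ y) (g : y ⟶ z) (s : sec z),
    res (f ≫ g) s = res f (res g s)

variable {S : CatOverSch.{u}}

/-- The sheaf condition for the étale topology. -/
def PresheafOn.IsSheaf (P : PresheafOn S) : Prop :=
  ∀ (x : S.obj) (R : Sieve (S.p.obj x)), R ∈ Scheme.etaleTopology (S.p.obj x) →
    ∀ s : ∀ (y : S.obj) (f : y ⟶ x), R (S.p.map f) → P.sec y,
      (∀ (z y : S.obj) (g : z ⟶ y) (f : y ⟶ x) (hf : R (S.p.map f)) (hgf : R (S.p.map (g ≫ f))),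
        s z (g ≫ f) hgf = P.res g (s y f hf)) →
      ∃! t : P.sec x, ∀ (y : S.obj) (f : y ⟶ x) (hf : R (S.p.map f)), P.res f t = s y f hf

lemma PresheafOn.IsSheaf.ext {P : PresheafOn S} (hP : P.IsSheaf) {x : S.obj}
    {R : Sieve (S.p.obj x)} (hR : R ∈ Scheme.etaleTopology (S.p.obj x)) {t t' : P.sec x}
    (h : ∀ (y : S.obj) (f : y ⟶ x), R (S.p.map f) → P.res f t = P.res f t') : t = t' :=
  (hP x R hR (fun _ f _ => P.res f t') fun _ _ g f _ _ => P.res_comp g f t').unique h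
    fun _ _ _ => rfl

/-- The objects of `S` together with a section of `P`. -/
structure ElementsObj (P : PresheafOn S) where
  /-- The object. -/
  pt : S.obj
  /-- The section. -/
  elt : P.sec pt

/-- The morphisms of `S` compatible with the sections of `P`. -/
@[ext]
structure ElementsHom {P : PresheafOn S} (a b : ElementsObj P) where
  /-- The morphism. -/
  hom : a.pt ⟶ b.pt
  res_elt : P.res hom b.elt = a.elt

instance (P : PresheafOn S) : Category (ElementsObj P) where
  Hom := ElementsHom
  id a := ⟨𝟙 _, P.res_id _ _⟩
  comp f g := ⟨f.hom ≫ g.hom, by rw [P.res_comp, g.res_elt, f.res_elt]⟩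
  id_comp f := ElementsHom.ext (Category.id_comp _)
  comp_id f := ElementsHom.ext (Category.comp_id _)
  assoc f g h := ElementsHom.ext (Category.assoc _ _ _)

/-- The functor forgetting the section. -/
def elementsForget (P : PresheafOn S) : ElementsObj P ⥤ S.obj where
  obj a := a.pt
  map f := ElementsHom.hom f
  map_id _ := rfl
  map_comp _ _ := rfl

/-- The category of elements of a presheaf on `S`, as a category over schemes. -/
def elements (P : PresheafOn S) : CatOverSch.{u} :=
  BasedCategory.ofFunctor (elementsForget P ⋙ S.p)

/-- The projection from the category of elements. -/
def elementsProj (P : PresheafOn S) : BasedFunctor (elements P) S where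
  toFunctor := elementsForget P
  w := rfl

variable {P : PresheafOn S}

/-- The object of the category of elements given by a section. -/
def elementsMk (x : S.obj) (s : P.sec x) : (elements P).obj := (⟨x, s⟩ : ElementsObj P)

/-- The section belonging to an object of the category of elements. -/
def elementsElt (a : (elements P).obj) : P.sec ((elementsProj P).obj a) := ElementsObj.elt a

/-- A morphism in the category of elements. -/
def elementsHom {a b : (elements P).obj} (f : (elementsProj P).obj a ⟶ (elementsProj P).obj b)
    (h : P.res f (elementsElt b) = elementsElt a) : a ⟶ b :=
  show ElementsHom a b from ⟨f, h⟩

lemma elementsHom_ext {a b : (elements P).obj} {f g : a ⟶ b}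
    (h : (elementsProj P).map f = (elementsProj P).map g) : f = g := ElementsHom.ext h

lemma res_elementsProj_map {a b : (elements P).obj} (f : a ⟶ b) :
    P.res ((elementsProj P).map f) (elementsElt b) = elementsElt a :=
  ElementsHom.res_elt f

lemma isFiberedInGroupoids_elements (hS : IsFiberedInGroupoids S) :
    IsFiberedInGroupoids (elements P) where
  exists_lift a T f := by
    change T ⟶ S.p.obj ((elementsProj P).obj a) at f
    obtain ⟨y, φ, h⟩ := hS.exists_lift ((elementsProj P).obj a) T f
    let φ' : elementsMk y (P.res φ (elementsElt a)) ⟶ a := elementsHom φ rfl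
    refine ⟨_, φ', ?_⟩
    obtain rfl := IsHomLift.domain_eq S.p f φ
    obtain rfl := IsHomLift.eq_of_isHomLift S.p f φ
    exact IsHomLift.map (elements P).p φ'
  cartesian {a b} φ := by
    refine { toIsHomLift := inferInstance, universal_property' := ?_ }
    intro c g ψ hψ
    have hψ' : (elements P).p.map ψ = g ≫ (elements P).p.map φ :=
      (IsHomLift.eq_of_isHomLift (elements P).p _ ψ).symm
    obtain ⟨χ, h1, h2⟩ := hS.exists_factor ((elementsProj P).map φ) ((elementsProj P).map ψ) g
      hψ'.symm
    have hχ : P.res χ (elementsElt a) = elementsElt c := by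
      rw [← res_elementsProj_map φ, ← P.res_comp, h2, res_elementsProj_map]
    let χ' : c ⟶ a := elementsHom χ hχ
    have hlift : (elements P).p.IsHomLift g χ' := by
      rw [← h1]
      exact IsHomLift.map (elements P).p χ'
    refine ⟨χ', ⟨hlift, elementsHom_ext h2⟩, ?_⟩
    rintro χ'' ⟨h3, h4⟩
    refine elementsHom_ext (hS.hom_ext ((elementsProj P).map φ) ?_ ?_)
    · have h5 := IsHomLift.eq_of_isHomLift (elements P).p g χ''
      exact h5.symm.trans h1.symm
    · exact (congrArg (fun k => (elementsProj P).map k) h4).trans h2.symm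

section OverCat

variable {T : Scheme.{u}} (F : BasedFunctor (overCat T) S)

/-- The value of a based functor on a `T`-scheme. -/
def overObj (U : Over T) : S.obj := F.obj U

/-- The value of a based functor on a morphism of `T`-schemes. -/
def overMap {U V : Over T} (g : U ⟶ V) : overObj F U ⟶ overObj F V := F.map g

lemma overMap_comp {U V W : Over T} (g : U ⟶ V) (h : V ⟶ W) :
    overMap F (g ≫ h) = overMap F g ≫ overMap F h := F.map_comp g h

lemma overMap_id (U : Over T) : overMap F (𝟙 U) = 𝟙 _ := F.map_id _

/-- The value of a based functor on a `T`-scheme lies over this scheme. -/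
def overIso (U : Over T) : S.p.obj (overObj F U) ≅ U.left := eqToIso (F.w_obj U)

lemma map_overMap {U V : Over T} (g : U ⟶ V) :
    S.p.map (overMap F g) = (overIso F U).hom ≫ g.left ≫ (overIso F V).inv :=
  Functor.congr_hom F.w g

/-- An arrow to a value of a based functor on `Sch/T` gives a `T`-scheme. -/
def overRestr (U : Over T) {y : S.obj} (f : y ⟶ overObj F U) : Over T :=
  Over.mk (S.p.map f ≫ (overIso F U).hom ≫ U.hom)

/-- The canonical morphism from the `T`-scheme given by an arrow. -/
def overRestrHom (U : Over T) {y : S.obj} (f : y ⟶ overObj F U) : overRestr F U f ⟶ U :=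
  Over.homMk (S.p.map f ≫ (overIso F U).hom) (Category.assoc _ _ _)

/-- The value of a based functor on the `T`-scheme given by an arrow lies over the source of the
arrow. -/
def overRestrIso (U : Over T) {y : S.obj} (f : y ⟶ overObj F U) :
    S.p.obj (overObj F (overRestr F U f)) ≅ S.p.obj y := overIso F (overRestr F U f)

lemma map_overMap_overRestrHom (U : Over T) {y : S.obj} (f : y ⟶ overObj F U) :
    S.p.map (overMap F (overRestrHom F U f)) = (overRestrIso F U f).hom ≫ S.p.map f := by
  rw [map_overMap]
  exact congrArg ((overRestrIso F U f).hom ≫ ·)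
    (show (S.p.map f ≫ (overIso F U).hom) ≫ (overIso F U).inv = S.p.map f by simp)

/-- Every arrow to a value of a functor from `Sch/T` comes from an arrow of `Sch/T`. -/
lemma exists_factor_overCat (hS : IsFiberedInGroupoids S) (U : Over T) {y : S.obj}
    (f : y ⟶ overObj F U) :
    ∃ h : y ⟶ overObj F (overRestr F U f), S.p.map h = (overRestrIso F U f).inv ∧
      h ≫ overMap F (overRestrHom F U f) = f :=
  hS.exists_factor _ _ _ (by rw [map_overMap_overRestrHom, Iso.inv_hom_id_assoc])

/-- The `T`-schemes given by arrows depend functorially on the arrow. -/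
def overRestrComp (U : Over T) {z y : S.obj} (g : z ⟶ y) (f : y ⟶ overObj F U) :
    overRestr F U (g ≫ f) ⟶ overRestr F U f :=
  Over.homMk (S.p.map g) (by simp [overRestr])

lemma overRestrComp_overRestrHom (U : Over T) {z y : S.obj} (g : z ⟶ y) (f : y ⟶ overObj F U) :
    overRestrComp F U g f ≫ overRestrHom F U f = overRestrHom F U (g ≫ f) := by
  ext1
  change S.p.map g ≫ S.p.map f ≫ (overIso F U).hom = S.p.map (g ≫ f) ≫ (overIso F U).hom
  rw [Functor.map_comp, Category.assoc]

lemma map_overMap_overRestrComp (U : Over T) {z y : S.obj} (g : z ⟶ y) (f : y ⟶ overObj F U) :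
    S.p.map (overMap F (overRestrComp F U g f)) =
      (overRestrIso F U (g ≫ f)).hom ≫ S.p.map g ≫ (overRestrIso F U f).inv :=
  map_overMap F _

/-- The `T`-scheme given by an arrow of `Sch/T`. -/
def overRestrOfMap {U V : Over T} (g : V ⟶ U) : V ⟶ overRestr F U (overMap F g) :=
  Over.homMk (overIso F V).inv (by
    change (overIso F V).inv ≫ S.p.map (overMap F g) ≫ (overIso F U).hom ≫ U.hom = V.hom
    simp [map_overMap])

lemma overRestrOfMap_overRestrHom {U V : Over T} (g : V ⟶ U) :
    overRestrOfMap F g ≫ overRestrHom F U (overMap F g) = g := by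
  ext1
  change (overIso F V).inv ≫ S.p.map (overMap F g) ≫ (overIso F U).hom = g.left
  simp [map_overMap]

lemma map_overMap_overRestrOfMap {U V : Over T} (g : V ⟶ U) :
    S.p.map (overMap F (overRestrOfMap F g)) = (overRestrIso F U (overMap F g)).inv := by
  refine (map_overMap F _).trans ?_
  exact Iso.hom_inv_id_assoc (overIso F V) _

end OverCat

section Descent

variable {T : Scheme.{u}} {R : Sieve T}

/-- An object of a sieve. -/
def sieveObj (U : Over T) (hU : R U.hom) : (sieveCat R).obj :=
  (⟨U, hU⟩ : ObjectProperty.FullSubcategory fun f : Over T => R.arrows f.hom)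

/-- A morphism between objects of a sieve. -/
def sieveHom {U V : Over T} {hU : R U.hom} {hV : R V.hom} (g : U ⟶ V) :
    sieveObj U hU ⟶ sieveObj V hV :=
  ObjectProperty.homMk g

lemma pullback_overIso_mem (hR : R ∈ Scheme.etaleTopology T) (F : BasedFunctor (overCat T) S)
    (U : Over T) : R.pullback ((overIso F U).hom ≫ U.hom) ∈
      Scheme.etaleTopology (S.p.obj (overObj F U)) :=
  Scheme.etaleTopology.pullback_stable _ hR

lemma precomp_faithful (hS : (Bicategory.precomp (B := CatOverSch.{u}) (a := sieveCat R)
      (b := overCat T) S (sieveIncl R)).Faithful) :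
    (Bicategory.precomp (B := CatOverSch.{u}) (a := sieveCat R)
      (b := overCat T) (elements P) (sieveIncl R)).Faithful where
  map_injective {F G α β} h := by
    have h' : BasedCategory.whiskerRight α (elementsProj P) =
        BasedCategory.whiskerRight β (elementsProj P) := by
      apply hS.map_injective
      exact congrArg (fun γ => BasedCategory.whiskerRight γ (elementsProj P)) h
    apply BasedNatTrans.ext
    ext U
    apply elementsHom_ext
    exact congrArg (fun γ => BasedNatTrans.toNatTrans γ |>.app U) h'

/-- A transformation over `S` respects the sections, since it does so locally. -/
lemma precomp_full (hP : P.IsSheaf) (hf : IsFiberedInGroupoids S)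
    (hR : R ∈ Scheme.etaleTopology T)
    (hS : (Bicategory.precomp (B := CatOverSch.{u}) (a := sieveCat R)
      (b := overCat T) S (sieveIncl R)).Full) :
    (Bicategory.precomp (B := CatOverSch.{u}) (a := sieveCat R)
      (b := overCat T) (elements P) (sieveIncl R)).Full where
  map_surjective {F G} γ := by
    change BasedFunctor (overCat T) (elements P) at F G
    change BasedNatTrans ((sieveIncl R).comp F) ((sieveIncl R).comp G) at γ
    let F' := F.comp (elementsProj P)
    let G' := G.comp (elementsProj P)
    obtain ⟨δ, hδ⟩ := hS.map_surjective (X := F') (Y := G')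
      (BasedCategory.whiskerRight γ (elementsProj P))
    change BasedNatTrans F' G' at δ
    let d : ∀ U : Over T, overObj F' U ⟶ overObj G' U := fun U => δ.app U
    have hd : ∀ {U V : Over T} (g : U ⟶ V), overMap F' g ≫ d V = d U ≫ overMap G' g :=
      fun g => δ.naturality g
    let sF : ∀ U : Over T, P.sec (overObj F' U) := fun U => elementsElt (F.obj U)
    let sG : ∀ U : Over T, P.sec (overObj G' U) := fun U => elementsElt (G.obj U)
    have hsF : ∀ {U V : Over T} (g : U ⟶ V), P.res (overMap F' g) (sF V) = sF U :=
      fun g => res_elementsProj_map (F.map g)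
    have hsG : ∀ {U V : Over T} (g : U ⟶ V), P.res (overMap G' g) (sG V) = sG U :=
      fun g => res_elementsProj_map (G.map g)
    have hdR : ∀ U : Over T, R U.hom → P.res (d U) (sG U) = sF U := fun U hU => by
      have h1 : d U = (elementsProj P).map (γ.app (sieveObj U hU)) :=
        congrArg (fun γ => BasedNatTrans.toNatTrans γ |>.app (sieveObj U hU)) hδ
      rw [h1]
      exact res_elementsProj_map (γ.app (sieveObj U hU))
    have key : ∀ U : Over T, P.res (d U) (sG U) = sF U := fun U => by
      refine hP.ext (pullback_overIso_mem hR F' U) fun y f hy => ?_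
      obtain ⟨h, h1, h2⟩ := exists_factor_overCat F' hf U f
      rw [← h2, P.res_comp, P.res_comp, ← P.res_comp (overMap F' _) (d U), hd, P.res_comp, hsG, hsF,
        hdR (overRestr F' U f) hy]
    let α : BasedNatTrans F G :=
      { app := fun U => elementsHom (d U) (key U)
        naturality := fun U V g => elementsHom_ext (δ.naturality g)
        isHomLift' := fun U => by
          have h1 := δ.isHomLift' U
          exact (BasedFunctor.isHomLift_iff (elementsProj P) _
            (elementsHom (a := F.obj U) (b := G.obj U) (d U) (key U))).1 h1 }
    refine ⟨α, BasedNatTrans.ext _ _ ?_⟩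
    ext U
    exact elementsHom_ext (congrArg (fun γ => BasedNatTrans.toNatTrans γ |>.app U) hδ)

lemma precomp_essSurj (hP : P.IsSheaf) (hf : IsFiberedInGroupoids S)
    (hR : R ∈ Scheme.etaleTopology T)
    (hS : (Bicategory.precomp (B := CatOverSch.{u}) (a := sieveCat R)
      (b := overCat T) S (sieveIncl R)).EssSurj) :
    (Bicategory.precomp (B := CatOverSch.{u}) (a := sieveCat R)
      (b := overCat T) (elements P) (sieveIncl R)).EssSurj where
  mem_essImage D := by
    change BasedFunctor (sieveCat R) (elements P) at D
    obtain ⟨E, ⟨ε⟩⟩ := hS.mem_essImage (D.comp (elementsProj P))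
    change BasedFunctor (overCat T) S at E
    let e : ∀ (U : Over T) (hU : R U.hom), overObj E U ⟶ (elementsProj P).obj
      (D.obj (sieveObj U hU)) := fun U hU => (BasedNatTrans.toNatTrans ε.hom).app (sieveObj U hU)
    let e' : ∀ (U : Over T) (hU : R U.hom), (elementsProj P).obj
      (D.obj (sieveObj U hU)) ⟶ overObj E U := fun U hU =>
        (BasedNatTrans.toNatTrans ε.inv).app (sieveObj U hU)
    have hee' : ∀ U hU, e U hU ≫ e' U hU = 𝟙 _ := fun U hU =>
      congrArg (fun γ => BasedNatTrans.toNatTrans γ |>.app (sieveObj U hU)) ε.hom_inv_id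
    have he'e : ∀ U hU, e' U hU ≫ e U hU = 𝟙 _ := fun U hU =>
      congrArg (fun γ => BasedNatTrans.toNatTrans γ |>.app (sieveObj U hU)) ε.inv_hom_id
    have he : ∀ {U V : Over T} (hU : R U.hom) (hV : R V.hom) (g : U ⟶ V),
        overMap E g ≫ e V hV = e U hU ≫ (elementsProj P).map (D.map (sieveHom g)) :=
      fun hU hV g => (BasedNatTrans.toNatTrans ε.hom).naturality (sieveHom (hU := hU) (hV := hV) g)
    -- the sections belonging to the descent datum, which glue over every `T`-scheme
    let s : ∀ (U : Over T) (hU : R U.hom), P.sec (overObj E U) := fun U hU =>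
      P.res (e U hU) (elementsElt (D.obj (sieveObj U hU)))
    have hs : ∀ {U V : Over T} (hU : R U.hom) (hV : R V.hom) (g : U ⟶ V),
        P.res (overMap E g) (s V hV) = s U hU := fun {U V} hU hV g => by
      change P.res _ (P.res _ _) = P.res _ _
      rw [← P.res_comp, he hU hV g, P.res_comp, res_elementsProj_map]
    have ht : ∀ U : Over T, ∃! t : P.sec (overObj E U), ∀ (V : Over T) (hV : R V.hom) (g : V ⟶ U),
        P.res (overMap E g) t = s V hV := fun U => by
      choose l hl hl' using fun (y : S.obj) (f : y ⟶ overObj E U) => exists_factor_overCat E hf U f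
      obtain ⟨t, ht, ht'⟩ := hP _ _ (pullback_overIso_mem hR E U)
        (fun y f hy => P.res (l y f) (s (overRestr E U f) hy)) fun z y g f hy hz => by
          have h1 : l z (g ≫ f) ≫ overMap E (overRestrComp E U g f) = g ≫ l y f := by
            refine hf.hom_ext (overMap E (overRestrHom E U f)) ?_ ?_
            · rw [Functor.map_comp, Functor.map_comp, hl, hl, map_overMap_overRestrComp,
                Iso.inv_hom_id_assoc]
            · rw [Category.assoc, Category.assoc, hl', ← overMap_comp, overRestrComp_overRestrHom,
                hl']
          rw [← hs (U := overRestr E U (g ≫ f)) (V := overRestr E U f) hz hy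
            (overRestrComp E U g f), ← P.res_comp, h1, P.res_comp]
      refine ⟨t, fun V hV g => ?_, fun t' h => ?_⟩
      · have hV' : R (overRestr E U (overMap E g)).hom := by
          change R (S.p.map (overMap E g) ≫ (overIso E U).hom ≫ U.hom)
          have : S.p.map (overMap E g) ≫ (overIso E U).hom ≫ U.hom = (overIso E V).hom ≫ V.hom := by
            simp [map_overMap]
          rw [this]
          exact R.downward_closed hV _
        have h1 : l _ (overMap E g) = overMap E (overRestrOfMap E g) := by
          refine hf.hom_ext (overMap E (overRestrHom E U (overMap E g))) ?_ ?_
          · rw [hl, map_overMap_overRestrOfMap]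
          · rw [hl', ← overMap_comp, overRestrOfMap_overRestrHom]
        rw [ht _ _ hV', h1, hs]
      · refine ht' t' fun y f hy => ?_
        rw [← h (overRestr E U f) hy (overRestrHom E U f), ← P.res_comp, hl']
    choose t ht ht' using ht
    have htg : ∀ {U V : Over T} (g : U ⟶ V), P.res (overMap E g) (t V) = t U := fun g =>
      ht' _ _ fun W hW k => by rw [← P.res_comp, ← overMap_comp, ht]
    have hte : ∀ U (hU : R U.hom), t U = P.res (e U hU) (elementsElt (D.obj (sieveObj U hU))) :=
      fun U hU => by
        have h1 := ht U U hU (𝟙 U)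
        rwa [overMap_id, P.res_id] at h1
    have hte' : ∀ U (hU : R U.hom), P.res (e' U hU) (t U) = elementsElt (D.obj (sieveObj U hU)) :=
      fun U hU => by rw [hte U hU, ← P.res_comp, he'e, P.res_id]
    let E' : BasedFunctor (overCat T) (elements P) :=
      { obj := fun U => elementsMk (overObj E U) (t U)
        map := fun {U V} g => elementsHom (a := elementsMk (overObj E U) (t U))
          (b := elementsMk (overObj E V) (t V)) (overMap E g) (htg g)
        map_id := fun U => elementsHom_ext (overMap_id E U)
        map_comp := fun g h => elementsHom_ext (overMap_comp E g h)
        w := E.w }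
    have hhom : ∀ U : (sieveCat R).obj, (elements P).p.IsHomLift (𝟙 ((sieveCat R).p.obj U))
        (elementsHom (a := E'.obj ((sieveIncl R).obj U)) (b := D.obj U) (e U.1 U.2)
          (hte U.1 U.2).symm) := fun U => by
      have h1 := ε.hom.isHomLift' U
      exact (BasedFunctor.isHomLift_iff (elementsProj P) _ _).1 h1
    refine ⟨E', ⟨BasedNatIso.mkNatIso (F := (sieveIncl R).comp E') (G := D)
      (NatIso.ofComponents (fun U =>
        { hom := elementsHom (a := E'.obj ((sieveIncl R).obj U)) (b := D.obj U) (e U.1 U.2)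
            (hte U.1 U.2).symm
          inv := elementsHom (a := D.obj U) (b := E'.obj ((sieveIncl R).obj U)) (e' U.1 U.2)
            (hte' U.1 U.2)
          hom_inv_id := elementsHom_ext (hee' U.1 U.2)
          inv_hom_id := elementsHom_ext (he'e U.1 U.2) }) fun {U V} g =>
            elementsHom_ext ((BasedNatTrans.toNatTrans ε.hom).naturality g)) hhom⟩⟩

/-- The category of elements of a sheaf on a stack is a stack. -/
lemma isStack_elements (hS : IsStack S) (hP : P.IsSheaf) : IsStack (elements P) where
  toIsFiberedInGroupoids := isFiberedInGroupoids_elements hS.toIsFiberedInGroupoids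
  descent T R hR := by
    have h := hS.descent T R hR
    exact { faithful := precomp_faithful h.faithful
            full := precomp_full hP hS.toIsFiberedInGroupoids hR h.full
            essSurj := precomp_essSurj hP hS.toIsFiberedInGroupoids hR h.essSurj }

end Descent

end Elements

/-! ### Gluing morphisms of schemes along étale coverings -/

section Glue

variable {S : CatOverSch.{u}}

/-- Representable presheaves are sheaves for the étale topology, in terms of the arrows of a
category fibered in groupoids. -/
lemma exists_unique_glue (hS : IsFiberedInGroupoids S) {y : S.obj} {Q : Sieve (S.p.obj y)}
    (hQ : Q ∈ Scheme.etaleTopology (S.p.obj y)) {X : Scheme.{u}}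
    (τ : ∀ (z : S.obj) (h : z ⟶ y), Q (S.p.map h) → (S.p.obj z ⟶ X))
    (hτ : ∀ (z' z : S.obj) (g : z' ⟶ z) (h : z ⟶ y) (hh : Q (S.p.map h))
      (hgh : Q (S.p.map (g ≫ h))), τ z' (g ≫ h) hgh = S.p.map g ≫ τ z h hh) :
    ∃! G : S.p.obj y ⟶ X, ∀ (z : S.obj) (h : z ⟶ y) (hh : Q (S.p.map h)),
      S.p.map h ≫ G = τ z h hh := by
  have hsub : Scheme.etaleTopology.{u}.Subcanonical :=
    .of_le Scheme.etaleTopology_le_proetaleTopology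
  have hsheaf : Presieve.IsSheafFor (yoneda.obj X) Q.arrows :=
    GrothendieckTopology.Subcanonical.isSheaf_of_isRepresentable (J := Scheme.etaleTopology)
      (yoneda.obj X) Q hQ
  choose z φ e he using fun (V : Scheme.{u}) (q : V ⟶ S.p.obj y) => hS.exists_lift_iso y q
  have hmem : ∀ (V : Scheme.{u}) (q : V ⟶ S.p.obj y), Q q → Q (S.p.map (φ V q)) := fun V q hq => by
    have : S.p.map (φ V q) = (e V q).inv ≫ q := (Iso.eq_inv_comp _).2 (he V q)
    rw [this]
    exact Q.downward_closed hq _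
  let x : Presieve.FamilyOfElements (yoneda.obj X) Q.arrows := fun V q hq =>
    (e V q).hom ≫ τ (z V q) (φ V q) (hmem V q hq)
  have hx : ∀ (w : S.obj) (h : w ⟶ y) (hh : Q (S.p.map h)), x (S.p.map h) hh = τ w h hh := by
    intro w h hh
    obtain ⟨χ, h1, h2⟩ := hS.exists_factor (φ _ (S.p.map h)) h (e _ (S.p.map h)).hom (he _ _)
    have h3 : Q (S.p.map (χ ≫ φ _ (S.p.map h))) := by rw [h2]; exact hh
    have h4 := hτ _ _ χ (φ _ (S.p.map h)) (hmem _ _ hh) h3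
    rw [h1] at h4
    change (e _ (S.p.map h)).hom ≫ _ = _
    rw [← h4]
    congr 1
  have hcompat : x.Compatible := by
    rw [Presieve.compatible_iff_sieveCompatible]
    intro V W q g hq
    obtain ⟨χ, h1, h2⟩ := hS.exists_factor (φ V q) (φ W (g ≫ q))
      ((e W (g ≫ q)).inv ≫ g ≫ (e V q).hom) (by
        rw [Category.assoc, Category.assoc, he]
        exact ((Iso.eq_inv_comp _).2 (he W (g ≫ q))).symm)
    have h3 : Q (S.p.map (χ ≫ φ V q)) := by
      rw [h2]; exact hmem _ _ (Q.downward_closed hq g)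
    have h4 := hτ _ _ χ (φ V q) (hmem V q hq) h3
    have h5 : τ _ (φ W (g ≫ q)) (hmem _ _ (Q.downward_closed hq g)) = τ _ (χ ≫ φ V q) h3 := by
      congr 1; exact h2.symm
    change (e W (g ≫ q)).hom ≫ τ _ (φ W (g ≫ q)) _ = g ≫ (e V q).hom ≫ _
    rw [h5, h4, h1]
    simp
  obtain ⟨G, hG, hG'⟩ := hsheaf x hcompat
  refine ⟨G, fun w h hh => (hG _ hh).trans (hx w h hh), fun G' h => hG' G' fun V q hq => ?_⟩
  change q ≫ G' = (e V q).hom ≫ _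
  rw [← h _ _ (hmem V q hq), ← Category.assoc, he]

/-- The sieve generated by an étale surjective arrow. -/
def etaleSieve {t y : S.obj} (r : t ⟶ y) : Sieve (S.p.obj y) :=
  Sieve.generate (Presieve.singleton (S.p.map r))

lemma etaleSieve_mem {t y : S.obj} (r : t ⟶ y) (h : Etale (S.p.map r))
    (h' : Surjective (S.p.map r)) : etaleSieve r ∈ Scheme.etaleTopology (S.p.obj y) := by
  refine Precoverage.generate_mem_toGrothendieck ?_
  exact (Scheme.singleton_mem_precoverage_iff _ (S.p.map r)).2 ⟨h'.surj, h⟩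

lemma exists_of_etaleSieve (hS : IsFiberedInGroupoids S) {t y z : S.obj} {r : t ⟶ y} {h : z ⟶ y}
    (hh : etaleSieve r (S.p.map h)) : ∃ j : z ⟶ t, j ≫ r = h := by
  obtain ⟨W, g, _, ⟨⟩, hg⟩ := hh
  obtain ⟨j, -, hj⟩ := hS.exists_factor r h g hg
  exact ⟨j, hj⟩

lemma eq_of_etale_surjective (hS : IsFiberedInGroupoids S) {t y : S.obj} (r : t ⟶ y)
    (h : Etale (S.p.map r)) (h' : Surjective (S.p.map r)) {X : Scheme.{u}}
    {G G' : S.p.obj y ⟶ X} (e : S.p.map r ≫ G = S.p.map r ≫ G') : G = G' := by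
  refine (exists_unique_glue hS (etaleSieve_mem r h h') (fun z h _ => S.p.map h ≫ G')
    (fun _ _ g h _ _ => by rw [Functor.map_comp, Category.assoc])).unique (fun z k hk => ?_)
    fun _ _ _ => rfl
  obtain ⟨j, rfl⟩ := exists_of_etaleSieve hS hk
  rw [Functor.map_comp, Category.assoc, e, Category.assoc]

lemma exists_glue_of_etale_surjective (hS : IsFiberedInGroupoids S) {t y : S.obj} (r : t ⟶ y)
    (h : Etale (S.p.map r)) (h' : Surjective (S.p.map r)) {X : Scheme.{u}} (τ : S.p.obj t ⟶ X)
    (hτ : ∀ (z : S.obj) (j j' : z ⟶ t), j ≫ r = j' ≫ r → S.p.map j ≫ τ = S.p.map j' ≫ τ) :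
    ∃ G : S.p.obj y ⟶ X, S.p.map r ≫ G = τ := by
  choose j hj using fun (z : S.obj) (k : z ⟶ y) (hk : etaleSieve r (S.p.map k)) =>
    exists_of_etaleSieve hS hk
  obtain ⟨G, hG, -⟩ := exists_unique_glue hS (etaleSieve_mem r h h')
    (fun z k hk => S.p.map (j z k hk) ≫ τ) (fun z' z g k hk hgk => by
      rw [← Category.assoc, ← Functor.map_comp]
      exact hτ _ _ _ (by rw [hj, Category.assoc, hj]))
  have hr : etaleSieve r (S.p.map r) := Sieve.le_generate _ _ _ ⟨⟩
  refine ⟨G, (hG t r hr).trans ?_⟩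
  rw [hτ _ (j t r hr) (𝟙 t) (by rw [hj, Category.id_comp]),
    CategoryTheory.Functor.map_id, Category.id_comp]

end Glue

/-! ### Objects over which the center becomes a Cartier divisor -/

section Cartier

variable {S : CatOverSch.{u}} (Z : ClosedSubstack S)

/-- The inverse image of `Z` in the object `v` is an effective Cartier divisor. -/
def IsCartierObj (v : S.obj) : Prop :=
  ∀ t : S.p.obj v, ∃ (c : AffineChart S) (m : c.obj ⟶ v), IsOpenImmersion (S.p.map m) ∧
    t ∈ Set.range (S.p.map m) ∧ ∃ a ∈ nonZeroDivisors c.ring, Z.ideal c = Ideal.span {a}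

/-- The morphism of schemes to the spectrum given by an arrow to a chart. -/
def toSpec (d : AffineChart S) {y : S.obj} (k : y ⟶ d.obj) : S.p.obj y ⟶ Spec d.ring :=
  S.p.map k ≫ d.iso.inv

lemma toSpec_comp (d : AffineChart S) {z y : S.obj} (g : z ⟶ y) (k : y ⟶ d.obj) :
    toSpec d (g ≫ k) = S.p.map g ≫ toSpec d k := by
  rw [toSpec, toSpec, Functor.map_comp, Category.assoc]

variable {Z}

lemma IsCartierObj.isCartierAt {v : S.obj} (hv : IsCartierObj Z v) (d : AffineChart S)
    (k : v ⟶ d.obj) (t : S.p.obj v) : IsCartierAt (Z.ideal d) (toSpec d k) t := by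
  obtain ⟨c, m, hm, ht, a, ha, hI⟩ := hv t
  let f : c ⟶ d := AffineChart.mkHom (m ≫ k)
  refine ⟨c.ring, c.iso.hom ≫ S.p.map m, CommRingCat.ofHom (AffineChart.ringMap f), inferInstance,
    ?_, ?_, a, ha, ?_⟩
  · obtain ⟨s, rfl⟩ := ht
    refine ⟨c.iso.inv s, ?_⟩
    have : c.iso.inv ≫ c.iso.hom ≫ S.p.map m = S.p.map m := Iso.inv_hom_id_assoc _ _
    exact congrArg (fun φ => φ s) this
  · have := AffineChart.hom_comm f
    rw [AffineChart.homOf_mkHom] at this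
    rw [← cancel_mono d.iso.hom, this, toSpec]
    simp
  · rw [← hI, ← Z.map_eq f]
    rfl

lemma exists_chart_of_isCartierAt (hS : IsFiberedInGroupoids S) {v : S.obj} (d : AffineChart S)
    (k : v ⟶ d.obj) {t : S.p.obj v} (h : IsCartierAt (Z.ideal d) (toSpec d k) t) :
    ∃ (c : AffineChart S) (m : c.obj ⟶ v), IsOpenImmersion (S.p.map m) ∧
      t ∈ Set.range (S.p.map m) ∧ ∃ a ∈ nonZeroDivisors c.ring, Z.ideal c = Ideal.span {a} := by
  obtain ⟨B, w, φ, hw, ht, hwf, a, ha, hI⟩ := h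
  obtain ⟨x, m, e, he⟩ := hS.exists_lift_iso v w
  have hm : S.p.map m = e.inv ≫ w := by rw [← he, Iso.inv_hom_id_assoc]
  let c : AffineChart S := ⟨x, B, e⟩
  let f : c ⟶ d := AffineChart.mkHom (m ≫ k)
  have hf : AffineChart.ringMap f = φ.hom := by
    have h1 := AffineChart.hom_comm f
    rw [AffineChart.homOf_mkHom] at h1
    have h2 : CommRingCat.ofHom (AffineChart.ringMap f) = φ := by
      apply Spec.map_injective
      rw [← cancel_mono d.iso.hom, h1, ← hwf, toSpec, Functor.map_comp, hm]
      simp [c]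
    rw [← h2]
    rfl
  refine ⟨c, m, ?_, ?_, a, ha, ?_⟩
  · rw [hm]
    infer_instance
  · obtain ⟨s, rfl⟩ := ht
    exact ⟨e.hom s, congrArg (fun φ => φ s) he⟩
  · rw [← Z.map_eq f, hf]
    exact hI

lemma isCartierObj_of_isCartierAt (hS : IsFiberedInGroupoids S) {v : S.obj} (d : AffineChart S)
    (k : v ⟶ d.obj) (h : ∀ t, IsCartierAt (Z.ideal d) (toSpec d k) t) : IsCartierObj Z v :=
  fun t => exists_chart_of_isCartierAt hS d k (h t)

lemma IsCartierObj.of_flat (hS : IsFiberedInGroupoids S) {v v' : S.obj} (hv : IsCartierObj Z v)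
    (f : v' ⟶ v) (hf : Flat (S.p.map f)) : IsCartierObj Z v' := by
  intro t
  obtain ⟨c, m, hm, ⟨s, hs⟩, a, ha, hI⟩ := hv (S.p.map f t)
  obtain ⟨w, l, r, hlr, hpb⟩ := hS.exists_pullback m f
  have hl : Flat (S.p.map l) := MorphismProperty.of_isPullback hpb.flip hf
  have hr : IsOpenImmersion (S.p.map r) := MorphismProperty.of_isPullback hpb hm
  obtain ⟨q, hq, hq'⟩ : ∃ q, S.p.map l q = s ∧ S.p.map r q = t := by
    obtain ⟨q, hq, hq'⟩ := Scheme.Pullback.exists_preimage_pullback s t hs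
    refine ⟨hpb.isoPullback.inv q, ?_, ?_⟩
    · rw [← hq]
      exact congrArg (fun φ => φ q) hpb.isoPullback_inv_fst
    · rw [← hq']
      exact congrArg (fun φ => φ q) hpb.isoPullback_inv_snd
  have hat : IsCartierAt (Z.ideal c) (toSpec c l) q := by
    refine IsCartierAt.comp_flat (S.p.map l) ⟨c.ring, c.iso.hom, 𝟙 _, inferInstance, ?_, ?_,
      a, ha, ?_⟩
    · exact ⟨c.iso.inv (S.p.map l q), congrArg (fun φ => φ (S.p.map l q)) c.iso.inv_hom_id⟩
    · simp
    · rw [← hI]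
      exact Ideal.map_id _
  obtain ⟨e, n, hn, ⟨p, hp⟩, h⟩ := exists_chart_of_isCartierAt hS c l hat
  refine ⟨e, n ≫ r, by rw [Functor.map_comp]; infer_instance, ⟨p, ?_⟩, h⟩
  rw [Functor.map_comp, ← hq', ← hp]
  rfl

lemma IsCartierObj.exists_lift {v : S.obj} (hv : IsCartierObj Z v) (d : AffineChart S)
    (k : v ⟶ d.obj) : ∃ β : S.p.obj v ⟶ blowUpScheme (Z.ideal d),
      β ≫ blowUpHom (Z.ideal d) = toSpec d k :=
  ((isSchemeBlowUp_blowUpHom (Z.ideal d)).2 _ _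
    ((becomesCartier_iff _).2 (hv.isCartierAt d k))).exists

lemma IsCartierObj.lift_unique {v : S.obj} (hv : IsCartierObj Z v) {d : AffineChart S}
    {k : v ⟶ d.obj} {β β' : S.p.obj v ⟶ blowUpScheme (Z.ideal d)}
    (h : β ≫ blowUpHom (Z.ideal d) = toSpec d k) (h' : β' ≫ blowUpHom (Z.ideal d) = toSpec d k) :
    β = β' :=
  eq_of_comp_blowUpHom_eq (hv.isCartierAt d k) _ _ h h'

end Cartier

/-! ### The sheaf of points of the blow-up -/

section Points

variable {S : CatOverSch.{u}}

lemma hom_ext_of_mem (hS : IsFiberedInGroupoids S) {y : S.obj} {Q : Sieve (S.p.obj y)}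
    (hQ : Q ∈ Scheme.etaleTopology (S.p.obj y)) {X : Scheme.{u}} {G G' : S.p.obj y ⟶ X}
    (h : ∀ (z : S.obj) (h : z ⟶ y), Q (S.p.map h) → S.p.map h ≫ G = S.p.map h ≫ G') : G = G' :=
  (exists_unique_glue hS hQ (fun _ h _ => S.p.map h ≫ G')
    (fun _ _ g h _ _ => by rw [Functor.map_comp, Category.assoc])).unique h fun _ _ _ => rfl

variable (Z : ClosedSubstack S)

/-- A point of the blow-up over the object `x`: for every smooth chart `d`, a lift of the projection
`x ×_S d → d` to the blow-up of `d` (described on the objects `y` mapping to `x` and `d`).  The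
lifts for different charts have to agree; since the lifts of an object `v` over which `Z` is Cartier
are unique, it is enough to ask this for those `y` for which the lift factors through such a `v`,
which is the case locally on the blow-up. -/
@[ext]
structure BlowUpPoint (x : S.obj) where
  /-- The lift to the blow-up of a chart. -/
  lift : ∀ {y : S.obj} (_ : y ⟶ x) (d : AffineChart S) (_ : IsSmoothOver S d.obj) (_ : y ⟶ d.obj),
    S.p.obj y ⟶ blowUpScheme (Z.ideal d)
  lift_blowUpHom : ∀ {y : S.obj} (f : y ⟶ x) (d : AffineChart S) (hd : IsSmoothOver S d.obj)
    (k : y ⟶ d.obj), lift f d hd k ≫ blowUpHom (Z.ideal d) = toSpec d k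
  lift_comp : ∀ {z y : S.obj} (g : z ⟶ y) (f : y ⟶ x) (d : AffineChart S)
    (hd : IsSmoothOver S d.obj) (k : y ⟶ d.obj),
    lift (g ≫ f) d hd (g ≫ k) = S.p.map g ≫ lift f d hd k
  lift_eq_of_isCartierObj : ∀ {y v : S.obj} (f : y ⟶ x) (j : y ⟶ v) (_ : IsCartierObj Z v)
    (d d' : AffineChart S) (hd : IsSmoothOver S d.obj) (hd' : IsSmoothOver S d'.obj)
    (a : v ⟶ d.obj) (b : v ⟶ d'.obj) (α : S.p.obj v ⟶ blowUpScheme (Z.ideal d))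
    (β : S.p.obj v ⟶ blowUpScheme (Z.ideal d')), α ≫ blowUpHom (Z.ideal d) = toSpec d a →
    β ≫ blowUpHom (Z.ideal d') = toSpec d' b → lift f d hd (j ≫ a) = S.p.map j ≫ α →
    lift f d' hd' (j ≫ b) = S.p.map j ≫ β

/-- The presheaf of points of the blow-up. -/
def blowUpPoints : PresheafOn S where
  sec x := BlowUpPoint Z x
  res m s :=
    { lift := fun f d hd k => s.lift (f ≫ m) d hd k
      lift_blowUpHom := fun f d hd k => s.lift_blowUpHom (f ≫ m) d hd k
      lift_comp := fun g f d hd k => by rw [Category.assoc, s.lift_comp]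
      lift_eq_of_isCartierObj := fun f j hv d d' hd hd' a b α β hα hβ h =>
        s.lift_eq_of_isCartierObj (f ≫ m) j hv d d' hd hd' a b α β hα hβ h }
  res_id x s := by
    apply BlowUpPoint.ext
    funext y f d hd k
    change s.lift (f ≫ 𝟙 x) d hd k = _
    rw [Category.comp_id]
  res_comp f g s := by
    apply BlowUpPoint.ext
    funext y h d hd k
    change s.lift (h ≫ f ≫ g) d hd k = s.lift ((h ≫ f) ≫ g) d hd k
    rw [Category.assoc]

variable {Z}

lemma lift_res {x x' y : S.obj} (m : x' ⟶ x) (s : BlowUpPoint Z x) (f : y ⟶ x')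
    (d : AffineChart S) (hd : IsSmoothOver S d.obj) (k : y ⟶ d.obj) :
    BlowUpPoint.lift ((blowUpPoints Z).res m s) f d hd k = s.lift (f ≫ m) d hd k := rfl

lemma isSheaf_blowUpPoints (hS : IsFiberedInGroupoids S) : (blowUpPoints Z).IsSheaf := by
  intro x R hR s hs
  change ∀ (y : S.obj) (f : y ⟶ x), R (S.p.map f) → BlowUpPoint Z y at s
  have hQ : ∀ {y : S.obj} (f : y ⟶ x), R.pullback (S.p.map f) ∈
      Scheme.etaleTopology (S.p.obj y) := fun f => Scheme.etaleTopology.pullback_stable _ hR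
  have hmem : ∀ {z y : S.obj} (h : z ⟶ y) (f : y ⟶ x), R.pullback (S.p.map f) (S.p.map h) →
      R (S.p.map (h ≫ f)) := fun h f hh => by rw [Functor.map_comp]; exact hh
  have hcongr : ∀ {y : S.obj} {f f' : y ⟶ x} (_ : f = f') (h : R (S.p.map f))
      (h' : R (S.p.map f')), s y f h = s y f' h' := by rintro y f _ rfl h h'; rfl
  have hres : ∀ {z y : S.obj} (g : z ⟶ y) (f : y ⟶ x) (hf : R (S.p.map f))
      (hgf : R (S.p.map (g ≫ f))) (d : AffineChart S) (hd : IsSmoothOver S d.obj)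
      (k : z ⟶ d.obj), (s z (g ≫ f) hgf).lift (𝟙 z) d hd k = (s y f hf).lift g d hd k :=
    fun g f hf hgf d hd k => by
      rw [hs _ _ g f hf hgf]
      change (s _ f hf).lift (𝟙 _ ≫ g) d hd k = _
      rw [Category.id_comp]
  have hglue : ∀ {y : S.obj} (f : y ⟶ x) (d : AffineChart S) (hd : IsSmoothOver S d.obj)
      (k : y ⟶ d.obj), ∃ G : S.p.obj y ⟶ blowUpScheme (Z.ideal d), ∀ (z : S.obj) (h : z ⟶ y)
      (hh : R (S.p.map (h ≫ f))),
      S.p.map h ≫ G = (s z (h ≫ f) hh).lift (𝟙 z) d hd (h ≫ k) := fun {y} f d hd k => by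
    obtain ⟨G, hG, -⟩ := exists_unique_glue hS (hQ f)
      (fun z h hh => (s z (h ≫ f) (hmem h f hh)).lift (𝟙 z) d hd (h ≫ k))
      (fun z' z g h hh hgh => by
        have h1 : R (S.p.map (g ≫ h ≫ f)) := by
          rw [← Category.assoc]; exact hmem (g ≫ h) f hgh
        rw [hcongr (Category.assoc g h f) _ h1, hres g (h ≫ f) (hmem h f hh), Category.assoc,
          ← BlowUpPoint.lift_comp, Category.comp_id])
    refine ⟨G, fun z h hh => hG z h ?_⟩
    rw [Functor.map_comp] at hh
    exact hh
  choose G hG using @hglue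
  let t : BlowUpPoint Z x :=
    { lift := fun f d hd k => G f d hd k
      lift_blowUpHom := fun f d hd k => hom_ext_of_mem hS (hQ f) fun z h hh => by
        rw [← Category.assoc, hG f d hd k z h (hmem h f hh), BlowUpPoint.lift_blowUpHom,
          toSpec_comp]
      lift_comp := fun g f d hd k => hom_ext_of_mem hS (hQ (g ≫ f)) fun z h hh => by
        have h1 := hmem h _ hh
        have h2 : R (S.p.map ((h ≫ g) ≫ f)) := by rwa [Category.assoc]
        have h3 := hG f d hd k z (h ≫ g) h2
        rw [Functor.map_comp, Category.assoc] at h3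
        rw [hG _ _ _ _ z h h1, h3, hcongr (Category.assoc h g f) h2 h1, Category.assoc]
      lift_eq_of_isCartierObj := fun f j hv d d' hd hd' a b α β hα hβ e =>
        hom_ext_of_mem hS (hQ f) fun z h hh => by
          have h1 := hmem h _ hh
          rw [hG f d' hd' _ z h h1, ← Category.assoc, ← Category.assoc, ← Functor.map_comp]
          refine BlowUpPoint.lift_eq_of_isCartierObj _ _ _ hv d d' hd hd' a b α β hα hβ ?_
          rw [Category.assoc, ← hG f d hd _ z h h1, e, ← Category.assoc, ← Functor.map_comp] }
  refine ⟨t, fun y f hf => ?_, fun t' ht' => ?_⟩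
  · apply BlowUpPoint.ext
    funext z m d hd k
    change G (m ≫ f) d hd k = (s y f hf).lift m d hd k
    have h1 : R (S.p.map (m ≫ f)) := by
      rw [Functor.map_comp]
      exact R.downward_closed hf _
    have h2 : R (S.p.map (𝟙 z ≫ m ≫ f)) := by rwa [Category.id_comp]
    have h3 := hG (m ≫ f) d hd k z (𝟙 z) h2
    rw [CategoryTheory.Functor.map_id, Category.id_comp, hcongr (Category.id_comp _) h2 h1,
      Category.id_comp, hres m f hf h1] at h3
    exact h3
  · change BlowUpPoint Z x at t'
    apply BlowUpPoint.ext
    funext y f d hd k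
    refine hom_ext_of_mem hS (hQ f) fun z h hh => ?_
    have h1 := hmem h _ hh
    rw [← t'.lift_comp]
    change _ = S.p.map h ≫ G f d hd k
    rw [hG f d hd k z h h1, ← ht' z (h ≫ f) h1]
    change _ = t'.lift (𝟙 z ≫ h ≫ f) d hd (h ≫ k)
    rw [Category.id_comp]

/-! ### The canonical point over an object where the center is Cartier -/

/-- If `w` is an atlas of `x ×_S d` over which `Z` is Cartier, then the lift of `w → d` induces the
lift of `v → d` for every other such object `v` over `x` and `d`: compare them on `v ×_{x ×_S d} w`,
which is étale over `v`. -/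
lemma comp_lift_eq_of_isSpanAtlas (hS : IsFiberedInGroupoids S) {x w v y : S.obj}
    {d : AffineChart S} {a : w ⟶ d.obj} {b : w ⟶ x} (h : IsSpanAtlas a b)
    {β₀ : S.p.obj w ⟶ blowUpScheme (Z.ideal d)} (hβ₀ : β₀ ≫ blowUpHom (Z.ideal d) = toSpec d a)
    (hv : IsCartierObj Z v) (q : v ⟶ x) (b' : v ⟶ d.obj)
    {β : S.p.obj v ⟶ blowUpScheme (Z.ideal d)} (hβ : β ≫ blowUpHom (Z.ideal d) = toSpec d b')
    (j : y ⟶ v) (j₀ : y ⟶ w) (e : j ≫ q = j₀ ≫ b) (e' : j ≫ b' = j₀ ≫ a) :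
    S.p.map j ≫ β = S.p.map j₀ ≫ β₀ := by
  obtain ⟨t, l, r, h1, h2, h3, -, h5⟩ := h v b' q
  obtain ⟨m, ⟨rfl, rfl⟩, -⟩ := h5 y j₀ j e'.symm e.symm
  have key : S.p.map r ≫ β = S.p.map l ≫ β₀ := by
    have ht : IsCartierObj Z t := hv.of_flat hS r inferInstance
    refine ht.lift_unique (k := r ≫ b') ?_ ?_
    · rw [Category.assoc, hβ, toSpec_comp]
    · rw [Category.assoc, hβ₀, ← h1, toSpec_comp]
  rw [Functor.map_comp, Category.assoc, key, Functor.map_comp, Category.assoc]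

variable (Z) in
/-- The morphism `G` is the lift to the blow-up of the chart `d` of the projection from `y`, where
`y` maps to the object `x` over which `Z` is Cartier. -/
def IsCanonicalLift {x y : S.obj} (m : y ⟶ x) (d : AffineChart S) (k : y ⟶ d.obj)
    (G : S.p.obj y ⟶ blowUpScheme (Z.ideal d)) : Prop :=
  ∀ (z v : S.obj) (h : z ⟶ y) (_ : IsCartierObj Z v) (q : v ⟶ x) (b : v ⟶ d.obj)
    (β : S.p.obj v ⟶ blowUpScheme (Z.ideal d)) (_ : β ≫ blowUpHom (Z.ideal d) = toSpec d b)
    (j : z ⟶ v), j ≫ q = h ≫ m → j ≫ b = h ≫ k → S.p.map h ≫ G = S.p.map j ≫ β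

lemma IsCanonicalLift.unique (hS : IsFiberedInGroupoids S) {x y : S.obj} (hx : IsCartierObj Z x)
    {m : y ⟶ x} {d : AffineChart S} (hd : IsSmoothOver S d.obj) {k : y ⟶ d.obj}
    {G G' : S.p.obj y ⟶ blowUpScheme (Z.ideal d)} (hG : IsCanonicalLift Z m d k G)
    (hG' : IsCanonicalLift Z m d k G') : G = G' := by
  obtain ⟨w, a, b, hw, hb⟩ := HasProp.exists_isSpanAtlas hd x
  have : Smooth (S.p.map b) := hb
  have hwc : IsCartierObj Z w := hx.of_flat hS b inferInstance
  obtain ⟨β, hβ⟩ := hwc.exists_lift d a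
  obtain ⟨t, l, r, h1, h2, h3, h4, -⟩ := hw y k m
  refine eq_of_etale_surjective hS r h3 h4 ?_
  rw [hG t w r hwc b a β hβ l h2 h1, hG' t w r hwc b a β hβ l h2 h1]

/-- The canonical lift is glued from the lift of an atlas of `x ×_S d`, which is smooth over `x`, so
that `Z` is Cartier over it. -/
lemma exists_isCanonicalLift (hS : IsFiberedInGroupoids S) {x y : S.obj} (hx : IsCartierObj Z x)
    (m : y ⟶ x) (d : AffineChart S) (hd : IsSmoothOver S d.obj) (k : y ⟶ d.obj) :
    ∃ G : S.p.obj y ⟶ blowUpScheme (Z.ideal d), IsCanonicalLift Z m d k G ∧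
      G ≫ blowUpHom (Z.ideal d) = toSpec d k := by
  obtain ⟨w, a, b, hw, hb⟩ := HasProp.exists_isSpanAtlas hd x
  have : Smooth (S.p.map b) := hb
  have hwc : IsCartierObj Z w := hx.of_flat hS b inferInstance
  obtain ⟨β₀, hβ₀⟩ := hwc.exists_lift d a
  obtain ⟨t, l, r, h1, h2, h3, h4, -⟩ := hw y k m
  obtain ⟨G, hG⟩ := exists_glue_of_etale_surjective hS r h3 h4 (S.p.map l ≫ β₀)
    fun z j j' e => by
      rw [← Category.assoc, ← Category.assoc, ← Functor.map_comp, ← Functor.map_comp]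
      refine comp_lift_eq_of_isSpanAtlas hS hw hβ₀ hwc b a hβ₀ _ _ ?_ ?_
      · rw [Category.assoc, Category.assoc, h2, reassoc_of% e]
      · rw [Category.assoc, Category.assoc, h1, reassoc_of% e]
  refine ⟨G, fun z v h hv q b' β hβ j e e' => ?_, eq_of_etale_surjective hS r h3 h4 ?_⟩
  · obtain ⟨z', n, r', hr, hpb⟩ := hS.exists_pullback r h
    have h5 : Etale (S.p.map r') := MorphismProperty.of_isPullback (P := @Etale) hpb h3
    have h6 : Surjective (S.p.map r') := MorphismProperty.of_isPullback (P := @Surjective) hpb h4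
    refine eq_of_etale_surjective hS r' h5 h6 ?_
    rw [← Category.assoc, ← Functor.map_comp, ← hr, Functor.map_comp, Category.assoc, hG,
      ← Category.assoc, ← Functor.map_comp, ← Category.assoc, ← Functor.map_comp]
    refine (comp_lift_eq_of_isSpanAtlas hS hw hβ₀ hv q b' hβ _ _ ?_ ?_).symm
    · rw [Category.assoc, Category.assoc, h2, e, reassoc_of% hr]
    · rw [Category.assoc, Category.assoc, h1, e', reassoc_of% hr]
  · rw [← Category.assoc, hG, Category.assoc, hβ₀, ← toSpec_comp, h1, toSpec_comp]

/-- The blow-up of a chart, as an object of the stack. -/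
lemma exists_blowUpObj (hS : IsFiberedInGroupoids S) (d : AffineChart S) :
    ∃ (x : S.obj) (π : x ⟶ d.obj) (e : S.p.obj x ≅ blowUpScheme (Z.ideal d)),
      e.hom ≫ blowUpHom (Z.ideal d) = toSpec d π ∧ IsCartierObj Z x := by
  obtain ⟨x, π, e, he⟩ := hS.exists_lift_iso d.obj (blowUpHom (Z.ideal d) ≫ d.iso.hom)
  have hπ : e.inv ≫ blowUpHom (Z.ideal d) = toSpec d π := by
    rw [toSpec, Iso.inv_comp_eq, ← Category.assoc, he, Category.assoc, Iso.hom_inv_id,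
      Category.comp_id]
  refine ⟨x, π, e.symm, hπ, isCartierObj_of_isCartierAt hS d π fun t => ?_⟩
  rw [← hπ]
  exact ((becomesCartier_iff _).1 (isSchemeBlowUp_blowUpHom (Z.ideal d)).1 _).comp_flat _

/-- Arrows to the blow-up of a chart are the same as arrows to the chart with a lift. -/
lemma exists_hom_blowUpObj (hS : IsFiberedInGroupoids S) {d : AffineChart S} {x y : S.obj}
    {π : x ⟶ d.obj} {e : S.p.obj x ≅ blowUpScheme (Z.ideal d)}
    (he : e.hom ≫ blowUpHom (Z.ideal d) = toSpec d π) (k : y ⟶ d.obj)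
    {G : S.p.obj y ⟶ blowUpScheme (Z.ideal d)} (hG : G ≫ blowUpHom (Z.ideal d) = toSpec d k) :
    ∃ q : y ⟶ x, S.p.map q ≫ e.hom = G ∧ q ≫ π = k := by
  obtain ⟨q, h1, h2⟩ := hS.exists_factor π k (G ≫ e.inv) (by
    rw [← cancel_mono d.iso.inv, Category.assoc, Category.assoc]
    change G ≫ e.inv ≫ toSpec d π = toSpec d k
    rw [← he, Iso.inv_hom_id_assoc, hG])
  exact ⟨q, by rw [h1, Category.assoc, Iso.inv_hom_id, Category.comp_id], h2⟩

/-- The canonical lifts to the blow-ups of different charts agree. -/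
lemma IsCanonicalLift.eq_of_eq (hS : IsFiberedInGroupoids S) {x y v : S.obj}
    (hx : IsCartierObj Z x) (hv : IsCartierObj Z v) {m : y ⟶ x} {j : y ⟶ v} {d d' : AffineChart S}
    (hd : IsSmoothOver S d.obj) (hd' : IsSmoothOver S d'.obj) {a : v ⟶ d.obj} {b : v ⟶ d'.obj}
    {α : S.p.obj v ⟶ blowUpScheme (Z.ideal d)} {β : S.p.obj v ⟶ blowUpScheme (Z.ideal d')}
    (hα : α ≫ blowUpHom (Z.ideal d) = toSpec d a) (hβ : β ≫ blowUpHom (Z.ideal d') = toSpec d' b)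
    {G : S.p.obj y ⟶ blowUpScheme (Z.ideal d)} {G' : S.p.obj y ⟶ blowUpScheme (Z.ideal d')}
    (hG : IsCanonicalLift Z m d (j ≫ a) G) (hG' : IsCanonicalLift Z m d' (j ≫ b) G')
    (e : G = S.p.map j ≫ α) : G' = S.p.map j ≫ β := by
  obtain ⟨w, a₀, b₀, hw, hb₀⟩ := HasProp.exists_isSpanAtlas hd x
  have : Smooth (S.p.map b₀) := hb₀
  have hwc : IsCartierObj Z w := hx.of_flat hS b₀ inferInstance
  obtain ⟨β₀, hβ₀⟩ := hwc.exists_lift d a₀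
  obtain ⟨t, l, r, h1, h2, h3, h4, -⟩ := hw y (j ≫ a) m
  have hl : S.p.map l ≫ β₀ = S.p.map (r ≫ j) ≫ α := by
    rw [← hG t w r hwc b₀ a₀ β₀ hβ₀ l h2 h1, e, Functor.map_comp, Category.assoc]
  -- both `w` and `v` map to the blow-up of `d`, and these maps agree on `t`
  obtain ⟨xd, π, i, hi, hxd⟩ := exists_blowUpObj (Z := Z) hS d
  obtain ⟨qv, hqv, hqv'⟩ := exists_hom_blowUpObj hS hi a hα
  obtain ⟨qw, hqw, hqw'⟩ := exists_hom_blowUpObj hS hi a₀ hβ₀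
  have hq : l ≫ qw = (r ≫ j) ≫ qv := by
    refine hS.hom_ext π ?_ ?_
    · rw [← cancel_mono i.hom, Functor.map_comp, Category.assoc, hqw, hl, S.p.map_comp (r ≫ j) qv,
        Category.assoc, hqv]
    · rw [Category.assoc, hqw', Category.assoc, hqv', h1, Category.assoc]
  obtain ⟨H, hH, -⟩ := exists_isCanonicalLift hS hxd ((r ≫ j) ≫ qv) d' hd' (r ≫ j ≫ b)
  have hHv : H = S.p.map (r ≫ j) ≫ β := by
    have := hH t v (𝟙 t) hv qv b β hβ (r ≫ j) (by simp) (by simp)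
    rwa [CategoryTheory.Functor.map_id, Category.id_comp] at this
  -- the canonical lift `H` over the blow-up of `d` induces both sides
  obtain ⟨w₁, a₁, b₁, hw₁, hb₁⟩ := HasProp.exists_isSpanAtlas hd' w
  have : Smooth (S.p.map b₁) := hb₁
  have hwc₁ : IsCartierObj Z w₁ := hwc.of_flat hS b₁ inferInstance
  obtain ⟨β₁, hβ₁⟩ := hwc₁.exists_lift d' a₁
  obtain ⟨t', l', r', f1, f2, f3, f4, -⟩ := hw₁ t (r ≫ j ≫ b) l
  have k1 := hH t' w₁ r' hwc₁ (b₁ ≫ qw) a₁ β₁ hβ₁ l' (by rw [reassoc_of% f2, hq]) f1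
  have k2 := hG' t' w₁ (r' ≫ r) hwc₁ (b₁ ≫ b₀) a₁ β₁ hβ₁ l'
    (by rw [reassoc_of% f2, h2, Category.assoc]) (by rw [f1, Category.assoc])
  refine eq_of_etale_surjective hS r h3 h4 (eq_of_etale_surjective hS r' f3 f4 ?_)
  rw [← Category.assoc, ← Functor.map_comp, k2, ← k1, hHv, S.p.map_comp r j, Category.assoc]

/-- The canonical point of the blow-up over an object where the center is Cartier. -/
lemma exists_canonicalPoint (hS : IsFiberedInGroupoids S) {x : S.obj} (hx : IsCartierObj Z x) :
    ∃ s : BlowUpPoint Z x, ∀ {y : S.obj} (m : y ⟶ x) (d : AffineChart S)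
      (hd : IsSmoothOver S d.obj) (k : y ⟶ d.obj), IsCanonicalLift Z m d k (s.lift m d hd k) := by
  choose G hG hG' using fun {y : S.obj} (m : y ⟶ x) (d : AffineChart S)
    (hd : IsSmoothOver S d.obj) (k : y ⟶ d.obj) => exists_isCanonicalLift hS hx m d hd k
  refine ⟨{ lift := fun m d hd k => G m d hd k
            lift_blowUpHom := fun m d hd k => hG' m d hd k
            lift_comp := fun g m d hd k => ?_
            lift_eq_of_isCartierObj := fun f j hv d d' hd hd' a b α β hα hβ e =>
              (hG f d hd (j ≫ a)).eq_of_eq hS hx hv hd hd' hα hβ (hG f d' hd' (j ≫ b)) e },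
    fun m d hd k => hG m d hd k⟩
  refine (hG (g ≫ m) d hd (g ≫ k)).unique hS hx hd fun z v h hv q b β hβ j e e' => ?_
  rw [← Category.assoc, ← Functor.map_comp]
  exact hG m d hd k z v (h ≫ g) hv q b β hβ j (by rw [e, Category.assoc])
    (by rw [e', Category.assoc])

end Points

/-! ### The blow-up of a stack -/

section BlowUpStack

variable {S : CatOverSch.{u}} (Z : ClosedSubstack S)

/-- The blow-up of a stack. -/
def blowUpStack : CatOverSch.{u} := elements (blowUpPoints Z)

/-- The projection of the blow-up. -/
def blowUpProj : BasedFunctor (blowUpStack Z) S := elementsProj (blowUpPoints Z)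

/-- The object of the blow-up given by a point. -/
def blowUpMk (x : S.obj) (s : BlowUpPoint Z x) : (blowUpStack Z).obj :=
  elementsMk (P := blowUpPoints Z) x s

variable {Z}

/-- The point belonging to an object of the blow-up. -/
def blowUpPoint (y : (blowUpStack Z).obj) : BlowUpPoint Z ((blowUpProj Z).obj y) :=
  elementsElt (P := blowUpPoints Z) y

lemma blowUpPoint_lift_map {y y' : (blowUpStack Z).obj} (f : y ⟶ y') {z : S.obj}
    (m : z ⟶ (blowUpProj Z).obj y) (d : AffineChart S) (hd : IsSmoothOver S d.obj)
    (k : z ⟶ d.obj) : (blowUpPoint y').lift (m ≫ (blowUpProj Z).map f) d hd k =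
      (blowUpPoint y).lift m d hd k := by
  have h : (blowUpPoints Z).res ((blowUpProj Z).map f) (blowUpPoint y') = blowUpPoint y :=
    res_elementsProj_map (P := blowUpPoints Z) f
  rw [← h, lift_res]

lemma exists_hom_blowUpStack {y y' : (blowUpStack Z).obj}
    (m : (blowUpProj Z).obj y ⟶ (blowUpProj Z).obj y')
    (h : ∀ (z : S.obj) (n : z ⟶ (blowUpProj Z).obj y) (d : AffineChart S)
      (hd : IsSmoothOver S d.obj) (k : z ⟶ d.obj),
      (blowUpPoint y').lift (n ≫ m) d hd k = (blowUpPoint y).lift n d hd k) :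
    ∃ f : y ⟶ y', (blowUpProj Z).map f = m :=
  ⟨elementsHom (P := blowUpPoints Z) m
    (BlowUpPoint.ext (by funext z n d hd k; exact h z n d hd k)), rfl⟩

lemma blowUpStack_hom_ext {y y' : (blowUpStack Z).obj} {f g : y ⟶ y'}
    (h : (blowUpProj Z).map f = (blowUpProj Z).map g) : f = g := elementsHom_ext h

lemma isStack_blowUpStack (hS : IsStack S) : IsStack (blowUpStack Z) :=
  isStack_elements hS (isSheaf_blowUpPoints hS.toIsFiberedInGroupoids)

/-- Over a smooth chart the blow-up of a stack is the blow-up of the chart: an object of the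
blow-up mapping to a chart maps uniquely to the blow-up of the chart. -/
lemma exists_universal_blowUpStack (hS : IsFiberedInGroupoids S) (c : AffineChart S)
    (hc : IsSmoothOver S c.obj) : ∃ (t : (blowUpStack Z).obj) (π : (blowUpProj Z).obj t ⟶ c.obj)
      (e : S.p.obj ((blowUpProj Z).obj t) ≅ blowUpScheme (Z.ideal c)),
      e.hom ≫ blowUpHom (Z.ideal c) = toSpec c π ∧ IsCartierObj Z ((blowUpProj Z).obj t) ∧
      ∀ (y : (blowUpStack Z).obj) (g : (blowUpProj Z).obj y ⟶ c.obj),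
        ∃! f : y ⟶ t, (blowUpProj Z).map f ≫ π = g := by
  obtain ⟨t, π, e, he, hx, hpt⟩ : ∃ (t : (blowUpStack Z).obj) (π : (blowUpProj Z).obj t ⟶ c.obj)
      (e : S.p.obj ((blowUpProj Z).obj t) ≅ blowUpScheme (Z.ideal c)),
      e.hom ≫ blowUpHom (Z.ideal c) = toSpec c π ∧ IsCartierObj Z ((blowUpProj Z).obj t) ∧
      ∀ {z : S.obj} (m : z ⟶ (blowUpProj Z).obj t) (d : AffineChart S)
        (hd : IsSmoothOver S d.obj) (k : z ⟶ d.obj),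
        IsCanonicalLift Z m d k ((blowUpPoint t).lift m d hd k) := by
    obtain ⟨x, π, e, he, hx⟩ := exists_blowUpObj (Z := Z) hS c
    obtain ⟨s, hs⟩ := exists_canonicalPoint hS hx
    exact ⟨blowUpMk Z x s, π, e, he, hx, hs⟩
  refine ⟨t, π, e, he, hx, fun y g => ?_⟩
  have hself : ∀ {z : S.obj} (m : z ⟶ (blowUpProj Z).obj t),
      (blowUpPoint t).lift m c hc (m ≫ π) = S.p.map m ≫ e.hom := fun {z} m => by
    have h := hpt m c hc (m ≫ π) z _ (𝟙 z) hx (𝟙 _) π e.hom he m (by simp) (by simp)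
    rwa [CategoryTheory.Functor.map_id, Category.id_comp] at h
  -- the lift belonging to `y` is an arrow `q` to the blow-up of the chart; it respects the points,
  -- which can be checked after pulling back to an atlas `w` of the fiber product with `d`
  have hG := (blowUpPoint y).lift_blowUpHom (𝟙 _) c hc g
  obtain ⟨q, hq, hqπ⟩ := exists_hom_blowUpObj hS he g hG
  have hlift : ∀ {z : S.obj} (n : z ⟶ (blowUpProj Z).obj y),
      (blowUpPoint y).lift n c hc (n ≫ g) = S.p.map (n ≫ q) ≫ e.hom := fun n => by
    have := (blowUpPoint y).lift_comp n (𝟙 _) c hc g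
    rw [Category.comp_id] at this
    rw [this, ← hq, Functor.map_comp, Category.assoc]
  obtain ⟨f, hf⟩ := exists_hom_blowUpStack (y := y) (y' := t) q
    fun z n d hd k => by
      obtain ⟨w, a, b, hw, hb⟩ := HasProp.exists_isSpanAtlas hd ((blowUpProj Z).obj t)
      have : Smooth (S.p.map b) := hb
      have hwc : IsCartierObj Z w := hx.of_flat hS b inferInstance
      obtain ⟨β, hβ⟩ := hwc.exists_lift d a
      obtain ⟨t', l, r, h1, h2, h3, h4, -⟩ := hw z k (n ≫ q)
      refine eq_of_etale_surjective hS r h3 h4 ?_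
      rw [hpt (n ≫ q) d hd k t' w r hwc b a β hβ l h2 h1, ← BlowUpPoint.lift_comp, ← h1]
      refine ((blowUpPoint y).lift_eq_of_isCartierObj (r ≫ n) l hwc c d hc hd (b ≫ π) a
        (S.p.map b ≫ e.hom) β ?_ hβ ?_).symm
      · rw [Category.assoc, he, toSpec_comp]
      · have h5 : l ≫ b ≫ π = (r ≫ n) ≫ g := by
          rw [reassoc_of% h2, hqπ, Category.assoc]
        rw [h5, hlift, Category.assoc, ← h2, Functor.map_comp, Category.assoc]
  refine ⟨f, (congrArg (· ≫ π) hf).trans hqπ, fun f' hf' => blowUpStack_hom_ext ?_⟩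
  rw [hf]
  refine hS.hom_ext π ?_ (hf'.trans hqπ.symm)
  change (blowUpProj Z).map f' ≫ π = g at hf'
  rw [← cancel_mono e.hom, hq, ← hself, hf']
  have := blowUpPoint_lift_map f' (𝟙 _) c hc g
  rw [Category.id_comp] at this
  exact this

lemma IsSchemeBlowUp.of_iso {A : CommRingCat.{u}} {I : Ideal A} {B B' : Scheme.{u}}
    {b : B ⟶ Spec A} (h : IsSchemeBlowUp I b) (e : B' ≅ B) : IsSchemeBlowUp I (e.hom ≫ b) := by
  obtain ⟨h1, h2⟩ := h
  refine ⟨(becomesCartier_iff _).2 fun t => ((becomesCartier_iff _).1 h1 _).comp_flat _,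
    fun T f hf => ?_⟩
  obtain ⟨g, hg, hg'⟩ := h2 T f hf
  refine ⟨g ≫ e.inv, by simp [hg], fun k hk => ?_⟩
  rw [← hg' (k ≫ e.hom) (by simpa using hk)]
  simp

lemma isBlowUp_blowUpProj (hS : IsStack S) : IsBlowUp (blowUpProj Z) Z where
  isStack := isStack_blowUpStack hS
  isBlowUp c hc := by
    obtain ⟨t, π, e, he, -, ht⟩ :=
      exists_universal_blowUpStack (Z := Z) hS.toIsFiberedInGroupoids c hc
    refine ⟨CostructuredArrow.mk (S := (blowUpProj Z).toFunctor) (Y := t) π, ⟨?_⟩, ?_⟩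
    · choose f hf hf' using ht
      exact IsTerminal.ofUniqueHom (fun y => CostructuredArrow.homMk (f y.left y.hom) (hf _ _))
        fun y m => by
          ext
          exact hf' _ _ _ (CostructuredArrow.w m)
    · have h := (isSchemeBlowUp_blowUpHom (Z.ideal c)).of_iso e
      rw [he] at h
      exact h

end BlowUpStack

/-! ### The strict transform -/

section StrictTransform

variable {S : CatOverSch.{u}} {Z : ClosedSubstack S}

/-- Arrows lift to the blow-up.  The object is only propositionally equal to `v`, so that it can be
substituted for `v`. -/
lemma exists_lift_blowUpStack {v : S.obj} (y : (blowUpStack Z).obj)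
    (b : v ⟶ (blowUpProj Z).obj y) : ∃ (x : (blowUpStack Z).obj) (h : (blowUpProj Z).obj x = v)
      (φ : x ⟶ y), (blowUpProj Z).map φ = eqToHom h ≫ b := by
  refine ⟨blowUpMk Z v ((blowUpPoints Z).res b (blowUpPoint y)), rfl, ?_⟩
  obtain ⟨f, hf⟩ := exists_hom_blowUpStack
    (y := blowUpMk Z v ((blowUpPoints Z).res b (blowUpPoint y))) (y' := y) b
    fun z n d hd k => (lift_res b (blowUpPoint y) n d hd k).symm
  exact ⟨f, hf.trans (Category.id_comp b).symm⟩

lemma exists_factor_blowUpStack {x y z : (blowUpStack Z).obj} (φ : y ⟶ x) (ψ : z ⟶ x)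
    (m : (blowUpProj Z).obj z ⟶ (blowUpProj Z).obj y)
    (h : m ≫ (blowUpProj Z).map φ = (blowUpProj Z).map ψ) :
    ∃ f : z ⟶ y, (blowUpProj Z).map f = m ∧ f ≫ φ = ψ := by
  obtain ⟨f, hf⟩ := exists_hom_blowUpStack m fun t n d hd k => by
    rw [← blowUpPoint_lift_map φ, Category.assoc, h, blowUpPoint_lift_map ψ]
  exact ⟨f, hf, blowUpStack_hom_ext (by rw [(blowUpProj Z).map_comp f φ, hf, h])⟩

/-- Over the blow-up of a stack the center becomes a Cartier divisor: an object that is smooth over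
the blow-up has a smooth covering on which this can be seen.  Let `t₀` be the blow-up of the atlas
`d`.  The fiber product of `c` and `t₀` over the blow-up is also that of `proj c` and `d` over `S`.
Hence it is smooth over `t₀` as well as smooth and surjective over `c`. -/
lemma exists_cartier_cover (hS : IsFiberedInGroupoids S) {d : AffineChart S}
    (hd : IsSmoothAtlas S d.obj) {c : (blowUpStack Z).obj} (hc : IsSmoothOver (blowUpStack Z) c) :
    ∃ (t : S.obj) (m : t ⟶ (blowUpProj Z).obj c), Smooth (S.p.map m) ∧ Surjective (S.p.map m) ∧
      IsCartierObj Z t := by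
  obtain ⟨t₀, π, -, -, ht₀, hπ⟩ := exists_universal_blowUpStack (Z := Z) hS d hd.isSmoothOver
  have huniq : ∀ {y : (blowUpStack Z).obj} {f g : y ⟶ t₀},
      (blowUpProj Z).map f ≫ π = (blowUpProj Z).map g ≫ π → f = g := fun {y f g} h =>
    (hπ y ((blowUpProj Z).map g ≫ π)).unique h rfl
  -- an atlas `v` of the fiber product of `proj c` and `d`, with its structure over the blow-up
  obtain ⟨v, av, bv, hv, hbv, hbv'⟩ := hd.exists_isSpanAtlas ((blowUpProj Z).obj c)
  obtain ⟨v, rfl, φ, hφ⟩ := exists_lift_blowUpStack c bv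
  rw [eqToHom_refl, Category.id_comp] at hφ
  obtain ⟨f, hf, -⟩ := hπ v av
  -- an atlas `w` of the fiber product of `c` and `t₀`; then `t` and `u` are both the product of
  -- the two atlases, formed over the blow-up and over `S`
  obtain ⟨w, a, b, hw, hb⟩ := HasProp.exists_isSpanAtlas hc t₀
  have hb' : Smooth (S.p.map ((blowUpProj Z).map b)) := hb
  obtain ⟨t, l, r, h1, h2, h3, h4, h5⟩ := hw v φ f
  have h3' : Etale (S.p.map ((blowUpProj Z).map r)) := h3
  have h4' : Surjective (S.p.map ((blowUpProj Z).map r)) := h4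
  have h1' := congrArg (blowUpProj Z).map h1
  have h2' := congrArg (blowUpProj Z).map h2
  rw [(blowUpProj Z).map_comp, (blowUpProj Z).map_comp] at h1' h2'
  obtain ⟨u, l', r', e1, e2, e3, e4, e5⟩ :=
    hv ((blowUpProj Z).obj w) ((blowUpProj Z).map b ≫ π) ((blowUpProj Z).map a)
  obtain ⟨u, rfl, ρ, hρ⟩ := exists_lift_blowUpStack w r'
  rw [eqToHom_refl, Category.id_comp] at hρ
  obtain ⟨μ, hμ, hμφ⟩ := exists_factor_blowUpStack φ (ρ ≫ a) l'
    (by rw [hφ, e2, (blowUpProj Z).map_comp, hρ])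
  have hμf : μ ≫ f = ρ ≫ b := huniq (by
    rw [(blowUpProj Z).map_comp, (blowUpProj Z).map_comp, Category.assoc, hf, hμ, e1, hρ,
      Category.assoc])
  obtain ⟨m, ⟨hm1, hm2⟩, -⟩ := h5 u ρ μ hμφ.symm hμf.symm
  obtain ⟨n, ⟨hn1, hn2⟩, -⟩ := e5 _ ((blowUpProj Z).map r) ((blowUpProj Z).map l)
    (by rw [← hf, ← Category.assoc, ← h2', Category.assoc]) (by rw [← hφ, h1'])
  obtain ⟨N, hN, hNρ⟩ := exists_factor_blowUpStack ρ l n (by rw [hρ, hn2])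
  have hNμ : N ≫ μ = r := blowUpStack_hom_ext (by rw [(blowUpProj Z).map_comp, hN, hμ, hn1])
  have hNm : N ≫ m = 𝟙 _ := (h5 t l r h1 h2).unique
    ⟨by rw [Category.assoc, hm1, hNρ], by rw [Category.assoc, hm2, hNμ]⟩
    ⟨Category.id_comp _, Category.id_comp _⟩
  have hmN : (blowUpProj Z).map (m ≫ N) = 𝟙 _ := (e5 _ l' r' e1 e2).unique
    ⟨by rw [← hμ, ← (blowUpProj Z).map_comp, Category.assoc, hNμ, hm2],
      by rw [← hρ, ← (blowUpProj Z).map_comp, Category.assoc, hNρ, hm1]⟩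
    ⟨Category.id_comp _, Category.id_comp _⟩
  have hiso : IsIso ((blowUpProj Z).map N) :=
    ⟨(blowUpProj Z).map m, by rw [← (blowUpProj Z).map_comp, hNm, (blowUpProj Z).map_id],
      by rw [← (blowUpProj Z).map_comp, hmN]⟩
  have hwC : IsCartierObj Z ((blowUpProj Z).obj w) :=
    ht₀.of_flat hS ((blowUpProj Z).map b) inferInstance
  have hr' : Etale (S.p.map r') := e3
  have huC : IsCartierObj Z ((blowUpProj Z).obj u) := hwC.of_flat hS r' inferInstance
  have hbv1 : Smooth (S.p.map bv) := hbv
  refine ⟨_, (blowUpProj Z).map r ≫ bv, ?_, ?_,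
    huC.of_flat hS ((blowUpProj Z).map N) inferInstance⟩
  · rw [Functor.map_comp]; infer_instance
  · rw [Functor.map_comp]; infer_instance

/-- A smooth covering of a chart by an object over which `Z` is Cartier is refined by a chart. -/
lemma exists_affine_cartier_cover (hS : IsFiberedInGroupoids S) (c : AffineChart S) {t : S.obj}
    (m : t ⟶ c.obj) (hm : Smooth (S.p.map m)) (hm' : Surjective (S.p.map m))
    (ht : IsCartierObj Z t) : ∃ (e : AffineChart S) (f : e ⟶ c),
      (AffineChart.ringMap f).FaithfullyFlat ∧ IsCartierObj Z e.obj := by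
  have : CompactSpace (S.p.obj c.obj) := c.iso.hom.homeomorph.compactSpace
  obtain ⟨B, g, hg, hg'⟩ := exists_affine_refinement (S.p.map m)
  obtain ⟨y, n, i, hi⟩ := hS.exists_lift_iso t g
  have hn : S.p.map n = i.inv ≫ g := by rw [← hi]; simp
  have hn' : Etale (S.p.map n) := by rw [hn]; infer_instance
  refine ⟨⟨y, B, i⟩, AffineChart.mkHom (n ≫ m), ?_, ht.of_flat hS n inferInstance⟩
  rw [AffineChart.faithfullyFlat_iff, AffineChart.homOf_mkHom]
  constructor
  · rw [Functor.map_comp]; infer_instance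
  · rw [Functor.map_comp, hn, Category.assoc]; infer_instance

lemma Ideal.eq_span_singleton_of_map_evalRingHom {ι : Type*} [Finite ι] {R : ι → Type*}
    [∀ i, CommRing (R i)] (I : Ideal (∀ i, R i)) (a : ∀ i, R i)
    (h : ∀ i, I.map (Pi.evalRingHom R i) = Ideal.span {a i}) : I = Ideal.span {a} := by
  classical
  have := Fintype.ofFinite ι
  have hsurj : ∀ i, Function.Surjective (Pi.evalRingHom R i) := fun i => Function.surjective_eval i
  apply le_antisymm
  · intro x hx
    have hx' : ∀ i, a i ∣ x i := fun i => by
      rw [← Ideal.mem_span_singleton, ← h]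
      exact Ideal.mem_map_of_mem (Pi.evalRingHom R i) hx
    choose y hy using hx'
    exact Ideal.mem_span_singleton.2 ⟨y, funext hy⟩
  · rw [Ideal.span_singleton_le_iff_mem]
    have hx : ∀ i, ∃ x ∈ I, x i = a i := fun i =>
      (Ideal.mem_map_iff_of_surjective (Pi.evalRingHom R i) (hsurj i)).1
        (h i ▸ Ideal.mem_span_singleton_self (a i))
    choose x hxI hxa using hx
    have : a = ∑ i, Pi.single i 1 * x i := by
      funext j
      rw [Finset.sum_apply, Finset.sum_eq_single j]
      · simp [hxa]
      · intro i _ hij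
        simp [hij.symm]
      · simp
    rw [this]
    exact Ideal.sum_mem _ fun i _ => Ideal.mul_mem_left _ _ (hxI i)

/-- A chart over which the center becomes a Cartier divisor is covered by a chart over which it is
defined by a single nonzerodivisor. -/
lemma exists_principal_cover (hS : IsFiberedInGroupoids S) (e : AffineChart S)
    (he : IsCartierObj Z e.obj) : ∃ (e' : AffineChart S) (f : e' ⟶ e),
      (AffineChart.ringMap f).FaithfullyFlat ∧ ∃ a ∈ nonZeroDivisors e'.ring,
        Z.ideal e' = Ideal.span {a} := by
  have key : ∀ q : PrimeSpectrum e.ring, ∃ (c : AffineChart S) (f : c ⟶ e),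
      IsOpenImmersion (S.p.map (AffineChart.homOf f)) ∧
      (∃ p, PrimeSpectrum.comap (AffineChart.ringMap f) p = q) ∧
      ∃ a ∈ nonZeroDivisors c.ring, Z.ideal c = Ideal.span {a} := fun q => by
    obtain ⟨c, m, hm, ⟨s, hs⟩, h⟩ := he (e.pt q)
    obtain ⟨p, rfl⟩ := c.pt_bijective.2 s
    refine ⟨c, AffineChart.mkHom m, hm, ⟨p, e.pt_bijective.1 ?_⟩, h⟩
    rw [← AffineChart.map_pt]
    exact hs
  choose c f hf hq a ha hI using key
  have ho : ∀ q, IsOpen (Set.range (PrimeSpectrum.comap (AffineChart.ringMap (f q)))) := fun q => by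
    have h := AffineChart.hom_comm (f q)
    have h1 : IsOpenImmersion (Spec.map (CommRingCat.ofHom (AffineChart.ringMap (f q)))) := by
      have : Spec.map (CommRingCat.ofHom (AffineChart.ringMap (f q))) =
          (c q).iso.hom ≫ S.p.map (AffineChart.homOf (f q)) ≫ e.iso.inv := by
        rw [← reassoc_of% h, Iso.hom_inv_id, Category.comp_id]
      rw [this]
      infer_instance
    exact (Spec.map (CommRingCat.ofHom (AffineChart.ringMap (f q)))).isOpenEmbedding.isOpen_range
  obtain ⟨t, ht⟩ := isCompact_univ.elim_finite_subcover _ ho fun q _ =>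
    Set.mem_iUnion.2 ⟨q, hq q⟩
  -- the disjoint union of finitely many charts is the spectrum of the product of their rings
  let R : t → Type u := fun i => (c i.1).ring
  let φ : e.ring →+* ∀ i, R i := RingHom.pi fun i => AffineChart.ringMap (f i.1)
  have hφ : φ.FaithfullyFlat := by
    rw [RingHom.FaithfullyFlat.iff_flat_and_comap_surjective]
    constructor
    · let := φ.toAlgebra
      let (i : t) : Algebra e.ring (R i) := (AffineChart.ringMap (f i.1)).toAlgebra
      have (i : t) : Module.Flat e.ring (R i) :=
        (AffineChart.flat_iff (f i.1)).2 inferInstance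
      change Module.Flat e.ring (∀ i, R i)
      classical
      have := Fintype.ofFinite t
      exact Module.Flat.of_linearEquiv (DirectSum.linearEquivFunOnFintype e.ring t R).symm
    · intro q
      obtain ⟨i, hi, p, hp⟩ := Set.mem_iUnion₂.1 (ht (Set.mem_univ q))
      refine ⟨PrimeSpectrum.comap (Pi.evalRingHom R ⟨i, hi⟩) p, ?_⟩
      rw [← hp, ← PrimeSpectrum.comap_comp_apply]
      rfl
  obtain ⟨x, i, g, hg⟩ := e.exists_of_ringHom hS (B := CommRingCat.of (∀ i, R i))
    (CommRingCat.ofHom φ)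
  refine ⟨_, g, ?_, fun i => a i.1, ?_, ?_⟩
  · rw [hg]; exact hφ
  · rw [mem_nonZeroDivisors_iff_right]
    intro y hy
    funext i
    exact (mem_nonZeroDivisors_iff_right.1 (ha i.1)) _ (congrFun hy i)
  · rw [← Z.map_eq g, hg]
    apply Ideal.eq_span_singleton_of_map_evalRingHom
    intro i
    rw [Ideal.map_map, ← hI, ← Z.map_eq (f i.1)]
    rfl

end StrictTransform

open TensorProduct in
/-- Local freeness descends along faithfully flat ring homomorphisms. -/
lemma LocallyFreeWithRanks.of_faithfullyFlat {A B M N : Type*} [CommRing A] [CommRing B]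
    [Algebra A B] [AddCommGroup M] [Module A M] [AddCommGroup N] [Module A N] [Module B N]
    [IsScalarTower A B N] [Module.FaithfullyFlat A B] {h : M →ₗ[A] N} (hh : IsBaseChange B h)
    {Δ : Set ℕ} (hN : LocallyFreeWithRanks B N Δ) : LocallyFreeWithRanks A M Δ := by
  obtain ⟨_, _, -⟩ := id hN
  have : Module.FinitePresentation B N := Module.finitePresentation_of_projective B N
  have : Module.FinitePresentation B (B ⊗[A] M) :=
    Module.FinitePresentation.of_equiv hh.equiv.symm
  have : Module.FinitePresentation A M := finitePresentation_of_tensorProduct (B := B)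
  refine locallyFreeWithRanks_of_freeAt fun p => ?_
  obtain ⟨q, rfl⟩ := PrimeSpectrum.comap_surjective_of_faithfullyFlat (A := A) (B := B) p
  obtain ⟨δ, hδ, hq⟩ := hN.exists_freeAt q
  exact ⟨δ, hδ, hq.of_flat hh⟩

section StrictTransform

variable {S : CatOverSch.{u}}

/-- On a chart over which the center becomes a Cartier divisor after a faithfully flat extension,
the quotient of `F` by the sections that vanish on the free locus is locally free. -/
lemma locallyFreeWithRanks_of_cartier_cover (hS : IsNoetherianStack S) {F : QCohModule S}
    (hF : F.IsCoherent) (Δ : Set ℕ) {c e : AffineChart S} (f : e ⟶ c)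
    (hf : (AffineChart.ringMap f).FaithfullyFlat) (he : IsCartierObj (center S F Δ) e.obj) :
    LocallyFreeWithRanks c.ring
      (F.obj c ⧸ vanishingOn c.ring (F.obj c) ((F.freeLocus Δ).opens c)) Δ := by
  have hS' := hS.toIsFiberedInGroupoids
  obtain ⟨d, hd, hd'⟩ := hS.exists_noetherian_atlas
  have hd₁ := hd.isSmoothOver.isFlatOver
  obtain ⟨e₁, f₁, hf₁, a, ha, hI⟩ := exists_principal_cover hS' e he
  obtain ⟨e₂, f₂, k, hf₂, -⟩ := exists_cover_of_isSmoothAtlas hS' hd e₁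
  let g : e₂ ⟶ c := f₂ ≫ f₁ ≫ f
  have hg : (AffineChart.ringMap g).FaithfullyFlat :=
    RingHom.FaithfullyFlat.stableUnderComposition _ _
      (RingHom.FaithfullyFlat.stableUnderComposition _ _ hf hf₁) hf₂
  have hI' : (center S F Δ).ideal e₂ = Ideal.span {AffineChart.ringMap f₂ a} := by
    rw [← ClosedSubstack.map_eq _ f₂, hI, Ideal.map_span, Set.image_singleton]
  have hU : ∀ q, q ∈ (F.freeLocus Δ).opens e₂ ↔ AffineChart.ringMap f₂ a ∉ q.asIdeal := fun q => by
    have h := congrArg (q ∈ ·) (zeroLocus_center hS hF Δ e₂)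
    rw [eq_iff_iff, PrimeSpectrum.mem_zeroLocus, SetLike.coe_subset_coe, hI',
      Ideal.span_singleton_le_iff_mem, Set.mem_compl_iff, SetLike.mem_coe] at h
    rw [h, not_not]
  -- the algebraic result applies to the chart `e₂`, which maps to the noetherian atlas `d`
  have key : LocallyFreeWithRanks e₂.ring
      (F.obj e₂ ⧸ vanishingOn e₂.ring (F.obj e₂) ((F.freeLocus Δ).opens e₂)) Δ := by
    let := (AffineChart.ringMap k).toAlgebra
    have := hF d
    obtain ⟨_, _, h, hh⟩ := F.exists_isBaseChange k
    refine locallyFreeWithRanks_quotient hh (V := fun δ => (F.freeLocus {δ}).opens d)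
      (fun δ p hp => ?_) (mem_nonZeroDivisors_of_flat hf₂.flat ha) ?_ hU
    · simpa using (mem_freeLocus_iff hS hF hd₁ hd' p).1 hp
    · rw [← hI', ← ClosedSubstack.map_eq _ k, center_ideal_eq hS hF Δ hd₁ hd']
      rfl
  let := (AffineChart.ringMap g).toAlgebra
  have : Module.FaithfullyFlat c.ring e₂.ring := hg
  obtain ⟨_, _, h, hh⟩ := F.exists_isBaseChange g
  obtain ⟨n, x, hx⟩ := Submodule.fg_iff_exists_fin_generating_family.1 (center_ideal_fg hS F Δ c)
  have hV : ∀ p, p ∈ (F.freeLocus Δ).opens c ↔ ∃ i, x i ∉ p.asIdeal := fun p => by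
    have h := congrArg (p ∈ ·) (zeroLocus_center hS hF Δ c)
    rw [eq_iff_iff, PrimeSpectrum.mem_zeroLocus, SetLike.coe_subset_coe, ← hx,
      Submodule.span_le, Set.range_subset_iff, Set.mem_compl_iff, SetLike.mem_coe] at h
    rw [← not_iff_not, ← h]
    simp
  obtain ⟨h', hh'⟩ := isBaseChange_mapQ hh _ _
    (vanishingOn_baseChange hh hV fun q => (F.freeLocus Δ).mem_iff g q)
  exact key.of_faithfullyFlat hh'

lemma strictTransformLocallyFree_blowUpProj (hS : IsNoetherianStack S) {F : QCohModule S}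
    (hF : F.IsCoherent) (Δ : Set ℕ) :
    F.StrictTransformLocallyFree (blowUpProj (center S F Δ)) (F.freeLocus Δ) Δ := by
  intro c hc
  obtain ⟨d, hd, -⟩ := hS.exists_noetherian_atlas
  obtain ⟨t, m, hm, hm', ht⟩ := exists_cartier_cover hS.toIsFiberedInGroupoids hd hc
  obtain ⟨e, f, hf, he⟩ := exists_affine_cartier_cover hS.toIsFiberedInGroupoids
    (c.push (blowUpProj (center S F Δ))) m hm hm' ht
  exact locallyFreeWithRanks_of_cartier_cover hS hF Δ f hf he

end StrictTransform

end Flatify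

end

theorem propositionP :
    ∃ Z : ∀ S : Flatify.CatOverSch.{u}, Flatify.QCohModule S → Set ℕ → Flatify.ClosedSubstack S,
      (∀ (S : Flatify.CatOverSch.{u}) (F : Flatify.QCohModule S) (Δ : Set ℕ),
        Flatify.IsNoetherianStack S → F.IsCoherent →
          IsGreatest {V : Flatify.OpenSubstack S | F.IsLocallyFreeOn V Δ} (F.freeLocus Δ) ∧
          (∀ c : Flatify.AffineChart S, ((Z S F Δ).ideal c).FG) ∧
          (∀ c : Flatify.AffineChart S,
            PrimeSpectrum.zeroLocus ((Z S F Δ).ideal c : Set c.ring) =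
              ((F.freeLocus Δ).opens c : Set (PrimeSpectrum c.ring))ᶜ) ∧
          (∀ c : Flatify.AffineChart S, Flatify.IsSmoothOver S c.obj →
            (Z S F Δ).ideal c = F.centerIdeal Δ c) ∧
          ∃ (S' : Flatify.CatOverSch.{u}) (π : CategoryTheory.BasedFunctor S' S),
            Flatify.IsBlowUp π (Z S F Δ) ∧
              F.StrictTransformLocallyFree π (F.freeLocus Δ) Δ) ∧
      (∀ (S S' : Flatify.CatOverSch.{u}) (g : CategoryTheory.BasedFunctor S' S)
        (F : Flatify.QCohModule S) (F' : Flatify.QCohModule S') (Δ : Set ℕ),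
        Flatify.IsNoetherianStack S → Flatify.IsNoetherianStack S' → Flatify.IsFlatMorphism g →
          F.IsCoherent → F'.IsIsomorphic (F.pullback g) →
            Z S' F' Δ = (Z S F Δ).pullback g) := by
  refine ⟨Flatify.center, fun S F Δ hS hF => ⟨Flatify.isGreatest_freeLocus hS hF Δ,
    Flatify.center_ideal_fg hS F Δ, Flatify.zeroLocus_center hS hF Δ,
    fun c hc => Flatify.center_ideal_eq hS hF Δ hc.isFlatOver
      (Flatify.isNoetherianRing_of_isSmoothOver hS hc),
    _, Flatify.blowUpProj _, Flatify.isBlowUp_blowUpProj hS.toIsStack,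
    Flatify.strictTransformLocallyFree_blowUpProj hS hF Δ⟩, ?_⟩
  intro S S' g F F' Δ hS hS' hg hF e
  exact Flatify.center_pullback g Δ hS hS' hg hF e
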